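/- Let $G,K,M\ge 1$ and $U,L\ge 0$ be integers with $U+L<M$. Given are angles $\theta_{g,t}\in\mathbb R$ and desired beam-pattern values $\mathcal D(\theta_{g,t})\in\mathbb R$ ($1\le g\le G$, $1\le t\le K$), an antenna spacing $d>0$ and a carrier wavelength $\lambda>0$, positive semidefinite channel matrices $\mathbf H_{s,i}$ ($1\le i\le U$) and $\mathbf H_{p,l}$ ($1\le l\le L$) in $\mathbb C^{M\times M}$, noise variances $\sigma_i^2\ge 0$, SINR targets $\eta_i>0$, a power budget $P_m>0$ and an interference threshold $I_{\rm thres}>0$. Let $\mathbf a(\theta)$ be the steering vector with $\mathbf a(\theta)^H=[1,e^{j2\pi\frac d\lambda\sin\theta},\dots,e^{j2\pi\frac{d(M-1)}\lambda\sin\theta}]$. Consider the convex semidefinite program $$\min_{\mathbf F_1,\dots,\mathbf F_U,\ \mathbf V_1,\dots,\mathbf V_M,\ \omega}\ \mathbf r^H\mathbf\Omega\,\mathbf r=\frac1G\sum_{g=1}^G\sum_{t=1}^K\bigl|\omega\,\mathcal D(\theta_{g,t})-\mathbf a(\theta_{g,t})^H\mathbf R\,\mathbf a(\theta_{g,t})\bigr|^2,\qquad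 \mathbf R=\sum_{i=1}^U\mathbf F_i+\sum_{t=1}^M\mathbf V_t,\quad \mathbf r=\begin{bmatrix}\omega\\ \mathrm{vec}(\mathbf R)\end{bmatrix},$$ over Hermitian $\mathbf F_i\succeq0$, $\mathbf V_t\succeq0$ and real $\omega$, subject to $$\Bigl(1+\tfrac1{\eta_i}\Bigr)\mathrm{Tr}(\mathbf H_{s,i}^H\mathbf F_i)-\sum_{j}\mathrm{Tr}(\mathbf H_{s,i}^H\mathbf F_j)-\sum_t\mathrm{Tr}(\mathbf H_{s,i}^H\mathbf V_t)-\sigma_i^2\ge0\quad(1\le i\le U),$$ $$\mathbf R_{m,m}\le \frac{P_m}M\quad(1\le m\le M),\qquad \sum_j\mathrm{Tr}(\mathbf H_{p,l}\mathbf F_j)+\sum_t\mathrm{Tr}(\mathbf H_{p,l}\mathbf V_t)\le I_{\rm thres}\quad(1\le l\le L).$$ Let $B$ be the sum of the logarithms of the slacks of all the scalar inequality constraints and of $\log\det\mathbf F_i$ and $\log\det\mathbf V_t$ for all $i$ and $t$. A run of the barrier method from a strictly feasible point $x_0$ is a finite sequence of strictly feasible points $x_0,\dots,x_T$ in which each $x_{k+1}=x_k+s_kd_k$,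 with $0<s_k\le1$ and $d_k$ a Newton direction at $x_k$ (a solution of the Newton system) for $\mathbf r^H\mathbf\Omega\mathbf r-\frac1{\tau_k}B$, where the parameters $\tau_k>0$ are nondecreasing. Then the program can be solved by the barrier method with on the order of $GKM^{8.5}$ operations for a fixed accuracy. Precisely: there is an absolute constant $C>0$ such that for all $G,K,M,U,L$ as above and all integers $b\ge0$ there is an arithmetic program (a fixed sequence of real operations $+,-,\times,\div,\sqrt{\cdot}$, comparisons with selection, and loading of rational constants) that performs at most $C\,GKM^{8.5}\,(b+1)$ operations and does the following. Its inputs are the problem data (the angles enter through the entries of the steering vectors $\mathbf a(\theta_{g,t})$), a strictly feasible point $x_0$ and a tolerance $\varepsilon>0$. Whenever the objective value at $x_0$ is at most $2^b\varepsilon$ and the point $x_0+2^{-b}(x_0-y)$ is feasible for every feasible $y$, the program divides by no zero and takes no square root of a negative number, and it computes all the iterates of a run $x_0,\dots,x_T$ of the barrier method from $x_0$ (with $T$ depending only on $G,K,M,U,L,b$) whose last point $x_T$ is optimal up to $\varepsilon$: its objective value is at most $\varepsilon$ plus the objective value of any feasible point. -/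

import Mathlib

open scoped ComplexOrder

noncomputable section

namespace DFRC

/-! ### The relaxed beamforming problem -/

/-- Complex square matrices of size `M`. -/
abbrev CMat (M : ℕ) : Type := Matrix (Fin M) (Fin M) ℂ

/-- Data of the cognitive dual-function radar-communication beamforming problem: `G` angle samples
for each of `K` targets, `M` antennas, `U` secondary users and `L` primary users. -/
structure ProblemData (G K M U L : ℕ) where
  /-- the sampled angles `θ_{g,t}` (in radians) -/
  angle : Fin G → Fin K → ℝ
  /-- the antenna spacing `d` -/
  spacing : ℝ
  /-- the carrier wavelength -/
  wavelength : ℝ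
  /-- the desired beam pattern `𝒟(θ_{g,t})` -/
  desired : Fin G → Fin K → ℝ
  /-- the channel matrices `H_{s,i}` of the secondary users -/
  chanS : Fin U → CMat M
  /-- the channel matrices `H_{p,l}` of the primary users -/
  chanP : Fin L → CMat M
  /-- the noise variances `σ_i²` -/
  noise : Fin U → ℝ
  /-- the required signal-to-interference-plus-noise ratios `η_i` -/
  sinr : Fin U → ℝ
  /-- the transmit power budget `P_m` -/
  power : ℝ
  /-- the interference threshold `I_thres` -/
  thres : ℝ
  spacing_pos : 0 < spacing
  wavelength_pos : 0 < wavelength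
  chanS_psd : ∀ i, (chanS i).PosSemidef
  chanP_psd : ∀ l, (chanP l).PosSemidef
  noise_nonneg : ∀ i, 0 ≤ noise i
  sinr_pos : ∀ i, 0 < sinr i
  power_pos : 0 < power
  thres_pos : 0 < thres

/-- The optimization variables `(F_1,…,F_U)`, `(V_1,…,V_M)` and the scaling factor `ω`. -/
abbrev Point (M U : ℕ) : Type := (Fin U → CMat M) × (Fin M → CMat M) × ℝ

/-- The covariance matrix `R = ∑ F_i + ∑ V_t`. -/
def cov {M U : ℕ} (x : Point M U) : CMat M := ∑ i, x.1 i + ∑ t, x.2.1 t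

/-- The stacked vector `r = [ω; vec R]`. -/
def stacked {M U : ℕ} (x : Point M U) : Unit ⊕ (Fin M × Fin M) → ℂ :=
  Sum.elim (fun _ => (x.2.2 : ℂ)) (fun p => cov x p.1 p.2)

/-- All matrix variables are Hermitian. -/
def IsHermitianPoint {M U : ℕ} (x : Point M U) : Prop :=
  (∀ i, (x.1 i).IsHermitian) ∧ ∀ t, (x.2.1 t).IsHermitian

namespace ProblemData

variable {G K M U L : ℕ}

/-- The steering vector `a(θ)`, with `a(θ)ᴴ = [1, e^{j2π(d/λ) sin θ}, …, e^{j2π(d(M-1)/λ) sin θ}]`,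
at the sampled angle `θ_{g,t}`. -/
def steer (P : ProblemData G K M U L) (g : Fin G) (t : Fin K) : Fin M → ℂ := fun m =>
  star (Complex.exp (((2 * Real.pi * (P.spacing * (m : ℕ) / P.wavelength)
    * Real.sin (P.angle g t) : ℝ) : ℂ) * Complex.I))

/-- The row vector `[𝒟(θ_{g,t}), -aᵀ(θ_{g,t}) ⊗ aᴴ(θ_{g,t})]`; the entry that multiplies `R m n`
is `-(conj a_m) a_n`. -/
def residualRow (P : ProblemData G K M U L) (g : Fin G) (t : Fin K) :
    Unit ⊕ (Fin M × Fin M) → ℂ :=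
  Sum.elim (fun _ => (P.desired g t : ℂ))
    (fun p => -(star (P.steer g t p.1) * P.steer g t p.2))

/-- The matrix `Ω`. -/
def Omega (P : ProblemData G K M U L) :
    Matrix (Unit ⊕ (Fin M × Fin M)) (Unit ⊕ (Fin M × Fin M)) ℂ :=
  (1 / (G : ℂ)) • ∑ g, ∑ t,
    Matrix.vecMulVec (star (P.residualRow g t)) (P.residualRow g t)

/-- The objective `rᴴ Ω r`. -/
def objective (P : ProblemData G K M U L) (x : Point M U) : ℝ :=
  (star (stacked x) ⬝ᵥ (P.Omega.mulVec (stacked x))).re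

/-- The left-hand side of the `i`-th SINR constraint (required to be nonnegative). -/
def sinrSlack (P : ProblemData G K M U L) (x : Point M U) (i : Fin U) : ℝ :=
  (1 + 1 / P.sinr i) * ((P.chanS i).conjTranspose * x.1 i).trace.re
    - ∑ j, ((P.chanS i).conjTranspose * x.1 j).trace.re
    - ∑ t, ((P.chanS i).conjTranspose * x.2.1 t).trace.re - P.noise i

/-- The slack of the power constraint at the `m`-th antenna. -/
def powerSlack (P : ProblemData G K M U L) (x : Point M U) (m : Fin M) : ℝ :=
  P.power / M - (cov x m m).re

/-- The slack of the interference constraint at the `l`-th primary user. -/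
def interferenceSlack (P : ProblemData G K M U L) (x : Point M U) (l : Fin L) : ℝ :=
  P.thres - (∑ j, (P.chanP l * x.1 j).trace.re + ∑ t, (P.chanP l * x.2.1 t).trace.re)

/-- Feasibility for the relaxed problem. -/
def Feasible (P : ProblemData G K M U L) (x : Point M U) : Prop :=
  (∀ i, 0 ≤ P.sinrSlack x i) ∧ (∀ m, 0 ≤ P.powerSlack x m) ∧
    (∀ l, 0 ≤ P.interferenceSlack x l) ∧
    (∀ i, (x.1 i).PosSemidef) ∧ ∀ t, (x.2.1 t).PosSemidef

/-- Strict feasibility for the relaxed problem. -/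
def StrictlyFeasible (P : ProblemData G K M U L) (x : Point M U) : Prop :=
  (∀ i, 0 < P.sinrSlack x i) ∧ (∀ m, 0 < P.powerSlack x m) ∧
    (∀ l, 0 < P.interferenceSlack x l) ∧
    (∀ i, (x.1 i).PosDef) ∧ ∀ t, (x.2.1 t).PosDef

/-- `x` has relative depth at least `δ` in the feasible set: every segment from a feasible `y`
to `x` can be prolonged beyond `x` by the fraction `δ` of its length. -/
def HasDepth (P : ProblemData G K M U L) (x : Point M U) (δ : ℝ) : Prop :=
  ∀ y, P.Feasible y → P.Feasible (x + δ • (x - y))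

/-! ### The barrier method -/

/-- The logarithmic barrier `B` of the inequality constraints. -/
def barrier (P : ProblemData G K M U L) (x : Point M U) : ℝ :=
  ∑ i, Real.log (P.sinrSlack x i) + ∑ m, Real.log (P.powerSlack x m)
    + ∑ l, Real.log (P.interferenceSlack x l)
    + ∑ i, Real.log (x.1 i).det.re + ∑ t, Real.log (x.2.1 t).det.re

/-- The objective `rᴴ Ω r - (1/τ) B` of the barrier problem with parameter `τ`. -/
def penalized (P : ProblemData G K M U L) (τ : ℝ) (x : Point M U) : ℝ :=
  P.objective x - 1 / τ * P.barrier x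

/-- First derivative of the barrier problem's objective at `x` in the direction `h`. -/
def gradDir (P : ProblemData G K M U L) (τ : ℝ) (x h : Point M U) : ℝ :=
  deriv (fun u : ℝ => P.penalized τ (x + u • h)) 0

/-- Hessian (as a bilinear form in `d` and `h`) of the barrier problem's objective at `x`. -/
def hessDir (P : ProblemData G K M U L) (τ : ℝ) (x d h : Point M U) : ℝ :=
  deriv (fun s : ℝ => P.gradDir τ (x + s • d) h) 0

/-- `d` solves the Newton system of the barrier problem at `x`. -/
def IsNewtonDirection (P : ProblemData G K M U L) (τ : ℝ) (x d : Point M U) : Prop :=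
  IsHermitianPoint d ∧ ∀ h, IsHermitianPoint h → P.hessDir τ x d h = -P.gradDir τ x h

/-- `x 0, …, x T` are the iterates of a run of the barrier method with `T` Newton steps: all of
them are strictly feasible, and `x (k+1)` arises from `x k` by a (possibly damped) Newton step for
the barrier problem with the current parameter `τ k`, which never decreases. -/
def IsBarrierRun (P : ProblemData G K M U L) (T : ℕ) (x : ℕ → Point M U) : Prop :=
  ∃ (τ s : ℕ → ℝ) (d : ℕ → Point M U), Monotone τ ∧ (∀ k, 0 < τ k) ∧
    (∀ k ≤ T, P.StrictlyFeasible (x k)) ∧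
    ∀ k < T, 0 < s k ∧ s k ≤ 1 ∧ P.IsNewtonDirection (τ k) (x k) (d k) ∧
      x (k + 1) = x k + s k • d k

end ProblemData

/-! ### Arithmetic programs and their operation count -/

/-- A readable cell: an input or a memory register. -/
abbrev Cell (ι : Type) : Type := ι ⊕ ℕ

/-- One operation on real numbers, whose result goes to the register `dst`. -/
inductive Instr (ι : Type) : Type
  | const (dst : ℕ) (q : ℚ)
  | add (dst : ℕ) (a b : Cell ι)
  | sub (dst : ℕ) (a b : Cell ι)
  | mul (dst : ℕ) (a b : Cell ι)
  | div (dst : ℕ) (a b : Cell ι)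
  | sqrt (dst : ℕ) (a : Cell ι)
  /-- stores `c` if `a ≤ b`, and `e` otherwise -/
  | select (dst : ℕ) (a b c e : Cell ι)

/-- The content of a cell. -/
def fetch {ι : Type} (inp : ι → ℝ) (mem : ℕ → ℝ) (a : Cell ι) : ℝ := Sum.elim inp mem a

/-- The memory after one operation. -/
def Instr.exec {ι : Type} (inp : ι → ℝ) (mem : ℕ → ℝ) : Instr ι → (ℕ → ℝ)
  | .const dst q => Function.update mem dst (q : ℝ)
  | .add dst a b => Function.update mem dst (fetch inp mem a + fetch inp mem b)
  | .sub dst a b => Function.update mem dst (fetch inp mem a - fetch inp mem b)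
  | .mul dst a b => Function.update mem dst (fetch inp mem a * fetch inp mem b)
  | .div dst a b => Function.update mem dst (fetch inp mem a / fetch inp mem b)
  | .sqrt dst a => Function.update mem dst (Real.sqrt (fetch inp mem a))
  | .select dst a b c e => Function.update mem dst
      (if fetch inp mem a ≤ fetch inp mem b then fetch inp mem c else fetch inp mem e)

/-- The operation is legal: no division by zero, no square root of a negative number. -/
def Instr.Legal {ι : Type} (inp : ι → ℝ) (mem : ℕ → ℝ) : Instr ι → Prop
  | .div _ _ b => fetch inp mem b ≠ 0
  | .sqrt _ a => 0 ≤ fetch inp mem a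
  | _ => True

/-- A program is a finite sequence of operations. -/
abbrev Program (ι : Type) : Type := List (Instr ι)

/-- The memory after running a program. -/
def Program.run {ι : Type} (inp : ι → ℝ) : Program ι → (ℕ → ℝ) → (ℕ → ℝ)
  | [], mem => mem
  | c :: cs, mem => Program.run inp cs (c.exec inp mem)

/-- All operations met while running the program are legal. -/
def Program.Legal {ι : Type} (inp : ι → ℝ) : Program ι → (ℕ → ℝ) → Prop
  | [], _ => True
  | c :: cs, mem => c.Legal inp mem ∧ Program.Legal inp cs (c.exec inp mem)

/-- The number of operations that a program performs. -/
def Program.cost {ι : Type} (p : Program ι) : ℕ := List.length p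

/-- Real coordinates of a point. -/
inductive Coord (M U : ℕ) : Type
  | fRe (i : Fin U) (m n : Fin M)
  | fIm (i : Fin U) (m n : Fin M)
  | vRe (t : Fin M) (m n : Fin M)
  | vIm (t : Fin M) (m n : Fin M)
  | omega

/-- The value of a real coordinate. -/
def Coord.value {M U : ℕ} (x : Point M U) : Coord M U → ℝ
  | .fRe i m n => (x.1 i m n).re
  | .fIm i m n => (x.1 i m n).im
  | .vRe t m n => (x.2.1 t m n).re
  | .vIm t m n => (x.2.1 t m n).im
  | .omega => x.2.2

/-- The inputs of a program for the beamforming problem: the problem data (the angles enter through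
the entries of the steering vectors), a starting point and the tolerance. -/
inductive InputIdx (G K M U L : ℕ) : Type
  | steerRe (g : Fin G) (t : Fin K) (m : Fin M)
  | steerIm (g : Fin G) (t : Fin K) (m : Fin M)
  | desired (g : Fin G) (t : Fin K)
  | chanSRe (i : Fin U) (m n : Fin M)
  | chanSIm (i : Fin U) (m n : Fin M)
  | chanPRe (l : Fin L) (m n : Fin M)
  | chanPIm (l : Fin L) (m n : Fin M)
  | noise (i : Fin U)
  | sinr (i : Fin U)
  | power
  | thres
  | start (c : Coord M U)
  | tolerance

/-- The input values. -/
def input {G K M U L : ℕ} (P : ProblemData G K M U L) (x₀ : Point M U) (ε : ℝ) :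
    InputIdx G K M U L → ℝ
  | .steerRe g t m => (P.steer g t m).re
  | .steerIm g t m => (P.steer g t m).im
  | .desired g t => P.desired g t
  | .chanSRe i m n => (P.chanS i m n).re
  | .chanSIm i m n => (P.chanS i m n).im
  | .chanPRe l m n => (P.chanP l m n).re
  | .chanPIm l m n => (P.chanP l m n).im
  | .noise i => P.noise i
  | .sinr i => P.sinr i
  | .power => P.power
  | .thres => P.thres
  | .start c => c.value x₀
  | .tolerance => ε

/-- Run on the inputs `inp` (with the memory initially zero), the program performs legal operations
only, and leaves the points `x 0, …, x T` in the cells listed by `out`. -/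
def Program.Produces {ι : Type} {M U : ℕ} (p : Program ι) (inp : ι → ℝ) (T : ℕ)
    (out : ℕ → Coord M U → Cell ι) (x : ℕ → Point M U) : Prop :=
  p.Legal inp (fun _ => 0) ∧
    ∀ k ≤ T, ∀ c : Coord M U,
      fetch inp (p.run inp (fun _ => 0)) (out k c) = c.value (x k)

end DFRC

end

/-! The total is (number of Newton steps) × (cost of a step) = O(M²√M (b+1)) · O(GK M⁶).

Convergence. Along a line x + u h through a strictly feasible x, with h Hermitian, congruence
diagonalizes every block. So B(x + u h) = B(x) + ∑ log(1 + u l_j) with at most 4M² numbers l_j, and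
feasibility means 1 + u l_j ≥ 0 for all j (`exists_line`). All estimates reduce to scalar bounds on
log(1 + t). Let f = τ·objective − B and let D be the squared Newton decrement. The step length
1/(2(1+D)) preserves strict feasibility and lowers f by at least D/(4(1+D))
(`StrictlyFeasible.newton_step`), while D ≤ 1/16 means that f(x) is within 1/4 of its infimum
(`StrictlyFeasible.merit_le`). Hence a step lowers the bound on the gap to the infimum by 1/68 or
brings it to 1/4. Relative depth 2⁻ᵇ bounds the gap at x₀ by 1 + 4M²(b+1) for τ = 1/(2ᵇε), so
O(M²(b+1)) steps bring it to 1/2. From then on each Newton step is followed by a growth of τ by the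
factor 1 + 1/(816M²), which preserves the bound 1/2. A gap g leaves an objective error of at most
2(4M² + g)/τ, so τ ≥ 16M²/ε suffices. This needs O(M²(b + log M)) steps; log M is estimated by √M,
which yields the exponent 6 + 2 + 1/2.

Cost of a step. There are on the order of M³ real variables, and plain elimination would cost M⁹.
However, the objective and the scalar slacks see the blocks only through at most 3M² numbers: the
entries of R and the traces Tr(H_{s,i} F_i). The rest of the Hessian comes from log det and acts
blockwise as Z ↦ X⁻¹ZX⁻¹, with the explicit inverse Z ↦ XZX. Eliminating the blocks and ω leaves a
system (I + AQ)z = c in at most 3M² unknowns with A and Q positive semidefinite (`sysMat_injective`,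
`StrictlyFeasible.isNewtonDirection`). Forming Q takes O(GK M⁵) operations; forming AQ and solving
take O(M⁶).

Programs. Intermediate values are real functions on the type of admissible inputs, and a chain of
operations on such functions compiles to one straight-line program (`Ext.exists_program`). Square
roots are avoided because the step length uses D instead of √D; the only comparison guards the
coefficient of ω². -/

noncomputable section

namespace DFRC

/-! ### Counting operations on functions of a context

Values computed by a program are viewed as real functions on a type `X` of admissible contexts. -/

section Cost

variable {X : Type*}

/-- `f` arises from functions in `S` by a single legal operation. -/
inductive OneOp (S : Set (X → ℝ)) : (X → ℝ) → Prop
  | const (q : ℚ) : OneOp S (fun _ => (q : ℝ))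
  | add {f g : X → ℝ} (hf : f ∈ S) (hg : g ∈ S) : OneOp S (fun x => f x + g x)
  | sub {f g : X → ℝ} (hf : f ∈ S) (hg : g ∈ S) : OneOp S (fun x => f x - g x)
  | mul {f g : X → ℝ} (hf : f ∈ S) (hg : g ∈ S) : OneOp S (fun x => f x * g x)
  | div {f g : X → ℝ} (hf : f ∈ S) (hg : g ∈ S) (h0 : ∀ x, g x ≠ 0) : OneOp S (fun x => f x / g x)
  | select {a b c e : X → ℝ} (ha : a ∈ S) (hb : b ∈ S) (hc : c ∈ S) (he : e ∈ S) :
      OneOp S (fun x => if a x ≤ b x then c x else e x)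

theorem OneOp.mono {S T : Set (X → ℝ)} (h : S ⊆ T) {f : X → ℝ} (hf : OneOp S f) : OneOp T f := by
  cases hf with
  | const q => exact .const q
  | add hf hg => exact .add (h hf) (h hg)
  | sub hf hg => exact .sub (h hf) (h hg)
  | mul hf hg => exact .mul (h hf) (h hg)
  | div hf hg h0 => exact .div (h hf) (h hg) h0
  | select ha hb hc he => exact .select (h ha) (h hb) (h hc) (h he)

/-- `T` arises from `S` by adjoining the results of `n` operations. -/
inductive Ext (S : Set (X → ℝ)) : ℕ → Set (X → ℝ) → Prop
  | refl : Ext S 0 S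
  | step {n : ℕ} {T : Set (X → ℝ)} {f : X → ℝ} (h : Ext S n T) (hf : OneOp T f) :
      Ext S (n + 1) (insert f T)

theorem Ext.subset {S T : Set (X → ℝ)} {n : ℕ} (h : Ext S n T) : S ⊆ T := by
  induction h with
  | refl => exact subset_rfl
  | step _ _ ih => exact ih.trans (Set.subset_insert _ _)

theorem Ext.trans {S T T' : Set (X → ℝ)} {n m : ℕ} (h : Ext S n T) (h' : Ext T m T') :
    Ext S (n + m) T' := by
  induction h' with
  | refl => exact h
  | step _ hf ih => exact .step ih hf

/-- The same operations are replayed over the larger set; the count stays the same even when some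
results are already present. -/
theorem Ext.union {S T : Set (X → ℝ)} {n : ℕ} (h : Ext S n T) {S' : Set (X → ℝ)} (hS : S ⊆ S') :
    Ext S' n (S' ∪ T) := by
  induction h with
  | refl => rw [Set.union_eq_left.2 hS]; exact .refl
  | step _ hf ih => rw [Set.union_insert]; exact .step ih (hf.mono Set.subset_union_right)

/-- From the functions in `S`, at most `n` operations lead to functions with the property `Q`. -/
def Comp (S : Set (X → ℝ)) (n : ℕ) (Q : Set (X → ℝ) → Prop) : Prop :=
  ∃ T, ∃ k ≤ n, Ext S k T ∧ Q T

theorem Comp.pure {S : Set (X → ℝ)} {n : ℕ} {Q : Set (X → ℝ) → Prop} (h : Q S) : Comp S n Q :=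
  ⟨S, 0, n.zero_le, .refl, h⟩

theorem Comp.bind {S : Set (X → ℝ)} {n m : ℕ} {Q Q' : Set (X → ℝ) → Prop} (h : Comp S n Q)
    (h' : ∀ T, S ⊆ T → Q T → Comp T m Q') : Comp S (n + m) Q' := by
  obtain ⟨T, k, hk, hT, hQ⟩ := h
  obtain ⟨T', k', hk', hT', hQ'⟩ := h' T hT.subset hQ
  exact ⟨T', k + k', by lia, hT.trans hT', hQ'⟩

theorem Comp.weaken {S : Set (X → ℝ)} {n m : ℕ} {Q Q' : Set (X → ℝ) → Prop} (h : Comp S n Q)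
    (hnm : n ≤ m) (hQ : ∀ T, S ⊆ T → Q T → Q' T) : Comp S m Q' := by
  obtain ⟨T, k, hk, hT, h⟩ := h
  exact ⟨T, k, hk.trans hnm, hT, hQ T hT.subset h⟩

theorem Comp.le {S : Set (X → ℝ)} {n m : ℕ} {Q : Set (X → ℝ) → Prop} (h : Comp S n Q)
    (hnm : n ≤ m) : Comp S m Q := h.weaken hnm fun _ _ h => h

/-- A property of sets of functions that is inherited by larger sets. -/
abbrev Upward (Q : Set (X → ℝ) → Prop) : Prop := ∀ ⦃S T⦄, S ⊆ T → Q S → Q T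

theorem Comp.mono {S T : Set (X → ℝ)} {n : ℕ} {Q : Set (X → ℝ) → Prop} (h : Comp S n Q)
    (hQ : Upward Q) (hST : S ⊆ T) : Comp T n Q := by
  obtain ⟨S', k, hk, hS', h⟩ := h
  exact ⟨T ∪ S', k, hk, hS'.union hST, hQ Set.subset_union_right h⟩

/-- The computations run one after another: `Comp.mono` lets each start from the enlarged set, and
upward closure preserves the earlier results. -/
theorem Comp.forall_finset {ι : Type*} (s : Finset ι) {S : Set (X → ℝ)} {n : ℕ}
    {Q : ι → Set (X → ℝ) → Prop} (hQ : ∀ i, Upward (Q i)) (h : ∀ i ∈ s, Comp S n (Q i)) :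
    Comp S (s.card * n) (fun T => ∀ i ∈ s, Q i T) := by
  classical
  induction s using Finset.induction_on with
  | empty => exact .pure (by simp)
  | insert a s ha ih =>
    refine ((ih fun i hi => h i (Finset.mem_insert_of_mem hi)).bind (m := n) fun T hT hs =>
      ((h a (Finset.mem_insert_self _ _)).mono (hQ a) hT).weaken le_rfl fun T' hT' ha' => ?_).le ?_
    · intro i hi
      rcases Finset.mem_insert.1 hi with rfl | hi
      · exact ha'
      · exact hQ i hT' (hs i hi)
    · rw [Finset.card_insert_of_notMem ha]; lia

theorem Comp.forall_fintype {ι : Type*} [Fintype ι] {S : Set (X → ℝ)} {n : ℕ}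
    {Q : ι → Set (X → ℝ) → Prop} (hQ : ∀ i, Upward (Q i)) (h : ∀ i, Comp S n (Q i)) :
    Comp S (Fintype.card ι * n) (fun T => ∀ i, Q i T) :=
  (Comp.forall_finset Finset.univ hQ fun i _ => h i).weaken le_rfl
    fun _ _ h i => h i (Finset.mem_univ i)

/-- The function `f` can be computed from `S` by at most `n` operations. -/
abbrev Cost (S : Set (X → ℝ)) (n : ℕ) (f : X → ℝ) : Prop := Comp S n fun T => f ∈ T

theorem upward_mem (f : X → ℝ) : Upward fun T => f ∈ T := fun _ _ h hf => h hf

theorem Cost.family {ι : Type*} [Fintype ι] {S : Set (X → ℝ)} {n : ℕ} {f : ι → X → ℝ}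
    (h : ∀ i, Cost S n (f i)) : Comp S (Fintype.card ι * n) (fun T => ∀ i, f i ∈ T) :=
  Comp.forall_fintype (fun i => upward_mem (f i)) h

theorem OneOp.cost {S : Set (X → ℝ)} {f : X → ℝ} (h : OneOp S f) : Cost S 1 f :=
  ⟨_, 1, le_rfl, .step .refl h, Set.mem_insert _ _⟩

theorem Cost.of_mem {S : Set (X → ℝ)} {f : X → ℝ} (h : f ∈ S) : Cost S 0 f := .pure h

theorem Cost.const (S : Set (X → ℝ)) (q : ℚ) : Cost S 1 (fun _ => (q : ℝ)) := (OneOp.const q).cost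

theorem Cost.natConst (S : Set (X → ℝ)) (q : ℕ) : Cost S 1 (fun _ => (q : ℝ)) := by
  simpa using Cost.const S (q : ℚ)

theorem Cost.two {S : Set (X → ℝ)} {n m : ℕ} {f g : X → ℝ} (hf : Cost S n f) (hg : Cost S m g) :
    Comp S (n + m) fun T => f ∈ T ∧ g ∈ T :=
  hf.bind fun _ hT h => (Comp.mono hg (upward_mem g) hT).weaken le_rfl
    fun _ hT' h' => ⟨hT' h, h'⟩

theorem Cost.add {S : Set (X → ℝ)} {n m : ℕ} {f g : X → ℝ} (hf : Cost S n f) (hg : Cost S m g) :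
    Cost S (n + m + 1) (fun x => f x + g x) :=
  (hf.two hg).bind fun _ _ h => (OneOp.add h.1 h.2).cost

theorem Cost.sub {S : Set (X → ℝ)} {n m : ℕ} {f g : X → ℝ} (hf : Cost S n f) (hg : Cost S m g) :
    Cost S (n + m + 1) (fun x => f x - g x) :=
  (hf.two hg).bind fun _ _ h => (OneOp.sub h.1 h.2).cost

theorem Cost.mul {S : Set (X → ℝ)} {n m : ℕ} {f g : X → ℝ} (hf : Cost S n f) (hg : Cost S m g) :
    Cost S (n + m + 1) (fun x => f x * g x) :=
  (hf.two hg).bind fun _ _ h => (OneOp.mul h.1 h.2).cost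

theorem Cost.div {S : Set (X → ℝ)} {n m : ℕ} {f g : X → ℝ} (hf : Cost S n f) (hg : Cost S m g)
    (h0 : ∀ x, g x ≠ 0) : Cost S (n + m + 1) (fun x => f x / g x) :=
  (hf.two hg).bind fun _ _ h => (OneOp.div h.1 h.2 h0).cost

theorem Cost.neg {S : Set (X → ℝ)} {n : ℕ} {f : X → ℝ} (hf : Cost S n f) :
    Cost S (n + 2) (fun x => -f x) := by
  have := (Cost.const S 0).sub hf
  simp only [Rat.cast_zero, zero_sub] at this
  exact Comp.le this (by lia)

theorem Cost.select {S : Set (X → ℝ)} {a b c e : X → ℝ} {n₁ n₂ n₃ n₄ : ℕ} (ha : Cost S n₁ a)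
    (hb : Cost S n₂ b) (hc : Cost S n₃ c) (he : Cost S n₄ e) :
    Cost S (n₁ + n₂ + (n₃ + n₄) + 1) (fun x => if a x ≤ b x then c x else e x) :=
  ((ha.two hb).bind fun _ hT h =>
    ((hc.two he).mono (fun _ _ hST h => ⟨hST h.1, hST h.2⟩) hT).weaken le_rfl
      fun _ hT' h' => And.intro (And.intro (hT' h.1) (hT' h.2)) h').bind
    fun _ _ h => (OneOp.select h.1.1 h.1.2 h.2.1 h.2.2).cost

/-- The extra operation loads the constant `0` of the empty sum. -/
theorem Cost.finsetSum {ι : Type*} (s : Finset ι) {S : Set (X → ℝ)} {n : ℕ} {f : ι → X → ℝ}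
    (h : ∀ i ∈ s, Cost S n (f i)) : Cost S (s.card * (n + 1) + 1) (fun x => ∑ i ∈ s, f i x) := by
  classical
  induction s using Finset.induction_on with
  | empty => simpa using Cost.const S 0
  | insert a s ha ih =>
    simp only [Finset.sum_insert ha]
    refine Comp.le ((h a (Finset.mem_insert_self _ _)).add
      (ih fun i hi => h i (Finset.mem_insert_of_mem hi))) ?_
    rw [Finset.card_insert_of_notMem ha]; lia

theorem Cost.sum {ι : Type*} [Fintype ι] {S : Set (X → ℝ)} {n : ℕ} {f : ι → X → ℝ}
    (h : ∀ i, Cost S n (f i)) : Cost S (Fintype.card ι * (n + 1) + 1) (fun x => ∑ i, f i x) :=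
  Cost.finsetSum Finset.univ fun i _ => h i

/-- Real and imaginary part of `f` belong to `S`. -/
def CMem (f : X → ℂ) (S : Set (X → ℝ)) : Prop :=
  (fun x => (f x).re) ∈ S ∧ (fun x => (f x).im) ∈ S

theorem upward_cmem (f : X → ℂ) : Upward (CMem f) := fun _ _ h hf => ⟨h hf.1, h hf.2⟩

/-- The complex function `f` can be computed from `S` by at most `n` operations. -/
abbrev CCost (S : Set (X → ℝ)) (n : ℕ) (f : X → ℂ) : Prop := Comp S n (CMem f)

theorem CCost.of_mem {S : Set (X → ℝ)} {f : X → ℂ} (h : CMem f S) : CCost S 0 f := .pure h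

theorem CCost.family {ι : Type*} [Fintype ι] {S : Set (X → ℝ)} {n : ℕ} {f : ι → X → ℂ}
    (h : ∀ i, CCost S n (f i)) : Comp S (Fintype.card ι * n) (fun T => ∀ i, CMem (f i) T) :=
  Comp.forall_fintype (fun i => upward_cmem (f i)) h

theorem CCost.two {S : Set (X → ℝ)} {n m : ℕ} {f g : X → ℂ} (hf : CCost S n f)
    (hg : CCost S m g) : Comp S (n + m) fun T => CMem f T ∧ CMem g T :=
  hf.bind fun _ hT h => (Comp.mono hg (upward_cmem g) hT).weaken le_rfl
    fun _ hT' h' => ⟨upward_cmem f hT' h, h'⟩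

theorem CCost.re {S : Set (X → ℝ)} {n : ℕ} {f : X → ℂ} (hf : CCost S n f) :
    Cost S n (fun x => (f x).re) := hf.weaken le_rfl fun _ _ h => h.1

theorem CCost.im {S : Set (X → ℝ)} {n : ℕ} {f : X → ℂ} (hf : CCost S n f) :
    Cost S n (fun x => (f x).im) := hf.weaken le_rfl fun _ _ h => h.2

theorem CCost.of_re_im {S : Set (X → ℝ)} {n m : ℕ} {f : X → ℂ} (hr : Cost S n fun x => (f x).re)
    (hi : Cost S m fun x => (f x).im) : CCost S (n + m) f := hr.two hi

theorem CCost.add {S : Set (X → ℝ)} {n m : ℕ} {f g : X → ℂ} (hf : CCost S n f)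
    (hg : CCost S m g) : CCost S (n + m + 2) (fun x => f x + g x) :=
  (hf.two hg).bind fun T _ h => CCost.of_re_im (n := 1) (m := 1)
    (by simpa using (Cost.of_mem h.1.1).add (.of_mem h.2.1))
    (by simpa using (Cost.of_mem h.1.2).add (.of_mem h.2.2))

theorem CCost.sub {S : Set (X → ℝ)} {n m : ℕ} {f g : X → ℂ} (hf : CCost S n f)
    (hg : CCost S m g) : CCost S (n + m + 2) (fun x => f x - g x) :=
  (hf.two hg).bind fun T _ h => CCost.of_re_im (n := 1) (m := 1)
    (by simpa using (Cost.of_mem h.1.1).sub (.of_mem h.2.1))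
    (by simpa using (Cost.of_mem h.1.2).sub (.of_mem h.2.2))

theorem CCost.mul {S : Set (X → ℝ)} {n m : ℕ} {f g : X → ℂ} (hf : CCost S n f)
    (hg : CCost S m g) : CCost S (n + m + 6) (fun x => f x * g x) :=
  (hf.two hg).bind fun T _ h => CCost.of_re_im (n := 3) (m := 3)
    (by simpa using ((Cost.of_mem h.1.1).mul (.of_mem h.2.1)).sub
          ((Cost.of_mem h.1.2).mul (.of_mem h.2.2)))
    (by simpa using ((Cost.of_mem h.1.1).mul (.of_mem h.2.2)).add
          ((Cost.of_mem h.1.2).mul (.of_mem h.2.1)))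

theorem CCost.star {S : Set (X → ℝ)} {n : ℕ} {f : X → ℂ} (hf : CCost S n f) :
    CCost S (n + 2) (fun x => star (f x)) :=
  hf.bind fun T _ h => CCost.of_re_im (n := 0) (m := 2)
    (by simpa using Cost.of_mem h.1) (by simpa using (Cost.of_mem h.2).neg)

theorem CCost.sum {ι : Type*} [Fintype ι] {S : Set (X → ℝ)} {n : ℕ} {f : ι → X → ℂ}
    (h : ∀ i, CCost S n (f i)) :
    CCost S (Fintype.card ι * n + 2 * (Fintype.card ι + 1)) (fun x => ∑ i, f i x) :=
  (CCost.family h).bind fun T _ h => (CCost.of_re_im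
    (by simpa using Cost.sum fun i => Cost.of_mem (h i).1)
    (by simpa using Cost.sum fun i => Cost.of_mem (h i).2)).le (by lia)

end Cost

/-! ### From operation counts to programs -/

section Compile

variable {ι : Type}

theorem Program.run_append (inp : ι → ℝ) (p q : Program ι) (mem : ℕ → ℝ) :
    Program.run inp (p ++ q) mem = Program.run inp q (Program.run inp p mem) := by
  induction p generalizing mem with
  | nil => rfl
  | cons c cs ih => exact ih _

theorem Program.legal_append (inp : ι → ℝ) (p q : Program ι) (mem : ℕ → ℝ) :
    Program.Legal inp (p ++ q) mem ↔
      Program.Legal inp p mem ∧ Program.Legal inp q (Program.run inp p mem) := by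
  induction p generalizing mem with
  | nil => simp [Program.Legal, Program.run]
  | cons c cs ih => simp [Program.Legal, Program.run, ih, and_assoc]

/-- A sequence of operations on functions is realized by a program of the same length. -/
theorem Ext.exists_program {X : Type*} (inp : X → ι → ℝ) {n : ℕ} {T : Set (X → ℝ)}
    (h : Ext (Set.range fun i x => inp x i) n T) :
    ∃ p : Program ι, p.length = n ∧ (∀ x, p.Legal (inp x) fun _ => 0) ∧
      ∀ f ∈ T, ∃ c : Cell ι, (∀ r, c = Sum.inr r → r < n) ∧
        ∀ x, fetch (inp x) (p.run (inp x) fun _ => 0) c = f x := by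
  induction h with
  | refl =>
    refine ⟨[], rfl, fun x => trivial, ?_⟩
    rintro _ ⟨i, rfl⟩
    exact ⟨Sum.inl i, by simp, fun x => rfl⟩
  | @step n T f _ hf ih =>
    obtain ⟨p, hp, hl, hc⟩ := ih
    -- Operation `n` writes to register `n`, and all earlier values sit in registers below `n` or in
    -- inputs, so nothing is ever overwritten.
    suffices H : ∃ c : Instr ι, ∀ x, c.Legal (inp x) (p.run (inp x) fun _ => 0) ∧
        c.exec (inp x) (p.run (inp x) fun _ => 0)
          = Function.update (p.run (inp x) fun _ => 0) n (f x) by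
      obtain ⟨c, h⟩ := H
      have hrun : ∀ x, Program.run (inp x) (p ++ [c]) (fun _ => 0)
          = Function.update (p.run (inp x) fun _ => 0) n (f x) := fun x => by
        rw [Program.run_append, ← (h x).2]; rfl
      refine ⟨p ++ [c], by simp [hp], fun x => ?_, ?_⟩
      · rw [Program.legal_append]
        exact ⟨hl x, (h x).1, trivial⟩
      · rintro g (rfl | hg)
        · refine ⟨Sum.inr n, by simp, fun x => ?_⟩
          rw [hrun]
          simp [fetch]
        · obtain ⟨cell, hlt, hcell⟩ := hc g hg
          refine ⟨cell, fun r hr => (hlt r hr).trans n.lt_succ_self, fun x => ?_⟩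
          rw [hrun, ← hcell x]
          cases cell with
          | inl i => rfl
          | inr r => simp [fetch, (hlt r rfl).ne]
    cases hf with
    | const q => exact ⟨.const n q, fun x => ⟨trivial, rfl⟩⟩
    | add hf hg =>
      obtain ⟨a, -, ha⟩ := hc _ hf
      obtain ⟨b, -, hb⟩ := hc _ hg
      exact ⟨.add n a b, fun x => ⟨trivial, by simp only [Instr.exec, ha, hb]⟩⟩
    | sub hf hg =>
      obtain ⟨a, -, ha⟩ := hc _ hf
      obtain ⟨b, -, hb⟩ := hc _ hg
      exact ⟨.sub n a b, fun x => ⟨trivial, by simp only [Instr.exec, ha, hb]⟩⟩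
    | mul hf hg =>
      obtain ⟨a, -, ha⟩ := hc _ hf
      obtain ⟨b, -, hb⟩ := hc _ hg
      exact ⟨.mul n a b, fun x => ⟨trivial, by simp only [Instr.exec, ha, hb]⟩⟩
    | div hf hg h0 =>
      obtain ⟨a, -, ha⟩ := hc _ hf
      obtain ⟨b, -, hb⟩ := hc _ hg
      exact ⟨.div n a b, fun x => ⟨by simp only [Instr.Legal, hb]; exact h0 x,
        by simp only [Instr.exec, ha, hb]⟩⟩
    | select hf hg hu hv =>
      obtain ⟨a, -, ha⟩ := hc _ hf
      obtain ⟨b, -, hb⟩ := hc _ hg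
      obtain ⟨c, -, hc'⟩ := hc _ hu
      obtain ⟨e, -, he⟩ := hc _ hv
      exact ⟨.select n a b c e, fun x => ⟨trivial, by simp only [Instr.exec, ha, hb, hc', he]⟩⟩

end Compile

/-! ### Solving linear systems -/

section Solve

open Matrix

/-- Isolates the first variable so that the square in it can be completed. -/
theorem dotProduct_mulVec_fin_succ {n : ℕ} (A : Matrix (Fin (n + 1)) (Fin (n + 1)) ℝ)
    (hA : A.IsHermitian) (t : ℝ) (y : Fin n → ℝ) :
    Fin.cons t y ⬝ᵥ A *ᵥ (Fin.cons t y : Fin (n + 1) → ℝ)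
      = A 0 0 * t ^ 2 + 2 * t * ∑ j, A 0 j.succ * y j
        + ∑ i, y i * ∑ j, A i.succ j.succ * y j := by
  have hs : ∀ i j, A i j = A j i := fun i j => by simpa using hA.apply j i
  simp only [dotProduct, mulVec, Fin.sum_univ_succ, Fin.cons_zero, Fin.cons_succ, mul_add,
    Finset.sum_add_distrib]
  have : ∑ i : Fin n, y i * (A i.succ 0 * t) = t * ∑ j, A 0 j.succ * y j := by
    rw [Finset.mul_sum]
    exact Finset.sum_congr rfl fun i _ => by rw [hs i.succ 0]; ring
  rw [this]; ring

/-- The Schur complement of the first diagonal entry of a positive definite matrix. -/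
theorem posDef_schurComplement_zero {n : ℕ} {A : Matrix (Fin (n + 1)) (Fin (n + 1)) ℝ}
    (hA : A.PosDef) :
    (Matrix.of fun i j : Fin n => A i.succ j.succ - A i.succ 0 * A 0 j.succ / A 0 0).PosDef := by
  have hα : 0 < A 0 0 := hA.diag_pos
  have hs : ∀ i j, A i j = A j i := fun i j => by simpa using hA.1.apply j i
  refine .of_dotProduct_mulVec_pos (by
    ext i j
    simp only [conjTranspose_apply, of_apply, star_trivial]
    rw [hs j.succ i.succ, hs j.succ 0, hs 0 i.succ]; ring) fun y hy => ?_
  set v := ∑ j, A 0 j.succ * y j with hv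
  -- For fixed `y` the first coordinate `-v / A 0 0` minimizes the form of `A`, and the minimum is
  -- the form of the Schur complement at `y`.
  have hne : (Fin.cons (-v / A 0 0) y : Fin (n + 1) → ℝ) ≠ 0 := fun h => hy <| by
    ext i; simpa using congrFun h i.succ
  have hpos := hA.dotProduct_mulVec_pos hne
  rw [star_trivial, dotProduct_mulVec_fin_succ A hA.1, ← hv] at hpos
  have h2 : star y ⬝ᵥ (Matrix.of fun i j : Fin n =>
      A i.succ j.succ - A i.succ 0 * A 0 j.succ / A 0 0) *ᵥ y
      = (∑ i, y i * ∑ j, A i.succ j.succ * y j) - v ^ 2 / A 0 0 := by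
    have e1 : ∀ i : Fin n, ∑ j, (A i.succ j.succ - A i.succ 0 * A 0 j.succ / A 0 0) * y j
        = (∑ j, A i.succ j.succ * y j) - A 0 i.succ * (v / A 0 0) := fun i => by
      rw [hv, Finset.sum_div, Finset.mul_sum, ← Finset.sum_sub_distrib]
      exact Finset.sum_congr rfl fun j _ => by rw [hs i.succ 0]; ring
    simp only [dotProduct, mulVec, of_apply, star_trivial, e1, mul_sub, Finset.sum_sub_distrib]
    congr 1
    rw [sq, mul_div_assoc, hv, Finset.sum_mul]
    exact Finset.sum_congr rfl fun j _ => by ring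
  rw [h2]
  convert hpos using 1
  field_simp
  ring

variable {X : Type*}

/-- Gaussian elimination for positive definite systems. -/
theorem comp_solve_posDef (n : ℕ) (S : Set (X → ℝ)) (A : X → Matrix (Fin n) (Fin n) ℝ)
    (b : X → Fin n → ℝ) (hA : ∀ x, (A x).PosDef) (hAS : ∀ i j, (fun x => A x i j) ∈ S)
    (hbS : ∀ i, (fun x => b x i) ∈ S) :
    Comp S (10 * n ^ 3) fun T => ∃ z : X → Fin n → ℝ,
      (∀ x, A x *ᵥ z x = b x) ∧ ∀ i, (fun x => z x i) ∈ T := by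
  induction n generalizing S with
  | zero => exact .pure ⟨fun _ => 0, fun x => by ext i; exact i.elim0, fun i => i.elim0⟩
  | succ n ih =>
    -- Positive definiteness makes the pivot nonzero and passes to the Schur complement `A'`, so
    -- neither pivoting nor comparison is needed.
    have hα : ∀ x, A x 0 0 ≠ 0 := fun x => (hA x).diag_pos.ne'
    set A' : X → Matrix (Fin n) (Fin n) ℝ := fun x => Matrix.of fun i j : Fin n =>
      A x i.succ j.succ - A x i.succ 0 * A x 0 j.succ / A x 0 0 with hA'
    set b' : X → Fin n → ℝ := fun x i => b x i.succ - A x i.succ 0 * b x 0 / A x 0 0 with hb'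
    have c1 := Cost.family (S := S) (f := fun (p : Fin n × Fin n) x => A' x p.1 p.2) (n := 3)
      fun p => (Cost.of_mem (hAS _ _)).sub
        (((Cost.of_mem (hAS _ _)).mul (.of_mem (hAS _ _))).div (.of_mem (hAS 0 0)) hα)
    have c2 := Cost.family (S := S) (f := fun (i : Fin n) x => b' x i) (n := 3)
      fun p => (Cost.of_mem (hbS _)).sub
        (((Cost.of_mem (hAS _ _)).mul (.of_mem (hbS _))).div (.of_mem (hAS 0 0)) hα)
    refine ((c1.bind fun T hT h1 => (c2.mono (fun _ _ hST h i => hST (h i)) hT).bind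
      fun T' hT' h2 => (ih T' A' b' (fun x => posDef_schurComplement_zero (hA x))
        (fun i j => hT' (h1 (i, j))) h2).bind fun T₃ hT₃ hz => ?_).le
        (m := 10 * (n + 1) ^ 3) (n := _ + (_ + (_ + (2 * n + 3)))) ?_)
    · obtain ⟨z, hz, hzT⟩ := hz
      have hST := (hT.trans hT').trans hT₃
      have c3 : Cost T₃ (0 + (Fintype.card (Fin n) * (1 + 1) + 1) + 1 + 0 + 1)
          (fun x => (b x 0 - ∑ j, A x 0 j.succ * z x j) / A x 0 0) :=
        ((Cost.of_mem (hST (hbS 0))).sub (.sum fun j => (Cost.of_mem (hST (hAS 0 j.succ))).mul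
          (.of_mem (hzT j)))).div (.of_mem (hST (hAS 0 0))) hα
      refine c3.weaken (by simp; lia) fun T₄ hT₄ h => ⟨fun x => Fin.cons
        ((b x 0 - ∑ j, A x 0 j.succ * z x j) / A x 0 0) (z x), fun x => ?_, fun i => ?_⟩
      · ext i
        refine Fin.cases ?_ (fun i => ?_) i
        · simp only [mulVec, dotProduct, Fin.sum_univ_succ, Fin.cons_zero, Fin.cons_succ]
          field_simp [hα x]
          ring
        · have := congrFun (hz x) i
          simp only [mulVec, dotProduct, hA', hb', of_apply, sub_mul, Finset.sum_sub_distrib]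
            at this
          have e : ∑ j, A x i.succ 0 * A x 0 j.succ / A x 0 0 * z x j
              = A x i.succ 0 * (∑ j, A x 0 j.succ * z x j) / A x 0 0 := by
            rw [Finset.mul_sum, Finset.sum_div]
            exact Finset.sum_congr rfl fun j _ => by ring
          rw [e] at this
          simp only [mulVec, dotProduct, Fin.sum_univ_succ, Fin.cons_zero, Fin.cons_succ]
          linear_combination this
      · refine Fin.cases ?_ (fun i => ?_) i
        · simpa using h
        · simpa using hT₄ (hzT i)
    · simp only [Fintype.card_prod, Fintype.card_fin]
      ring_nf
      nlinarith

/-- Solving an invertible linear system through the normal equations. -/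
theorem comp_solve {ι : Type*} [Fintype ι] [DecidableEq ι] (S : Set (X → ℝ))
    (A : X → Matrix ι ι ℝ) (b : X → ι → ℝ)
    (hA : ∀ x, Function.Injective (A x).mulVec) (hAS : ∀ i j, (fun x => A x i j) ∈ S)
    (hbS : ∀ i, (fun x => b x i) ∈ S) :
    Comp S (20 * Fintype.card ι ^ 3) fun T => ∃ z : X → ι → ℝ,
      (∀ x, A x *ᵥ z x = b x) ∧ ∀ i, (fun x => z x i) ∈ T := by
  set e := Fintype.equivFin ι
  set n := Fintype.card ι
  rcases Nat.eq_zero_or_pos n with h0 | hpos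
  · have : IsEmpty ι := Fintype.card_eq_zero_iff.1 h0
    exact .pure ⟨fun _ _ => 0, fun x => Subsingleton.elim _ _, fun i => isEmptyElim i⟩
  -- `A` need not be symmetric, but `AᵀA` is positive definite as soon as `A` is injective, so
  -- elimination without pivoting applies to it.
  set B : X → Matrix (Fin n) (Fin n) ℝ := fun x => ((A x)ᵀ * A x).submatrix e.symm e.symm
  set c : X → Fin n → ℝ := fun x i => ((A x)ᵀ *ᵥ b x) (e.symm i)
  have hPD : ∀ x, ((A x)ᵀ * A x).PosDef := fun x => by
    simpa using PosDef.conjTranspose_mul_self (A x) (hA x)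
  have c1 := Cost.family (S := S) (f := fun (p : Fin n × Fin n) x => B x p.1 p.2)
    fun p => (Cost.sum fun k => (Cost.of_mem (hAS k (e.symm p.1))).mul
      (Cost.of_mem (hAS k (e.symm p.2))))
  have c2 := Cost.family (S := S) (f := fun (i : Fin n) x => c x i)
    fun p => (Cost.sum fun k => (Cost.of_mem (hAS k (e.symm p))).mul (Cost.of_mem (hbS k)))
  refine ((c1.bind fun T hT h1 => (c2.mono (fun _ _ hST h i => hST (h i)) hT).bind
      fun T' hT' h2 => (comp_solve_posDef n T' B c (fun x => (hPD x).submatrix e.symm.injective)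
        (fun i j => hT' (h1 (i, j))) h2).weaken le_rfl fun T₃ hT₃ hz => ?_).le ?_)
  · obtain ⟨z, hz, hzT⟩ := hz
    refine ⟨fun x i => z x (e i), fun x => ?_, fun i => hzT (e i)⟩
    have h1 : (A x)ᵀ *ᵥ (A x *ᵥ fun i => z x (e i)) = (A x)ᵀ *ᵥ b x := by
      ext i
      have := congrFun (hz x) (e i)
      simp only [B, c, submatrix_mulVec_equiv, Equiv.symm_symm, Function.comp_apply,
        Equiv.symm_apply_apply] at this
      rw [← this, mulVec_mulVec]; rfl
    have hunit : IsUnit (A x)ᵀ := by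
      rw [isUnit_transpose]; exact mulVec_injective_iff_isUnit.1 (hA x)
    exact mulVec_injective_iff_isUnit.2 hunit h1
  · simp only [Fintype.card_prod, Fintype.card_fin]
    change n * n * (n * (0 + 0 + 1 + 1) + 1) + (n * (n * (0 + 0 + 1 + 1) + 1) + 10 * n ^ 3) ≤ _
    have : n ≤ n ^ 2 := by nlinarith
    have : n ^ 2 ≤ n ^ 3 := by nlinarith [sq_nonneg n]
    nlinarith

end Solve

/-! ### Simultaneous diagonalization -/

section SimDiag

open Matrix

variable {m : Type*} [Fintype m] [DecidableEq m]

open scoped MatrixOrder in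
/-- A positive definite and a Hermitian matrix are simultaneously diagonalized by congruence. -/
theorem exists_simulDiag {A H : Matrix m m ℂ} (hA : A.PosDef) (hH : H.IsHermitian) :
    ∃ (B : Matrix m m ℂ) (l : m → ℝ), IsUnit B ∧ A = B * Bᴴ ∧
      H = B * diagonal (fun i => (l i : ℂ)) * Bᴴ := by
  obtain ⟨Y, hY⟩ := CStarAlgebra.nonneg_iff_eq_star_mul_self.mp hA.posSemidef.nonneg
  rw [star_eq_conjTranspose] at hY
  have hYu : IsUnit Y := by
    have h := hA.isUnit
    rw [hY, isUnit_iff_isUnit_det, det_mul] at h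
    rw [isUnit_iff_isUnit_det]
    exact isUnit_of_mul_isUnit_right h
  have hYd : IsUnit Y.det := (isUnit_iff_isUnit_det _).1 hYu
  have hYd' : IsUnit (Yᴴ).det := by rw [det_conjTranspose]; exact hYd.star
  -- In the frame where `A` is the identity, `H` becomes the Hermitian matrix `K`; diagonalizing `K`
  -- by a unitary matrix leaves the identity untouched.
  set K := (Yᴴ)⁻¹ * H * Y⁻¹ with hK
  have hKh : K.IsHermitian := by
    rw [Matrix.IsHermitian, hK, conjTranspose_mul, conjTranspose_mul, hH.eq,
      conjTranspose_nonsing_inv, conjTranspose_nonsing_inv, conjTranspose_conjTranspose, mul_assoc]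
  set V : Matrix m m ℂ := (hKh.eigenvectorUnitary : Matrix m m ℂ)
  have hV : V * Vᴴ = 1 := by
    rw [← star_eq_conjTranspose]; exact Unitary.coe_mul_star_self _
  have hspec : K = V * diagonal (fun i => (hKh.eigenvalues i : ℂ)) * Vᴴ := by
    have := hKh.spectral_theorem
    rwa [Unitary.conjStarAlgAut_apply] at this
  refine ⟨Yᴴ * V, hKh.eigenvalues, ?_, ?_, ?_⟩
  · refine IsUnit.mul ((isUnit_iff_isUnit_det _).2 hYd') ?_
    rw [isUnit_iff_isUnit_det]
    exact IsUnit.of_mul_eq_one (Vᴴ).det (by rw [← det_mul, hV, det_one])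
  · rw [conjTranspose_mul, conjTranspose_conjTranspose, mul_assoc, ← mul_assoc V, hV, one_mul, hY]
  · have : Yᴴ * K * Y = H := by
      rw [hK, ← mul_assoc, ← mul_assoc, mul_nonsing_inv _ hYd', one_mul, mul_assoc,
        nonsing_inv_mul _ hYd, mul_one]
    rw [conjTranspose_mul, conjTranspose_conjTranspose]
    exact this.symm.trans ((congrArg (fun Z => Yᴴ * Z * Y) hspec).trans (by simp only [mul_assoc]))

/-- In the common frame the whole line stays diagonal, so a matrix constraint behaves there like
finitely many scalar slacks `1 + u * l i`. -/
theorem simulDiag_line (B : Matrix m m ℂ) (l : m → ℝ) (u : ℝ) :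
    B * Bᴴ + u • (B * diagonal (fun i => (l i : ℂ)) * Bᴴ)
      = B * diagonal (fun i => ((1 + u * l i : ℝ) : ℂ)) * Bᴴ := by
  have : diagonal (fun i => ((1 + u * l i : ℝ) : ℂ))
      = (1 : Matrix m m ℂ) + u • diagonal (fun i => (l i : ℂ)) := by
    ext i j
    by_cases h : i = j
    · subst h; simp
    · simp [h]
  rw [this, mul_add, add_mul, mul_one, mul_smul_comm, smul_mul_assoc]

theorem posDef_congr_diagonal_iff {B : Matrix m m ℂ} (hB : IsUnit B) (d : m → ℝ) :
    (B * diagonal (fun i => (d i : ℂ)) * Bᴴ).PosDef ↔ ∀ i, 0 < d i := by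
  rw [← star_eq_conjTranspose, hB.posDef_star_right_conjugate_iff, posDef_diagonal_iff]
  simp

theorem posSemidef_congr_diagonal_iff {B : Matrix m m ℂ} (hB : IsUnit B) (d : m → ℝ) :
    (B * diagonal (fun i => (d i : ℂ)) * Bᴴ).PosSemidef ↔ ∀ i, 0 ≤ d i := by
  rw [← star_eq_conjTranspose, hB.posSemidef_star_right_conjugate_iff, posSemidef_diagonal_iff]
  simp

theorem det_congr_diagonal (B : Matrix m m ℂ) (d : m → ℝ) :
    (B * diagonal (fun i => (d i : ℂ)) * Bᴴ).det.re = (B * Bᴴ).det.re * ∏ i, d i := by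
  rw [det_mul, det_mul, det_mul, det_diagonal, ← Complex.ofReal_prod, mul_right_comm,
    Complex.re_mul_ofReal]

/-- Used with `d = 1` for the gradient of log det, and with `d = 1 + s l` to differentiate the
inverse along a line. -/
theorem trace_inv_congr_diagonal {B : Matrix m m ℂ} (hB : IsUnit B) {d : m → ℝ}
    (hd : ∀ i, d i ≠ 0) (H : Matrix m m ℂ) :
    ((B * diagonal (fun i => (d i : ℂ)) * Bᴴ)⁻¹ * H).trace.re
      = ∑ i, ((B⁻¹ * H * (B⁻¹)ᴴ) i i).re / d i := by
  have hBd : IsUnit B.det := (isUnit_iff_isUnit_det _).1 hB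
  have hinv : (diagonal (fun i => (d i : ℂ)))⁻¹ = diagonal (fun i => ((d i : ℂ))⁻¹) := by
    refine inv_eq_right_inv ?_
    rw [diagonal_mul_diagonal]
    convert diagonal_one using 2
    ext i
    exact mul_inv_cancel₀ (by exact_mod_cast hd i)
  rw [Matrix.mul_inv_rev, Matrix.mul_inv_rev, hinv, ← conjTranspose_nonsing_inv, mul_assoc,
    trace_mul_comm, mul_assoc, mul_assoc, ← mul_assoc B⁻¹]
  rw [trace, Complex.re_sum]
  refine Finset.sum_congr rfl fun i _ => ?_
  rw [diag_apply, diagonal_mul, ← Complex.ofReal_inv, Complex.re_ofReal_mul, div_eq_inv_mul]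

theorem trace_inv_mul_inv_mul {B : Matrix m m ℂ} (hB : IsUnit B) (l : m → ℝ) (H : Matrix m m ℂ) :
    ((B * Bᴴ)⁻¹ * (B * diagonal (fun i => (l i : ℂ)) * Bᴴ) * (B * Bᴴ)⁻¹ * H).trace.re
      = ∑ i, l i * ((B⁻¹ * H * (B⁻¹)ᴴ) i i).re := by
  have hBd : IsUnit B.det := (isUnit_iff_isUnit_det _).1 hB
  have hBd' : IsUnit (Bᴴ).det := by rw [det_conjTranspose]; exact hBd.star
  have : (B * Bᴴ)⁻¹ * (B * diagonal (fun i => (l i : ℂ)) * Bᴴ) * (B * Bᴴ)⁻¹ * H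
      = (Bᴴ)⁻¹ * (diagonal (fun i => (l i : ℂ)) * (B⁻¹ * H)) := by
    rw [Matrix.mul_inv_rev]
    simp only [mul_assoc]
    rw [← mul_assoc B⁻¹ B, nonsing_inv_mul _ hBd, one_mul, ← mul_assoc Bᴴ (Bᴴ)⁻¹,
      mul_nonsing_inv _ hBd', one_mul]
  rw [this, trace_mul_comm, ← conjTranspose_nonsing_inv, mul_assoc, trace, Complex.re_sum]
  refine Finset.sum_congr rfl fun i _ => ?_
  rw [diag_apply, diagonal_mul, Complex.re_ofReal_mul]

theorem inv_congr_self {B : Matrix m m ℂ} (hB : IsUnit B) (D : Matrix m m ℂ) :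
    B⁻¹ * (B * D * Bᴴ) * (B⁻¹)ᴴ = D := by
  have hBd : IsUnit B.det := (isUnit_iff_isUnit_det _).1 hB
  have hBd' : IsUnit (Bᴴ).det := by rw [det_conjTranspose]; exact hBd.star
  rw [conjTranspose_nonsing_inv, mul_assoc B, ← mul_assoc B⁻¹, nonsing_inv_mul _ hBd, one_mul,
    mul_assoc, mul_nonsing_inv _ hBd', mul_one]

/-- In the frame that diagonalizes `A` and `D` the trace is a sum of scalar quotients `c i / (1 + s
* l i)`. The test matrix `H` may be arbitrary, since only its diagonal entries in that frame enter.
-/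
theorem hasDerivAt_trace_inv {A D : Matrix m m ℂ} (hA : A.PosDef) (hD : D.IsHermitian)
    (H : Matrix m m ℂ) :
    HasDerivAt (fun s : ℝ => ((A + s • D)⁻¹ * H).trace.re)
      (-(A⁻¹ * D * A⁻¹ * H).trace.re) 0 := by
  obtain ⟨B, l, hB, rfl, rfl⟩ := exists_simulDiag hA hD
  have hev : ∀ᶠ s : ℝ in nhds 0, ∀ i, 1 + s * l i ≠ 0 := by
    rw [Filter.eventually_all]
    intro i
    have : ContinuousAt (fun s : ℝ => 1 + s * l i) 0 := by fun_prop
    exact this.eventually_ne (by simp)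
  have hd : HasDerivAt (fun s : ℝ => ∑ i, ((B⁻¹ * H * (B⁻¹)ᴴ) i i).re / (1 + s * l i))
      (∑ i, -(l i * ((B⁻¹ * H * (B⁻¹)ᴴ) i i).re)) 0 := by
    refine HasDerivAt.fun_sum fun i _ => ?_
    have h1 : HasDerivAt (fun s : ℝ => 1 + s * l i) (l i) 0 := by
      simpa using ((hasDerivAt_id (0 : ℝ)).mul_const (l i)).const_add 1
    have := (hasDerivAt_const (0 : ℝ) ((B⁻¹ * H * (B⁻¹)ᴴ) i i).re).div h1 (by simp)
    refine this.congr_deriv ?_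
    ring
  rw [trace_inv_mul_inv_mul hB, ← Finset.sum_neg_distrib]
  refine hd.congr_of_eventuallyEq (hev.mono fun s hs => ?_)
  beta_reduce
  rw [simulDiag_line, trace_inv_congr_diagonal hB hs]

end SimDiag

/-! ### The problem in coordinates -/

/-- The matrix variables of a point as a single family. -/
def blocks {M U : ℕ} (x : Point M U) : Fin U ⊕ Fin M → CMat M := Sum.elim x.1 x.2.1

theorem blocks_add_smul {M U : ℕ} (x h : Point M U) (u : ℝ) :
    blocks (x + u • h) = blocks x + u • blocks h := by
  ext (i | i) <;> rfl

theorem cov_eq_sum_blocks {M U : ℕ} (x : Point M U) : cov x = ∑ b, blocks x b := by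
  simp [cov, blocks]

theorem isHermitianPoint_iff {M U : ℕ} {x : Point M U} :
    IsHermitianPoint x ↔ ∀ b, (blocks x b).IsHermitian := by
  simp [IsHermitianPoint, blocks]

theorem IsHermitianPoint.add_smul {M U : ℕ} {x h : Point M U} (hx : IsHermitianPoint x)
    (hh : IsHermitianPoint h) (u : ℝ) : IsHermitianPoint (x + u • h) := by
  rw [isHermitianPoint_iff] at *
  intro b
  rw [blocks_add_smul]
  refine (hx b).add ?_
  rw [Pi.smul_apply, Matrix.IsHermitian, Matrix.conjTranspose_smul, (hh b).eq, star_trivial]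

theorem IsHermitianPoint.sub {M U : ℕ} {x h : Point M U} (hx : IsHermitianPoint x)
    (hh : IsHermitianPoint h) : IsHermitianPoint (x - h) := by
  simpa [sub_eq_add_neg] using hx.add_smul hh (-1)

/-- Indices of the real coordinates `(re R, im R, (Tr (H_{s,i} F_i))_i)`. -/
abbrev CoordIdx (M U : ℕ) : Type := (Fin M × Fin M) ⊕ (Fin M × Fin M) ⊕ Fin U

/-- Indices of the scalar inequality constraints. -/
abbrev SlackIdx (M U L : ℕ) : Type := Fin U ⊕ Fin M ⊕ Fin L

/-- The coefficients of the functional `R ↦ Re Tr (A R)`. -/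
def matRow {M U : ℕ} (A : CMat M) : CoordIdx M U → ℝ :=
  Sum.elim (fun p => (A p.2 p.1).re) (Sum.elim (fun p => -(A p.2 p.1).im) 0)

/-! ### The scalar quantities that determine the objective and the scalar constraints. -/

namespace ProblemData

variable {G K M U L : ℕ} (P : ProblemData G K M U L)

/-- The real quantities on which the objective and the scalar constraints depend. -/
def coords : (Fin U ⊕ Fin M → CMat M) →ₗ[ℝ] (CoordIdx M U → ℝ) where
  toFun Z := Sum.elim (fun p => ((∑ b, Z b) p.1 p.2).re)
    (Sum.elim (fun p => ((∑ b, Z b) p.1 p.2).im) fun i => (P.chanS i * Z (Sum.inl i)).trace.re)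
  map_add' Z Z' := by
    ext (p | p | i) <;> simp [Finset.sum_add_distrib, Matrix.mul_add, -Fintype.sum_sum_type]
  map_smul' u Z := by
    ext (p | p | i) <;> simp [← Finset.smul_sum, -Fintype.sum_sum_type]

theorem coords_apply (Z : Fin U ⊕ Fin M → CMat M) : P.coords Z =
    Sum.elim (fun p => ((∑ b, Z b) p.1 p.2).re)
    (Sum.elim (fun p => ((∑ b, Z b) p.1 p.2).im)
      fun i => (P.chanS i * Z (Sum.inl i)).trace.re) := rfl

/-- Turns the trace constraints and the beam values `aᴴ R a` into dot products with the coordinate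
vector. -/
theorem matRow_dotProduct (A : CMat M) (Z : Fin U ⊕ Fin M → CMat M) :
    matRow A ⬝ᵥ P.coords Z = (A * ∑ b, Z b).trace.re := by
  rw [coords_apply]
  generalize ∑ b, Z b = R
  simp only [matRow, sumElim_dotProduct_sumElim, zero_dotProduct, add_zero]
  simp only [dotProduct, Matrix.trace, Matrix.diag_apply,
    Matrix.mul_apply, Complex.re_sum, Complex.mul_re]
  rw [← Finset.sum_add_distrib, Fintype.sum_prod_type, Finset.sum_comm]
  exact Finset.sum_congr rfl fun i _ => Finset.sum_congr rfl fun j _ => by ring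

/-- The linear part of the slack of a scalar constraint. -/
def slackRow : SlackIdx M U L → CoordIdx M U → ℝ
  | .inl i => (1 + 1 / P.sinr i) • Pi.single (.inr (.inr i)) 1 - matRow (P.chanS i)
  | .inr (.inl m) => Pi.single (.inl (m, m)) (-1)
  | .inr (.inr l) => -matRow (P.chanP l)

/-- The constant part of the slack of a scalar constraint. -/
def slackOffset : SlackIdx M U L → ℝ
  | .inl i => -P.noise i
  | .inr (.inl _) => P.power / M
  | .inr (.inr _) => P.thres

/-- The slacks of the scalar constraints. -/
def slack (x : Point M U) (k : SlackIdx M U L) : ℝ :=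
  P.slackOffset k + P.slackRow k ⬝ᵥ P.coords (blocks x)

theorem slack_inl (x : Point M U) (i : Fin U) : P.slack x (.inl i) = P.sinrSlack x i := by
  have h1 : (P.chanS i * ∑ b, blocks x b).trace.re
      = ∑ j, (P.chanS i * x.1 j).trace.re + ∑ t, (P.chanS i * x.2.1 t).trace.re := by
    simp [Matrix.mul_sum, Matrix.mul_add, blocks, Matrix.trace_sum]
  rw [slack, slackOffset, slackRow, sub_dotProduct, P.matRow_dotProduct, h1, smul_dotProduct,
    single_dotProduct, coords_apply, sinrSlack, (P.chanS_psd i).1.eq]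
  simp only [blocks, Sum.elim_inr, Sum.elim_inl, one_mul, smul_eq_mul]
  ring

theorem slack_inr_inl (x : Point M U) (m : Fin M) :
    P.slack x (.inr (.inl m)) = P.powerSlack x m := by
  rw [slack, slackOffset, slackRow, single_dotProduct, coords_apply, powerSlack, cov_eq_sum_blocks]
  simp only [Sum.elim_inl]
  ring

theorem slack_inr_inr (x : Point M U) (l : Fin L) :
    P.slack x (.inr (.inr l)) = P.interferenceSlack x l := by
  have h1 : (P.chanP l * ∑ b, blocks x b).trace.re
      = ∑ j, (P.chanP l * x.1 j).trace.re + ∑ t, (P.chanP l * x.2.1 t).trace.re := by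
    simp [Matrix.mul_sum, Matrix.mul_add, blocks, Matrix.trace_sum]
  rw [slack, slackOffset, slackRow, neg_dotProduct, P.matRow_dotProduct, h1, interferenceSlack]
  ring

/-- The derivative of the slack of a scalar constraint in the direction `h`. -/
def slackLin (h : Point M U) (k : SlackIdx M U L) : ℝ := P.slackRow k ⬝ᵥ P.coords (blocks h)

theorem slack_add_smul (x h : Point M U) (u : ℝ) (k : SlackIdx M U L) :
    P.slack (x + u • h) k = P.slack x k + u * P.slackLin h k := by
  simp only [slack, slackLin, blocks_add_smul, map_add, map_smul, dotProduct_add, dotProduct_smul,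
    smul_eq_mul]
  ring

theorem slackLin_add_smul (x h : Point M U) (u : ℝ) (k : SlackIdx M U L) :
    P.slackLin (x + u • h) k = P.slackLin x k + u * P.slackLin h k := by
  simp only [slackLin, blocks_add_smul, map_add, map_smul, dotProduct_add, dotProduct_smul,
    smul_eq_mul]

theorem strictlyFeasible_iff {x : Point M U} :
    P.StrictlyFeasible x ↔ (∀ k, 0 < P.slack x k) ∧ ∀ b, (blocks x b).PosDef := by
  simp only [StrictlyFeasible, Sum.forall, slack_inl, slack_inr_inl, slack_inr_inr, blocks,
    Sum.elim_inl, Sum.elim_inr, and_assoc]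

theorem feasible_iff {x : Point M U} :
    P.Feasible x ↔ (∀ k, 0 ≤ P.slack x k) ∧ ∀ b, (blocks x b).PosSemidef := by
  simp only [Feasible, Sum.forall, slack_inl, slack_inr_inl, slack_inr_inr, blocks,
    Sum.elim_inl, Sum.elim_inr, and_assoc]

variable {P} in
theorem StrictlyFeasible.isHermitianPoint {x : Point M U} (hx : P.StrictlyFeasible x) :
    IsHermitianPoint x :=
  isHermitianPoint_iff.2 fun b => ((P.strictlyFeasible_iff.1 hx).2 b).1

variable {P} in
theorem Feasible.isHermitianPoint {x : Point M U} (hx : P.Feasible x) :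
    IsHermitianPoint x :=
  isHermitianPoint_iff.2 fun b => ((P.feasible_iff.1 hx).2 b).1

variable {P} in
theorem StrictlyFeasible.feasible {x : Point M U} (hx : P.StrictlyFeasible x) : P.Feasible x := by
  rw [strictlyFeasible_iff] at hx
  exact P.feasible_iff.2 ⟨fun k => (hx.1 k).le, fun b => (hx.2 b).posSemidef⟩

theorem barrier_eq (x : Point M U) :
    P.barrier x = ∑ k, Real.log (P.slack x k) + ∑ b, Real.log (blocks x b).det.re := by
  simp only [barrier, Fintype.sum_sum_type, slack_inl, slack_inr_inl, slack_inr_inr, blocks,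
    Sum.elim_inl, Sum.elim_inr]
  ring

/-- The coefficients of the functional `R ↦ aᴴ R a` for the steering vector `a`. -/
def beamRow (g : Fin G) (t : Fin K) : CoordIdx M U → ℝ :=
  matRow (Matrix.of fun m n => P.steer g t m * star (P.steer g t n))

/-- The residual `ω 𝒟 - aᴴ R a` for a sampled angle. -/
def resid (x : Point M U) (g : Fin G) (t : Fin K) : ℝ :=
  P.desired g t * x.2.2 - P.beamRow g t ⬝ᵥ P.coords (blocks x)

theorem resid_add_smul (x h : Point M U) (u : ℝ) (g : Fin G) (t : Fin K) :
    P.resid (x + u • h) g t = P.resid x g t + u * P.resid h g t := by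
  simp only [resid, blocks_add_smul, map_add, map_smul, dotProduct_add, dotProduct_smul,
    smul_eq_mul, Prod.snd_add, Prod.smul_snd]
  ring

/-- `aᴴ R a` is real because `R` is Hermitian, so the modulus in the objective becomes an ordinary
square. -/
theorem residualRow_dotProduct {x : Point M U} (hx : IsHermitianPoint x) (g : Fin G)
    (t : Fin K) : P.residualRow g t ⬝ᵥ stacked x = (P.resid x g t : ℂ) := by
  have hR : (cov x).IsHermitian := by
    rw [cov_eq_sum_blocks]
    exact isSelfAdjoint_sum _ fun b _ => isHermitianPoint_iff.1 hx b
  have h1 : P.residualRow g t ⬝ᵥ stacked x = (P.desired g t : ℂ) * x.2.2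
      - ((Matrix.of fun m n => P.steer g t m * star (P.steer g t n)) * cov x).trace := by
    rw [residualRow, stacked, sumElim_dotProduct_sumElim]
    simp only [dotProduct, Finset.univ_unique, Finset.sum_singleton, Fintype.sum_prod_type,
      Matrix.trace, Matrix.diag_apply, Matrix.mul_apply, Matrix.of_apply, sub_eq_add_neg]
    rw [Finset.sum_comm, ← Finset.sum_neg_distrib]
    congr 1
    refine Finset.sum_congr rfl fun i _ => ?_
    rw [← Finset.sum_neg_distrib]
    exact Finset.sum_congr rfl fun j _ => by ring
  have h2 : (((Matrix.of fun m n => P.steer g t m * star (P.steer g t n)) * cov x).trace).im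
      = 0 := by
    rw [← Complex.conj_eq_iff_im, starRingEnd_apply, ← Matrix.trace_conjTranspose,
      Matrix.conjTranspose_mul, hR.eq, Matrix.trace_mul_comm]
    congr 2
    ext m n
    simp [mul_comm]
  rw [h1, resid, beamRow, matRow_dotProduct, ← cov_eq_sum_blocks]
  refine Complex.ext (by simp) ?_
  rw [Complex.sub_im, h2]
  simp

theorem objective_eq {x : Point M U} (hx : IsHermitianPoint x) :
    P.objective x = 1 / G * ∑ g, ∑ t, P.resid x g t ^ 2 := by
  have h1 : star (stacked x) ⬝ᵥ (P.Omega.mulVec (stacked x))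
      = ((1 / G * ∑ g, ∑ t, P.resid x g t ^ 2 : ℝ) : ℂ) := by
    rw [Omega, Matrix.smul_mulVec, dotProduct_smul, Matrix.sum_mulVec, dotProduct_sum]
    push_cast
    rw [smul_eq_mul]
    congr 1
    refine Finset.sum_congr rfl fun g _ => ?_
    rw [Matrix.sum_mulVec, dotProduct_sum]
    refine Finset.sum_congr rfl fun t _ => ?_
    rw [Matrix.vecMulVec_mulVec, P.residualRow_dotProduct hx, dotProduct_smul,
      Matrix.star_dotProduct_star, P.residualRow_dotProduct hx]
    simp [sq]
  rw [objective, h1, Complex.ofReal_re]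

end ProblemData

namespace ProblemData

variable {G K M U L : ℕ} (P : ProblemData G K M U L)

/-! ### Restriction to lines and derivatives -/

/-- The bilinear form of the Hessian of the objective. -/
def objForm (d h : Point M U) : ℝ := 2 / G * ∑ g, ∑ t, P.resid d g t * P.resid h g t

/-- The derivative of the barrier at `x` in the direction `h`. -/
def barGrad (x h : Point M U) : ℝ :=
  ∑ k, P.slackLin h k / P.slack x k + ∑ b, ((blocks x b)⁻¹ * blocks h b).trace.re

/-- The negative of the Hessian of the barrier at `x`. -/
def barHess (x d h : Point M U) : ℝ :=
  ∑ k, P.slackLin d k * P.slackLin h k / P.slack x k ^ 2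
    + ∑ b, ((blocks x b)⁻¹ * blocks d b * (blocks x b)⁻¹ * blocks h b).trace.re

theorem objForm_add_smul_left (x d h : Point M U) (u : ℝ) :
    P.objForm (x + u • d) h = P.objForm x h + u * P.objForm d h := by
  simp only [objForm, resid_add_smul, add_mul, Finset.sum_add_distrib, mul_assoc,
    ← Finset.mul_sum]
  ring

theorem objForm_comm (d h : Point M U) : P.objForm d h = P.objForm h d := by
  simp only [objForm, mul_comm]

theorem objForm_self_nonneg (d : Point M U) : 0 ≤ P.objForm d d :=
  mul_nonneg (by positivity) <| Finset.sum_nonneg fun g _ => Finset.sum_nonneg fun t _ =>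
    mul_self_nonneg _

theorem objective_add_smul {x h : Point M U} (hx : IsHermitianPoint x) (hh : IsHermitianPoint h)
    (u : ℝ) : P.objective (x + u • h)
      = P.objective x + u * P.objForm x h + u ^ 2 / 2 * P.objForm h h := by
  rw [P.objective_eq hx, P.objective_eq (hx.add_smul hh u), objForm, objForm]
  simp only [resid_add_smul]
  have : ∀ g t, (P.resid x g t + u * P.resid h g t) ^ 2 = P.resid x g t ^ 2
      + (2 * u) * (P.resid x g t * P.resid h g t) + u ^ 2 * (P.resid h g t * P.resid h g t) :=
    fun g t => by ring
  simp only [this, Finset.sum_add_distrib, ← Finset.mul_sum]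
  ring

theorem objective_nonneg {x : Point M U} (hx : IsHermitianPoint x) : 0 ≤ P.objective x := by
  rw [P.objective_eq hx]; positivity

/-- Indices of the eigenvalues that describe the constraints along a line. -/
abbrev LineIdx (M U L : ℕ) : Type := SlackIdx M U L ⊕ (Fin U ⊕ Fin M) × Fin M

theorem forall_lineIdx {p : LineIdx M U L → Prop} :
    (∀ j, p j) ↔ (∀ k, p (.inl k)) ∧ ∀ b i, p (.inr (b, i)) :=
  ⟨fun h => ⟨fun k => h _, fun b i => h _⟩, fun h j => by
    rcases j with k | ⟨b, i⟩
    exacts [h.1 k, h.2 b i]⟩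

/-- Along a line through a strictly feasible point all constraints are diagonal. -/
theorem exists_line {x h : Point M U} (hx : P.StrictlyFeasible x) (hh : IsHermitianPoint h) :
    ∃ l : LineIdx M U L → ℝ,
      (∀ u : ℝ, P.StrictlyFeasible (x + u • h) ↔ ∀ j, 0 < 1 + u * l j) ∧
      (∀ u : ℝ, P.Feasible (x + u • h) ↔ ∀ j, 0 ≤ 1 + u * l j) ∧
      (∀ u : ℝ, (∀ j, 0 < 1 + u * l j) →
        P.barrier (x + u • h) = P.barrier x + ∑ j, Real.log (1 + u * l j)) ∧
      P.barGrad x h = ∑ j, l j ∧ P.barHess x h h = ∑ j, l j ^ 2 := by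
  obtain ⟨hs, hX⟩ := P.strictlyFeasible_iff.1 hx
  rw [isHermitianPoint_iff] at hh
  -- Each block gets a frame shared with its direction and contributes `M` eigenvalues; a scalar
  -- slack contributes the single quotient `slackLin / slack`.
  choose B l hB hXB hhB using fun b => exists_simulDiag (hX b) (hh b)
  have hslack : ∀ (u : ℝ) k, P.slack (x + u • h) k
      = P.slack x k * (1 + u * (P.slackLin h k / P.slack x k)) := fun u k => by
    rw [slack_add_smul]
    field_simp [(hs k).ne']
  have hblock : ∀ (u : ℝ) b, blocks (x + u • h) b
      = B b * Matrix.diagonal (fun i => ((1 + u * l b i : ℝ) : ℂ)) * (B b).conjTranspose :=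
    fun u b => by
      rw [blocks_add_smul, Pi.add_apply, Pi.smul_apply, hXB b, hhB b, simulDiag_line]
  refine ⟨Sum.elim (fun k => P.slackLin h k / P.slack x k) fun p => l p.1 p.2,
    fun u => ?_, fun u => ?_, fun u hu => ?_, ?_, ?_⟩
  · rw [strictlyFeasible_iff, forall_lineIdx]
    simp only [hslack, hblock, posDef_congr_diagonal_iff (hB _), Sum.elim_inl, Sum.elim_inr,
      mul_pos_iff_of_pos_left (hs _)]
  · rw [feasible_iff, forall_lineIdx]
    simp only [hslack, hblock, posSemidef_congr_diagonal_iff (hB _), Sum.elim_inl, Sum.elim_inr,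
      mul_nonneg_iff_of_pos_left (hs _)]
  · rw [forall_lineIdx] at hu
    simp only [Sum.elim_inl, Sum.elim_inr] at hu
    have hdet : ∀ b, 0 < (blocks x b).det.re := fun b =>
      (Complex.lt_def.1 (hX b).det_pos).1
    rw [barrier_eq, barrier_eq, Fintype.sum_sum_type (α₁ := SlackIdx M U L), Fintype.sum_prod_type]
    simp only [Sum.elim_inl, Sum.elim_inr]
    have h1 : ∀ k, Real.log (P.slack (x + u • h) k) = Real.log (P.slack x k)
        + Real.log (1 + u * (P.slackLin h k / P.slack x k)) := fun k => by
      rw [hslack, Real.log_mul (hs k).ne' (hu.1 k).ne']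
    have h2 : ∀ b, Real.log (blocks (x + u • h) b).det.re = Real.log (blocks x b).det.re
        + ∑ i, Real.log (1 + u * l b i) := fun b => by
      rw [hblock, det_congr_diagonal, ← hXB, Real.log_mul (hdet b).ne'
        (Finset.prod_pos fun i _ => hu.2 b i).ne', Real.log_prod fun i _ => (hu.2 b i).ne']
    simp only [h1, h2, Finset.sum_add_distrib]
    ring
  · rw [barGrad, Fintype.sum_sum_type (α₁ := SlackIdx M U L), Fintype.sum_prod_type]
    simp only [Sum.elim_inl, Sum.elim_inr]
    congr 1
    refine Finset.sum_congr rfl fun b _ => ?_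
    have := trace_inv_congr_diagonal (hB b) (d := fun _ => 1) (fun _ => one_ne_zero) (blocks h b)
    have e : Matrix.diagonal (fun _ : Fin M => ((1 : ℝ) : ℂ)) = 1 := by simp
    rw [e, mul_one, ← hXB] at this
    rw [this, hhB b, inv_congr_self (hB b)]
    simp
  · rw [barHess, Fintype.sum_sum_type (α₁ := SlackIdx M U L), Fintype.sum_prod_type]
    simp only [Sum.elim_inl, Sum.elim_inr]
    congr 1
    · exact Finset.sum_congr rfl fun k _ => by rw [div_pow, sq (P.slackLin h k)]
    · refine Finset.sum_congr rfl fun b _ => ?_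
      have := trace_inv_mul_inv_mul (hB b) (l b) (blocks h b)
      rw [← hXB, ← hhB] at this
      rw [this]
      nth_rewrite 1 [hhB b]
      rw [inv_congr_self (hB b)]
      simp [sq]

/-- The finitely many conditions `0 < 1 + u * l j` are open at `u = 0`. This is needed because
`deriv` depends on a whole neighbourhood, whereas the closed formulas hold at strictly feasible
points. -/
theorem eventually_strictlyFeasible {x h : Point M U} (hx : P.StrictlyFeasible x)
    (hh : IsHermitianPoint h) : ∀ᶠ u : ℝ in nhds 0, P.StrictlyFeasible (x + u • h) := by
  obtain ⟨l, hl, -⟩ := P.exists_line hx hh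
  simp only [hl]
  rw [Filter.eventually_all]
  intro j
  have : ContinuousAt (fun u : ℝ => 1 + u * l j) 0 := by fun_prop
  exact this.eventually_const_lt (by simp)

theorem gradDir_eq {τ : ℝ} {x h : Point M U} (hx : P.StrictlyFeasible x)
    (hh : IsHermitianPoint h) :
    P.gradDir τ x h = P.objForm x h - 1 / τ * P.barGrad x h := by
  obtain ⟨l, hl, -, hB, hg, -⟩ := P.exists_line hx hh
  have hev : (fun u : ℝ => P.penalized τ (x + u • h)) =ᶠ[nhds 0] fun u =>
      (P.objective x + u * P.objForm x h + u ^ 2 / 2 * P.objForm h h)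
        - 1 / τ * (P.barrier x + ∑ j, Real.log (1 + u * l j)) :=
    (P.eventually_strictlyFeasible hx hh).mono fun u hu => by
      beta_reduce
      rw [penalized, P.objective_add_smul hx.isHermitianPoint hh, hB u ((hl u).1 hu)]
  have hlog : HasDerivAt (fun u : ℝ => ∑ j, Real.log (1 + u * l j)) (∑ j, l j) 0 := by
    refine HasDerivAt.fun_sum fun j _ => ?_
    have h1 : HasDerivAt (fun s : ℝ => 1 + s * l j) (l j) 0 := by
      simpa using ((hasDerivAt_id (0 : ℝ)).mul_const (l j)).const_add 1
    simpa using h1.log (by simp)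
  have hobj : HasDerivAt (fun u : ℝ => P.objective x + u * P.objForm x h
      + u ^ 2 / 2 * P.objForm h h) (P.objForm x h) 0 := by
    have h1 := ((hasDerivAt_id (0 : ℝ)).mul_const (P.objForm x h)).const_add (P.objective x)
    have h2 := (((hasDerivAt_id (0 : ℝ)).pow 2).div_const 2).mul_const (P.objForm h h)
    simpa using h1.fun_add h2
  rw [gradDir, hev.deriv_eq, (hobj.fun_sub ((hlog.const_add _).const_mul _)).deriv, hg]

theorem hasDerivAt_barGrad {x d h : Point M U} (hx : P.StrictlyFeasible x)
    (hd : IsHermitianPoint d) :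
    HasDerivAt (fun s : ℝ => P.barGrad (x + s • d) h) (-P.barHess x d h) 0 := by
  obtain ⟨hs, hX⟩ := P.strictlyFeasible_iff.1 hx
  rw [isHermitianPoint_iff] at hd
  simp only [barGrad, barHess, slack_add_smul, blocks_add_smul, Pi.add_apply, Pi.smul_apply]
  rw [neg_add, ← Finset.sum_neg_distrib, ← Finset.sum_neg_distrib]
  refine (HasDerivAt.fun_sum fun k _ => ?_).add
    (HasDerivAt.fun_sum fun b _ => hasDerivAt_trace_inv (hX b) (hd b) _)
  have h1 : HasDerivAt (fun s : ℝ => P.slack x k + s * P.slackLin d k) (P.slackLin d k) 0 := by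
    simpa using ((hasDerivAt_id (0 : ℝ)).mul_const (P.slackLin d k)).const_add (P.slack x k)
  have := (hasDerivAt_const (0 : ℝ) (P.slackLin h k)).div h1 (by simpa using (hs k).ne')
  refine this.congr_deriv ?_
  ring

theorem hessDir_eq {τ : ℝ} {x d h : Point M U} (hx : P.StrictlyFeasible x)
    (hd : IsHermitianPoint d) (hh : IsHermitianPoint h) :
    P.hessDir τ x d h = P.objForm d h + 1 / τ * P.barHess x d h := by
  have hev : (fun s : ℝ => P.gradDir τ (x + s • d) h) =ᶠ[nhds 0] fun s =>
      (P.objForm x h + s * P.objForm d h) - 1 / τ * P.barGrad (x + s • d) h :=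
    (P.eventually_strictlyFeasible hx hd).mono fun u hu => by
      beta_reduce
      rw [P.gradDir_eq hu hh, objForm_add_smul_left]
  have h1 : HasDerivAt (fun s : ℝ => P.objForm x h + s * P.objForm d h) (P.objForm d h) 0 := by
    simpa using ((hasDerivAt_id (0 : ℝ)).mul_const (P.objForm d h)).const_add (P.objForm x h)
  rw [hessDir, hev.deriv_eq, (h1.fun_sub ((P.hasDerivAt_barGrad hx hd).const_mul _)).deriv]
  ring

/-- The Newton system, multiplied by the barrier parameter. -/
theorem isNewtonDirection_iff {τ : ℝ} (hτ : 0 < τ) {x d : Point M U} (hx : P.StrictlyFeasible x)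
    (hd : IsHermitianPoint d) : P.IsNewtonDirection τ x d ↔ ∀ h, IsHermitianPoint h →
      τ * P.objForm d h + P.barHess x d h = -(τ * P.objForm x h - P.barGrad x h) := by
  simp only [IsNewtonDirection, hd, true_and]
  refine forall₂_congr fun h hh => ?_
  rw [P.hessDir_eq hx hd hh, P.gradDir_eq hx hh]
  constructor <;> intro H
  · field_simp at H
    linarith
  · field_simp
    linarith

end ProblemData

/-! ### Convergence of the damped Newton method -/

/-- For `x = exp s` this is `s ≤ sinh s`. Its accuracy to second order at `1` is what both bounds
below rely on. -/
theorem log_le_half_sub_inv {x : ℝ} (hx : 1 ≤ x) : Real.log x ≤ (x - x⁻¹) / 2 := by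
  rw [← Real.sinh_log (by linarith)]
  exact Real.self_le_sinh_iff.2 (Real.log_nonneg hx)

/-- Controls the barrier along a step in which every `1 + s * l j` moves by at most one half. For
negative `t`, the plain bound `log x ≤ x - 1` at `x = 1 / (1 + t)` would lose a factor up to two. -/
theorem sub_log_one_add_le {t : ℝ} (ht : |t| ≤ 1 / 2) : t - Real.log (1 + t) ≤ t ^ 2 := by
  obtain ⟨h1, h2⟩ := abs_le.1 ht
  have hpos : 0 < 1 + t := by linarith
  rcases le_or_gt 0 t with h0 | h0
  · have h := Real.one_sub_inv_le_log_of_pos hpos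
    have e : 1 - (1 + t)⁻¹ = t / (1 + t) := by field_simp; ring
    have h3 : t - t ^ 2 ≤ t / (1 + t) := by
      rw [le_div_iff₀ hpos]; nlinarith [mul_nonneg h0 (sq_nonneg t)]
    linarith
  · have h := log_le_half_sub_inv ((one_le_inv₀ hpos).2 (by linarith))
    rw [Real.log_inv, inv_inv] at h
    have h3 : (1 + t)⁻¹ ≤ 1 - t + 2 * t ^ 2 := by
      rw [inv_le_iff_one_le_mul₀ hpos]; nlinarith [sq_nonneg t]
    linarith

/-- Quadratic near zero and linear for large `|t|`. No smallness is required, so `x` can be compared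
with an arbitrary strictly feasible point. -/
theorem le_sub_log_one_add {t : ℝ} (ht : 0 < 1 + t) :
    t ^ 2 / (2 * (1 + |t|)) ≤ t - Real.log (1 + t) := by
  rcases le_or_gt 0 t with h0 | h0
  · have h := log_le_half_sub_inv (x := 1 + t) (by linarith)
    have e : t ^ 2 / (2 * (1 + |t|)) = t - (1 + t - (1 + t)⁻¹) / 2 := by
      rw [abs_of_nonneg h0]; field_simp; ring
    linarith
  · have h := Real.le_log_one_add_of_nonneg (x := -t / (1 + t)) (div_nonneg (by linarith) ht.le)
    have e : 1 + -t / (1 + t) = (1 + t)⁻¹ := by field_simp; ring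
    rw [e, Real.log_inv] at h
    have e2 : 2 * (-t / (1 + t)) / (-t / (1 + t) + 2) = -2 * t / (2 + t) := by
      have : 0 < 2 + t := by linarith
      rw [show -t / (1 + t) + 2 = (2 + t) / (1 + t) by field_simp; ring]
      field_simp
    have e3 : t + -2 * t / (2 + t) = t ^ 2 / (2 + t) := by
      have : 0 < 2 + t := by linarith
      field_simp
      ring
    have h4 : t ^ 2 / (2 * (1 + |t|)) ≤ t ^ 2 / (2 + t) :=
      div_le_div_of_nonneg_left (sq_nonneg t) (by linarith) (by linarith [abs_nonneg t])
    linarith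

/-! ### Newton decrement and gap of the merit function. -/

namespace ProblemData

variable {G K M U L : ℕ} (P : ProblemData G K M U L)

/-- The barrier problem's objective, multiplied by the barrier parameter. -/
def merit (τ : ℝ) (x : Point M U) : ℝ := τ * P.objective x - P.barrier x

/-- The Hessian of the merit function. -/
def newtonForm (τ : ℝ) (x d h : Point M U) : ℝ := τ * P.objForm d h + P.barHess x d h

theorem barHess_comm (x d h : Point M U) : P.barHess x d h = P.barHess x h d := by
  unfold barHess
  congr 1
  · exact Finset.sum_congr rfl fun k _ => by rw [mul_comm (P.slackLin d k)]
  · refine Finset.sum_congr rfl fun b _ => ?_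
    rw [mul_assoc, Matrix.trace_mul_comm, ← mul_assoc]

theorem barHess_add_smul_left (x e d h : Point M U) (u : ℝ) :
    P.barHess x (e + u • d) h = P.barHess x e h + u * P.barHess x d h := by
  have h1 : ∀ b, ((blocks x b)⁻¹ * blocks (e + u • d) b * (blocks x b)⁻¹ * blocks h b).trace.re
      = ((blocks x b)⁻¹ * blocks e b * (blocks x b)⁻¹ * blocks h b).trace.re
        + u * ((blocks x b)⁻¹ * blocks d b * (blocks x b)⁻¹ * blocks h b).trace.re := fun b => by
    simp [blocks_add_smul, mul_add, add_mul]
  simp only [barHess, h1]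
  simp only [slackLin_add_smul, add_mul, add_div, Finset.sum_add_distrib, mul_assoc,
    mul_div_assoc, ← Finset.mul_sum]
  ring

theorem newtonForm_comm (τ : ℝ) (x d h : Point M U) :
    P.newtonForm τ x d h = P.newtonForm τ x h d := by
  rw [newtonForm, newtonForm, objForm_comm, barHess_comm]

theorem newtonForm_add_smul_left (τ : ℝ) (x e d h : Point M U) (u : ℝ) :
    P.newtonForm τ x (e + u • d) h = P.newtonForm τ x e h + u * P.newtonForm τ x d h := by
  rw [newtonForm, newtonForm, newtonForm, objForm_add_smul_left, barHess_add_smul_left]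
  ring

variable {P}

theorem StrictlyFeasible.barHess_self_nonneg {x h : Point M U} (hx : P.StrictlyFeasible x)
    (hh : IsHermitianPoint h) : 0 ≤ P.barHess x h h := by
  obtain ⟨l, -, -, -, -, h⟩ := P.exists_line hx hh
  rw [h]; positivity

theorem StrictlyFeasible.newtonForm_self_nonneg {τ : ℝ} (hτ : 0 ≤ τ) {x h : Point M U}
    (hx : P.StrictlyFeasible x) (hh : IsHermitianPoint h) : 0 ≤ P.newtonForm τ x h h :=
  add_nonneg (mul_nonneg hτ (P.objForm_self_nonneg h)) (hx.barHess_self_nonneg hh)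

/-- Cauchy–Schwarz by the discriminant of `u ↦ N(d + u h, d + u h)`; semidefiniteness suffices, and
the form does degenerate in the direction of `ω` if all desired values vanish. -/
theorem StrictlyFeasible.newtonForm_sq_le {τ : ℝ} (hτ : 0 ≤ τ) {x d h : Point M U}
    (hx : P.StrictlyFeasible x) (hd : IsHermitianPoint d) (hh : IsHermitianPoint h) :
    P.newtonForm τ x d h ^ 2 ≤ P.newtonForm τ x d d * P.newtonForm τ x h h := by
  have key : ∀ u : ℝ, 0 ≤ P.newtonForm τ x h h * (u * u) + 2 * P.newtonForm τ x d h * u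
      + P.newtonForm τ x d d := fun u => by
    have := hx.newtonForm_self_nonneg hτ (hd.add_smul hh u)
    rw [newtonForm_add_smul_left, P.newtonForm_comm τ x d, P.newtonForm_comm τ x h,
      newtonForm_add_smul_left, newtonForm_add_smul_left, P.newtonForm_comm τ x h d] at this
    linarith
  have := discrim_le_zero key
  rw [discrim] at this
  linarith

theorem StrictlyFeasible.newtonForm_self {τ : ℝ} (hτ : 0 < τ) {x d : Point M U}
    (hx : P.StrictlyFeasible x) (hd : P.IsNewtonDirection τ x d) {h : Point M U}
    (hh : IsHermitianPoint h) :
    P.newtonForm τ x d h = -(τ * P.objForm x h - P.barGrad x h) :=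
  (P.isNewtonDirection_iff hτ hx hd.1).1 hd h hh

/-- A damped Newton step decreases the merit function. -/
theorem StrictlyFeasible.newton_step {τ : ℝ} (hτ : 0 < τ) {x d : Point M U}
    (hx : P.StrictlyFeasible x) (hd : P.IsNewtonDirection τ x d) {D s : ℝ}
    (hD : D = P.newtonForm τ x d d) (hs : s = 1 / (2 * (1 + D))) :
    P.StrictlyFeasible (x + s • d) ∧
      P.merit τ (x + s • d) ≤ P.merit τ x - D / (4 * (1 + D)) := by
  obtain ⟨l, hl, -, hB, hg, hH⟩ := P.exists_line hx hd.1
  have hN := hx.newtonForm_self hτ hd hd.1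
  have hform := mul_nonneg hτ.le (P.objForm_self_nonneg d)
  have hD0 : 0 ≤ D := hD ▸ hx.newtonForm_self_nonneg hτ.le hd.1
  rw [← hD, hg] at hN
  rw [newtonForm, hH] at hD
  have hs0 : 0 < s := by rw [hs]; positivity
  have hs1 : s * (2 * (1 + D)) = 1 := by rw [hs]; field_simp
  -- `s² l_j² ≤ D / (4 (1 + D)²) ≤ 1/4`. This gives strict feasibility and makes the bound on the
  -- logarithm applicable.
  have hsmall : ∀ j, |s * l j| ≤ 1 / 2 := fun j => by
    have h1 : l j ^ 2 ≤ D := by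
      have := Finset.single_le_sum (f := fun j => l j ^ 2) (fun i _ => sq_nonneg _)
        (Finset.mem_univ j)
      beta_reduce at this
      linarith
    refine abs_le_of_sq_le_sq ?_ (by norm_num)
    nlinarith [mul_le_mul_of_nonneg_left h1 (sq_nonneg s), mul_pos hs0 hs0]
  have hpos : ∀ j, 0 < 1 + s * l j := fun j => by
    have := (abs_le.1 (hsmall j)).1
    linarith
  refine ⟨(hl s).2 hpos, ?_⟩
  have hlog : s * ∑ j, l j - s ^ 2 * ∑ j, l j ^ 2 ≤ ∑ j, Real.log (1 + s * l j) := by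
    rw [Finset.mul_sum, Finset.mul_sum, ← Finset.sum_sub_distrib]
    refine Finset.sum_le_sum fun j _ => ?_
    have := sub_log_one_add_le (hsmall j)
    linarith [mul_pow s (l j) 2]
  rw [merit, merit, hB s hpos, P.objective_add_smul hx.isHermitianPoint hd.1]
  have e : D / (4 * (1 + D)) = s * D / 2 := by rw [hs]; field_simp; norm_num
  rw [e]
  have hs2 : s ≤ 1 / 2 := by nlinarith
  -- By the Newton equation the first-order term is `-s * D`; the second-order terms add at most `s
  -- ^ 2 * D`, which is half of that.
  have h3 : s ^ 2 * D ≤ s * D / 2 := by nlinarith [mul_nonneg hs0.le hD0]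
  nlinarith [mul_nonneg (sq_nonneg s) hform]

/-- If the Newton decrement is small, then the merit function is almost minimal. -/
theorem StrictlyFeasible.merit_le {τ : ℝ} (hτ : 0 < τ) {x d y : Point M U}
    (hx : P.StrictlyFeasible x) (hd : P.IsNewtonDirection τ x d)
    (hD : P.newtonForm τ x d d ≤ 1 / 16) (hy : P.StrictlyFeasible y) :
    P.merit τ x ≤ P.merit τ y + 1 / 4 := by
  have hh := hy.isHermitianPoint.sub hx.isHermitianPoint
  set h := y - x with hdef
  have hyx : y = x + (1 : ℝ) • h := by rw [hdef]; module
  obtain ⟨l, hl, -, hB, hg, hH⟩ := P.exists_line hx hh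
  have hN := hx.newtonForm_self hτ hd hh
  have hCS := hx.newtonForm_sq_le hτ.le hd.1 hh
  have hpos := (hl 1).1 (hyx ▸ hy)
  have hform := mul_nonneg hτ.le (P.objForm_self_nonneg h)
  have hr0 := hx.newtonForm_self_nonneg hτ.le hh
  -- `r` is the length of `y - x` in the seminorm of the Hessian at `x`. It bounds every `|l j|`,
  -- and a decrement of at most `1/4` limits the first-order term to `r / 4`.
  obtain ⟨r, hr, hrr⟩ : ∃ r, 0 ≤ r ∧ P.newtonForm τ x h h = r ^ 2 :=
    ⟨_, Real.sqrt_nonneg _, (Real.sq_sqrt hr0).symm⟩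
  have hNr : P.newtonForm τ x d h ≤ r / 4 := by
    refine le_of_sq_le_sq ?_ (by positivity)
    rw [hrr] at hCS
    nlinarith [sq_nonneg r]
  rw [hN, hg] at hNr
  rw [newtonForm, hH] at hrr
  have hsmall : ∀ j, |l j| ≤ r := fun j => by
    have := Finset.single_le_sum (f := fun j => l j ^ 2) (fun i _ => sq_nonneg _)
      (Finset.mem_univ j)
    refine abs_le_of_sq_le_sq ?_ hr
    beta_reduce at this
    linarith
  have hlog : (∑ j, l j ^ 2) / (2 * (1 + r)) ≤ ∑ j, l j - ∑ j, Real.log (1 + 1 * l j) := by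
    rw [Finset.sum_div, ← Finset.sum_sub_distrib]
    refine Finset.sum_le_sum fun j _ => ?_
    have h1 := le_sub_log_one_add (t := l j) (by simpa using hpos j)
    rw [one_mul]
    refine le_trans ?_ h1
    have := hsmall j
    gcongr
  rw [merit, merit, hyx, hB 1 hpos, P.objective_add_smul hx.isHermitianPoint hh]
  have h2 : τ * P.objForm h h / (2 * (1 + r)) ≤ τ * P.objForm h h / 2 := by
    gcongr; linarith
  -- Second-order gain against first-order loss; after clearing denominators the claim is `0 ≤ r ^ 2
  -- + 1`.
  have h3 : r ^ 2 / (2 * (1 + r)) - r / 4 ≥ - (1 / 4) := by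
    rw [ge_iff_le, neg_le_sub_iff_le_add, div_add' _ _ _ (by positivity),
      le_div_iff₀ (by positivity)]
    nlinarith [sq_nonneg r]
  rw [← hrr, add_div] at h3
  linarith

/-- The degree of the barrier, which governs both the initial gap and the admissible growth of `τ`:
`U + M + L` slacks and `M` eigenvalues for each of the `U + M` blocks. -/
theorem card_lineIdx_le (hM : U + L < M) : Fintype.card (LineIdx M U L) ≤ 4 * M ^ 2 := by
  simp only [Fintype.card_sum, Fintype.card_prod, Fintype.card_fin]
  nlinarith

/-- The merit function at `x` is minimal over the strictly feasible points up to `g`. -/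
def HasGap (P : ProblemData G K M U L) (τ : ℝ) (x : Point M U) (g : ℝ) : Prop :=
  ∀ y, P.StrictlyFeasible y → P.merit τ x ≤ P.merit τ y + g

theorem HasGap.mono {τ g g' : ℝ} {x : Point M U} (h : P.HasGap τ x g) (hg : g ≤ g') :
    P.HasGap τ x g' := fun y hy => (h y hy).trans (by linarith)

/-- Almost minimal points of the merit function have almost optimal objective. -/
theorem HasGap.objective_le (hM : U + L < M) {τ g : ℝ} (hτ : 0 ≤ τ) {x y : Point M U}
    (hg : P.HasGap τ x g) (hx : P.StrictlyFeasible x) (hy : P.Feasible y) :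
    τ * (P.objective x - P.objective y) ≤ 2 * (4 * M ^ 2 + g) := by
  have hh := hy.isHermitianPoint.sub hx.isHermitianPoint
  set h := y - x with hdef
  have hyx : y = x + (1 : ℝ) • h := by rw [hdef]; module
  obtain ⟨l, hl, hl', hB, -, -⟩ := P.exists_line hx hh
  have hpos := (hl' 1).1 (hyx ▸ hy)
  -- The comparison is made at the midpoint, since `y` may lie on the boundary. There every factor
  -- is at least `1/2`, so each logarithm is at least `-1`; convexity of the objective then costs
  -- the factor `2` in the conclusion.
  have hpos' : ∀ j, 1 / 2 ≤ 1 + (1 / 2 : ℝ) * l j := fun j => by linarith [hpos j]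
  have hSF := (hl (1 / 2)).2 fun j => by linarith [hpos' j]
  have hgap := hg _ hSF
  have hlog : -(4 * (M : ℝ) ^ 2) ≤ ∑ j, Real.log (1 + (1 / 2 : ℝ) * l j) := by
    have h1 : ∀ j, -1 ≤ Real.log (1 + (1 / 2 : ℝ) * l j) := fun j => by
      have := Real.log_le_log (by norm_num) (hpos' j)
      rw [one_div, Real.log_inv] at this
      linarith [Real.log_two_lt_d9]
    have h2 := Finset.sum_le_sum fun j (_ : j ∈ Finset.univ) => h1 j
    rw [Finset.sum_const, Finset.card_univ, nsmul_eq_mul] at h2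
    have h3 : (Fintype.card (LineIdx M U L) : ℝ) ≤ 4 * M ^ 2 := by
      exact_mod_cast card_lineIdx_le hM
    linarith
  rw [merit, merit, hB _ fun j => by linarith [hpos' j],
    P.objective_add_smul hx.isHermitianPoint hh] at hgap
  have hform := mul_nonneg hτ (P.objForm_self_nonneg h)
  rw [hyx, P.objective_add_smul hx.isHermitianPoint hh]
  nlinarith

/-- The effect of an increase of the barrier parameter. -/
theorem HasGap.increase (hM : U + L < M) {τ g κ : ℝ} (hτ : 0 ≤ τ) (hκ : 0 < κ) {x : Point M U}
    (h : P.HasGap τ x g) (hx : P.StrictlyFeasible x) :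
    P.HasGap ((1 + 1 / κ) * τ) x (g + 2 * (4 * M ^ 2 + g) / κ) := fun y hy => by
  have h1 := h y hy
  have h2 := div_le_div_of_nonneg_right (h.objective_le hM hτ hx hy.feasible) hκ.le
  rw [merit, merit] at *
  have e : (1 + 1 / κ) * τ * P.objective x - (1 + 1 / κ) * τ * P.objective y
      = τ * P.objective x - τ * P.objective y
        + τ * (P.objective x - P.objective y) / κ := by field_simp
  linarith

/-- Feasibility of the prolonged segment, at parameter `-2⁻ᵇ`, forces `l j ≤ 2 ^ b`. So each
logarithm gains at most `log (1 + 2 ^ b) ≤ b + 1` on the way to `y`, and the objective at `y` is at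
least zero. -/
theorem StrictlyFeasible.hasGap_of_hasDepth (hM : U + L < M) {x : Point M U}
    (hx : P.StrictlyFeasible x) {b : ℕ} (hdep : P.HasDepth x ((2 : ℝ)⁻¹ ^ b)) {τ : ℝ}
    (hτ : 0 ≤ τ) : P.HasGap τ x (τ * P.objective x + 4 * M ^ 2 * (b + 1)) := fun y hy => by
  have hh := hy.isHermitianPoint.sub hx.isHermitianPoint
  have hdep' := hdep y hy.feasible
  have e : x + (2 : ℝ)⁻¹ ^ b • (x - y) = x + (-(2 : ℝ)⁻¹ ^ b) • (y - x) := by module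
  rw [e] at hdep'
  set h := y - x with hdef
  have hyx : y = x + (1 : ℝ) • h := by rw [hdef]; module
  obtain ⟨l, hl, hl', hB, -, -⟩ := P.exists_line hx hh
  have hpos := (hl 1).1 (hyx ▸ hy)
  have hup := (hl' _).1 hdep'
  have hlog : ∑ j, Real.log (1 + 1 * l j) ≤ 4 * (M : ℝ) ^ 2 * (b + 1) := by
    have h1 : ∀ j, Real.log (1 + 1 * l j) ≤ b + 1 := fun j => by
      have h2 : (1 : ℝ) ≤ 2 ^ b := one_le_pow₀ (by norm_num)
      have h3 : l j ≤ 2 ^ b := by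
        have := hup j
        rw [inv_pow, neg_mul, ← div_eq_inv_mul] at this
        have h4 : l j / 2 ^ b ≤ 1 := by linarith
        rwa [div_le_one (by positivity)] at h4
      have h4 : 1 + 1 * l j ≤ 2 ^ (b + 1) := by rw [pow_succ]; linarith
      have h5 := Real.log_le_log (hpos j) h4
      rw [Real.log_pow] at h5
      push_cast at h5
      have : Real.log 2 ≤ 1 := by linarith [Real.log_two_lt_d9]
      nlinarith [(Nat.cast_nonneg b : (0 : ℝ) ≤ b)]
    have h2 := Finset.sum_le_sum fun j (_ : j ∈ Finset.univ) => h1 j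
    rw [Finset.sum_const, Finset.card_univ, nsmul_eq_mul] at h2
    have h3 : (Fintype.card (LineIdx M U L) : ℝ) ≤ 4 * M ^ 2 := by
      exact_mod_cast card_lineIdx_le hM
    nlinarith [(Nat.cast_nonneg b : (0 : ℝ) ≤ b)]
  have hobj := mul_nonneg hτ (P.objective_nonneg hy.isHermitianPoint)
  have hBy : P.barrier y = P.barrier x + ∑ j, Real.log (1 + 1 * l j) := by
    nth_rewrite 1 [hyx]
    exact hB 1 hpos
  rw [merit, merit, hBy]
  linarith

end ProblemData

/-! ### The Newton direction through a reduced linear system -/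

/-- The point with given matrix variables and scaling factor. -/
def ofBlocks {M U : ℕ} (Z : Fin U ⊕ Fin M → CMat M) (w : ℝ) : Point M U :=
  (fun i => Z (.inl i), fun t => Z (.inr t), w)

theorem blocks_ofBlocks {M U : ℕ} (Z : Fin U ⊕ Fin M → CMat M) (w : ℝ) :
    blocks (ofBlocks Z w) = Z := by
  ext (i | i) <;> rfl

/-- The complex matrix with given real and imaginary parts. -/
def pairMat {M U : ℕ} (p : CoordIdx M U → ℝ) : CMat M :=
  Matrix.of fun m n => (⟨p (.inl (m, n)), p (.inr (.inl (m, n)))⟩ : ℂ)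

namespace ProblemData

variable {G K M U L : ℕ} (P : ProblemData G K M U L)

/-- The adjoint of `coords` with respect to the trace pairing of Hermitian families. -/
def dual : (CoordIdx M U → ℝ) →ₗ[ℝ] (Fin U ⊕ Fin M → CMat M) where
  toFun p b := (1 / 2 : ℝ) • (pairMat p + (pairMat p).conjTranspose)
    + Sum.elim (fun i => p (.inr (.inr i)) • P.chanS i) (fun _ => 0) b
  map_add' p q := by
    have : pairMat (p + q) = pairMat p + pairMat q := by
      ext m n; simp [pairMat, Complex.ext_iff]
    ext (i | i) m n <;>
    simp only [this, Matrix.conjTranspose_add, Pi.add_apply, Sum.elim_inl, Sum.elim_inr, add_smul,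
      smul_add, Matrix.add_apply, Matrix.zero_apply] <;> ring
  map_smul' u p := by
    have : pairMat (u • p) = u • pairMat p := by
      ext m n; simp [pairMat, Complex.ext_iff]
    ext (i | i) m n <;>
    simp [this, Matrix.conjTranspose_smul] <;> ring

theorem dual_apply (p : CoordIdx M U → ℝ) (b : Fin U ⊕ Fin M) :
    P.dual p b = (1 / 2 : ℝ) • (pairMat p + (pairMat p).conjTranspose)
      + Sum.elim (fun i => p (.inr (.inr i)) • P.chanS i) (fun _ => 0) b := rfl

theorem dual_isHermitian (p : CoordIdx M U → ℝ) (b : Fin U ⊕ Fin M) :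
    (P.dual p b).IsHermitian := by
  rw [dual_apply]
  refine .add ?_ ?_
  · rw [Matrix.IsHermitian, Matrix.conjTranspose_smul, Matrix.conjTranspose_add,
      Matrix.conjTranspose_conjTranspose, add_comm, star_trivial]
  · rcases b with i | t
    · rw [Sum.elim_inl, Matrix.IsHermitian, Matrix.conjTranspose_smul, (P.chanS_psd i).1.eq,
        star_trivial]
    · simp

/-- Only the Hermitian part of `pairMat p` pairs with a Hermitian sum. Hence the symmetrization in
`dual` loses nothing, and it keeps the resulting directions Hermitian. -/
theorem sum_trace_dual_mul (p : CoordIdx M U → ℝ) {Z : Fin U ⊕ Fin M → CMat M}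
    (hZ : ∀ b, (Z b).IsHermitian) :
    ∑ b, (P.dual p b * Z b).trace.re = p ⬝ᵥ P.coords Z := by
  have hR : (∑ b, Z b).IsHermitian := isSelfAdjoint_sum _ fun b _ => hZ b
  have h1 : ∑ b, (P.dual p b * Z b).trace.re
      = (1 / 2) * (((pairMat p) * ∑ b, Z b).trace.re
          + ((pairMat p).conjTranspose * ∑ b, Z b).trace.re)
        + ∑ i, p (.inr (.inr i)) * (P.chanS i * Z (.inl i)).trace.re := by
    have h2 : ∀ b, (P.dual p b * Z b).trace.re = (1 / 2) * ((pairMat p * Z b).trace.re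
        + ((pairMat p).conjTranspose * Z b).trace.re)
        + Sum.elim (fun i => p (.inr (.inr i)) * (P.chanS i * Z (.inl i)).trace.re)
          (fun _ => 0) b := fun b => by
      rw [dual_apply]
      rcases b with i | t <;> simp [add_mul] <;> ring
    simp only [h2, Finset.sum_add_distrib, ← Finset.mul_sum]
    congr 1
    · rw [Matrix.mul_sum, Matrix.mul_sum, Matrix.trace_sum, Matrix.trace_sum, Complex.re_sum,
        Complex.re_sum]
    · rw [Fintype.sum_sum_type]
      simp
  have h3 : ((pairMat p) * ∑ b, Z b).trace.re
      = ((pairMat p).conjTranspose * ∑ b, Z b).trace.re := by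
    have := congrArg Complex.re (Matrix.trace_conjTranspose ((pairMat p) * ∑ b, Z b))
    rw [Matrix.conjTranspose_mul, hR.eq, Matrix.trace_mul_comm] at this
    rw [this]
    simp
  rw [h1, ← h3, coords_apply]
  have h4 : ∀ R : CMat M, ((pairMat p).conjTranspose * R).trace.re
      = ∑ q : Fin M × Fin M, p (.inl q) * (R q.1 q.2).re
        + ∑ q : Fin M × Fin M, p (.inr (.inl q)) * (R q.1 q.2).im := fun R => by
    rw [← Finset.sum_add_distrib, Fintype.sum_prod_type, Finset.sum_comm, Matrix.trace,
      Complex.re_sum]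
    refine Finset.sum_congr rfl fun i _ => ?_
    rw [Matrix.diag_apply, Matrix.mul_apply, Complex.re_sum]
    refine Finset.sum_congr rfl fun j _ => ?_
    simp [pairMat]
  rw [h3, h4]
  simp only [dotProduct, Fintype.sum_sum_type (α₁ := Fin M × Fin M), Sum.elim_inl, Sum.elim_inr]
  ring

/-- The map `p ↦ X (dual p) X` for the matrix variables `X` of `x`. -/
def conjDual (x : Point M U) : (CoordIdx M U → ℝ) →ₗ[ℝ] (Fin U ⊕ Fin M → CMat M) where
  toFun p b := blocks x b * P.dual p b * blocks x b
  map_add' p q := by ext1 b; simp [mul_add, add_mul]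
  map_smul' u p := by ext1 b; simp

theorem conjDual_apply (x : Point M U) (p : CoordIdx M U → ℝ) (b : Fin U ⊕ Fin M) :
    P.conjDual x p b = blocks x b * P.dual p b * blocks x b := rfl

theorem conjDual_isHermitian {x : Point M U} (hx : IsHermitianPoint x) (p : CoordIdx M U → ℝ)
    (b : Fin U ⊕ Fin M) : (P.conjDual x p b).IsHermitian := by
  rw [Matrix.IsHermitian, conjDual_apply, Matrix.conjTranspose_mul, Matrix.conjTranspose_mul,
    (P.dual_isHermitian p b).eq, (isHermitianPoint_iff.1 hx b).eq, mul_assoc]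

/-- The operator `coords ∘ D⁻¹ ∘ dual`, where `D` is the Hessian of the log-det barriers. -/
def schur (x : Point M U) : (CoordIdx M U → ℝ) →ₗ[ℝ] (CoordIdx M U → ℝ) :=
  P.coords ∘ₗ P.conjDual x

/-- With `X = B Bᴴ` and `C` a block of `dual p`, the trace of `C X C X` is the squared Frobenius
norm of `Bᴴ C B`. -/
theorem dotProduct_schur_nonneg {x : Point M U} (hx : P.StrictlyFeasible x)
    (p : CoordIdx M U → ℝ) : 0 ≤ p ⬝ᵥ P.schur x p := by
  have hH := isHermitianPoint_iff.1 hx.isHermitianPoint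
  rw [schur, LinearMap.comp_apply,
    ← P.sum_trace_dual_mul p (P.conjDual_isHermitian hx.isHermitianPoint p)]
  refine Finset.sum_nonneg fun b _ => ?_
  obtain ⟨B, -, -, hB, -⟩ := exists_simulDiag ((P.strictlyFeasible_iff.1 hx).2 b) (hH b)
  have hC := (P.dual_isHermitian p b).eq
  have : (P.dual p b * P.conjDual x p b).trace
      = ((B.conjTranspose * P.dual p b * B).conjTranspose
        * (B.conjTranspose * P.dual p b * B)).trace := by
    rw [conjDual_apply, hB]
    simp only [Matrix.conjTranspose_mul, Matrix.conjTranspose_conjTranspose, hC, mul_assoc]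
    rw [Matrix.trace_mul_comm B.conjTranspose]
    simp only [mul_assoc]
  rw [this]
  exact (Complex.le_def.1 (Matrix.posSemidef_conjTranspose_mul_self _).trace_nonneg).1

/-- The coefficient of `ω²` in the objective, replaced by `1` if it vanishes. -/
def omegaCoeff : ℝ :=
  if ∑ g, ∑ t, P.desired g t * P.desired g t ≤ 0 then 1
  else ∑ g, ∑ t, P.desired g t * P.desired g t

theorem omegaCoeff_pos : 0 < P.omegaCoeff := by
  rw [omegaCoeff]
  split_ifs with h
  · exact one_pos
  · exact not_le.1 h

/-- The coefficients of the mixed term of `ω` and `R` in the objective. -/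
def omegaRow : CoordIdx M U → ℝ := ∑ g, ∑ t, P.desired g t • P.beamRow g t

/-- The coefficients of the residual after minimization over `ω`. -/
def redRow (g : Fin G) (t : Fin K) : CoordIdx M U → ℝ :=
  P.beamRow g t - (P.desired g t / P.omegaCoeff) • P.omegaRow

/-- The normal equation of the least-squares fit in `ω`: reduced residuals are orthogonal to the
desired pattern, so `ω` decouples. If the pattern vanishes every term is zero, and the substitute
value `1` of `omegaCoeff` does no harm. -/
theorem sum_desired_mul_redRow (z : CoordIdx M U → ℝ) :
    ∑ g, ∑ t, P.desired g t * (P.redRow g t ⬝ᵥ z) = 0 := by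
  have h1 : P.omegaRow ⬝ᵥ z = ∑ g, ∑ t, P.desired g t * (P.beamRow g t ⬝ᵥ z) := by
    simp [omegaRow, sum_dotProduct, smul_dotProduct]
  have h2 : ∑ g, ∑ t, P.desired g t * (P.redRow g t ⬝ᵥ z)
      = P.omegaRow ⬝ᵥ z - (∑ g, ∑ t, P.desired g t * P.desired g t)
        * (P.omegaRow ⬝ᵥ z / P.omegaCoeff) := by
    rw [h1, Finset.sum_mul, ← Finset.sum_sub_distrib, ← h1]
    refine Finset.sum_congr rfl fun g _ => ?_
    rw [Finset.sum_mul, ← Finset.sum_sub_distrib]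
    refine Finset.sum_congr rfl fun t _ => ?_
    rw [redRow, sub_dotProduct, smul_dotProduct, smul_eq_mul]
    ring
  rw [h2]
  by_cases h : ∑ g, ∑ t, P.desired g t * P.desired g t ≤ 0
  · have h0 : ∀ g t, P.desired g t = 0 := fun g t => by
      have ha : P.desired g t * P.desired g t ≤ ∑ t, P.desired g t * P.desired g t :=
        Finset.single_le_sum (f := fun t => P.desired g t * P.desired g t)
          (fun t _ => mul_self_nonneg _) (Finset.mem_univ t)
      have hb : ∑ t, P.desired g t * P.desired g t
          ≤ ∑ g, ∑ t, P.desired g t * P.desired g t :=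
        Finset.single_le_sum (f := fun g => ∑ t, P.desired g t * P.desired g t)
          (fun g _ => Finset.sum_nonneg fun t _ => mul_self_nonneg _) (Finset.mem_univ g)
      exact mul_self_eq_zero.1 (le_antisymm (by linarith) (mul_self_nonneg _))
    rw [h1]
    simp [h0]
  · rw [omegaCoeff, if_neg h]
    rw [mul_div_cancel₀ _ (not_le.1 h).ne', sub_self]

/-- The Hessian of the merit function without the log-det terms, after minimization over `ω`. -/
def quad (τ : ℝ) (x : Point M U) : Matrix (CoordIdx M U) (CoordIdx M U) ℝ :=
  (2 * τ / G) • ∑ g, ∑ t, Matrix.vecMulVec (P.redRow g t) (P.redRow g t)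
    + ∑ k, (1 / (P.slack x k * P.slack x k)) • Matrix.vecMulVec (P.slackRow k) (P.slackRow k)

theorem dotProduct_quad_mulVec (τ : ℝ) (x : Point M U) (a z : CoordIdx M U → ℝ) :
    a ⬝ᵥ (P.quad τ x).mulVec z
      = 2 * τ / G * ∑ g, ∑ t, (P.redRow g t ⬝ᵥ z) * (P.redRow g t ⬝ᵥ a)
        + ∑ k, (P.slackRow k ⬝ᵥ z) * (P.slackRow k ⬝ᵥ a) / P.slack x k ^ 2 := by
  simp only [quad, Matrix.add_mulVec, Matrix.smul_mulVec, Matrix.sum_mulVec,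
    Matrix.vecMulVec_mulVec, dotProduct_add, dotProduct_smul, dotProduct_sum,
    smul_eq_mul, MulOpposite.smul_eq_mul_unop, MulOpposite.unop_op]
  congr 1
  · simp only [dotProduct_comm a, mul_comm]
  · exact Finset.sum_congr rfl fun k _ => by rw [dotProduct_comm a]; field_simp

theorem quad_posSemidef {τ : ℝ} (hτ : 0 ≤ τ) (x : Point M U) : (P.quad τ x).PosSemidef := by
  refine .of_dotProduct_mulVec_nonneg ?_ fun z => ?_
  · ext i j
    simp [quad, Matrix.vecMulVec_apply, Matrix.sum_apply, mul_comm]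
  · rw [star_trivial, dotProduct_quad_mulVec]
    have : 0 ≤ 2 * τ / G := by positivity
    refine add_nonneg (mul_nonneg this (Finset.sum_nonneg fun g _ => Finset.sum_nonneg
      fun t _ => mul_self_nonneg _)) (Finset.sum_nonneg fun k _ => ?_)
    exact div_nonneg (mul_self_nonneg _) (sq_nonneg _)

/-- The linear part of the reduced Newton system. -/
def offs (x : Point M U) : CoordIdx M U → ℝ :=
  -∑ k, (P.slackLin x k / (P.slack x k * P.slack x k) + 1 / P.slack x k) • P.slackRow k

/-- The matrix of the reduced Newton system. -/
def sysMat (τ : ℝ) (x : Point M U) : Matrix (CoordIdx M U) (CoordIdx M U) ℝ :=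
  Matrix.of fun i j => (if i = j then 1 else 0) + P.schur x (fun k => P.quad τ x k j) i

theorem sysMat_mulVec (τ : ℝ) (x : Point M U) (z : CoordIdx M U → ℝ) :
    (P.sysMat τ x).mulVec z = z + P.schur x ((P.quad τ x).mulVec z) := by
  have : P.sysMat τ x = 1 + LinearMap.toMatrix' (P.schur x) * P.quad τ x := by
    ext i j
    rw [sysMat, Matrix.of_apply, Matrix.add_apply, Matrix.one_apply]
    congr 1
    have := congrFun (LinearMap.toMatrix'_mulVec (P.schur x) fun k => P.quad τ x k j) i
    rw [← this]
    rfl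
  rw [this, Matrix.add_mulVec, Matrix.one_mulVec, ← Matrix.mulVec_mulVec,
    LinearMap.toMatrix'_mulVec]

/-- Write `A` for `schur` and `Q` for `quad`. If `z + A Q z = 0`, pairing with `Q z` makes a sum of
two nonnegative terms vanish, so `zᵀ Q z = 0`, then `Q z = 0` and `z = 0`. Neither `A` nor `Q` has
to be invertible. -/
theorem sysMat_injective {τ : ℝ} (hτ : 0 ≤ τ) {x : Point M U} (hx : P.StrictlyFeasible x) :
    Function.Injective (P.sysMat τ x).mulVec := by
  rw [← Matrix.coe_mulVecLin]
  refine (injective_iff_map_eq_zero _).2 fun z hz => ?_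
  rw [Matrix.mulVecLin_apply, sysMat_mulVec] at hz
  have hQ := (P.quad_posSemidef hτ x)
  have h1 := hQ.dotProduct_mulVec_nonneg z
  have h2 := P.dotProduct_schur_nonneg hx ((P.quad τ x).mulVec z)
  have h3 := congrArg (fun v => (P.quad τ x).mulVec z ⬝ᵥ v) hz
  rw [star_trivial] at h1
  simp only [dotProduct_add, dotProduct_zero] at h3
  rw [dotProduct_comm _ z] at h3
  have h4 : z ⬝ᵥ (P.quad τ x).mulVec z = 0 := by linarith
  have h5 := (hQ.dotProduct_mulVec_zero_iff z).1 (by rwa [star_trivial])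
  rwa [h5, map_zero, add_zero] at hz

variable {P} in
/-- A solution of the reduced system yields a Newton direction. -/
theorem StrictlyFeasible.isNewtonDirection {τ : ℝ} (hτ : 0 < τ) {x : Point M U}
    (hx : P.StrictlyFeasible x) {z p : CoordIdx M U → ℝ}
    (hz : (P.sysMat τ x).mulVec z = (2 : ℝ) • P.coords (blocks x) - P.schur x (P.offs x))
    (hp : p = P.offs x + (P.quad τ x).mulVec z) {d : Point M U}
    (hd : d = ofBlocks (fun b => blocks x b - P.conjDual x p b)
      (P.omegaRow ⬝ᵥ z / P.omegaCoeff - x.2.2)) :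
    P.IsNewtonDirection τ x d := by
  have hH := isHermitianPoint_iff.1 hx.isHermitianPoint
  have hdb : ∀ b, blocks d b = blocks x b - P.conjDual x p b := fun b => by
    rw [hd, blocks_ofBlocks]
  have hdH : IsHermitianPoint d := isHermitianPoint_iff.2 fun b => by
    rw [hdb]; exact (hH b).sub (P.conjDual_isHermitian hx.isHermitianPoint p b)
  -- The unknown `z` is the coordinate vector of the full step `x + d`. The vector `p` is the
  -- gradient there of the quadratic model without the log-det terms, and the block equation reads
  -- `X⁻¹ d X⁻¹ = X⁻¹ - dual p`.
  have hcd : P.coords (blocks d) = z - P.coords (blocks x) := by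
    have e : blocks d = blocks x - P.conjDual x p := funext hdb
    have e2 : P.coords (P.conjDual x p) = P.schur x p := rfl
    rw [e, map_sub, e2, hp, map_add]
    rw [sysMat_mulVec] at hz
    have : P.schur x ((P.quad τ x).mulVec z)
        = (2 : ℝ) • P.coords (blocks x) - P.schur x (P.offs x) - z := by rw [← hz]; abel
    rw [this]
    module
  rw [P.isNewtonDirection_iff hτ hx hdH]
  intro h hh
  have hX := (P.strictlyFeasible_iff.1 hx).2
  have hblock : ∑ b, ((blocks x b)⁻¹ * blocks d b * (blocks x b)⁻¹ * blocks h b).trace.re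
      = ∑ b, ((blocks x b)⁻¹ * blocks h b).trace.re - p ⬝ᵥ P.coords (blocks h) := by
    rw [← P.sum_trace_dual_mul p (isHermitianPoint_iff.1 hh), ← Finset.sum_sub_distrib]
    refine Finset.sum_congr rfl fun b _ => ?_
    have hu := (Matrix.isUnit_iff_isUnit_det _).1 (hX b).isUnit
    have e : (blocks x b)⁻¹ * blocks d b * (blocks x b)⁻¹ * blocks h b
        = (blocks x b)⁻¹ * blocks h b - P.dual p b * blocks h b := by
      rw [hdb, conjDual_apply, mul_sub, ← mul_assoc, ← mul_assoc, Matrix.nonsing_inv_mul _ hu,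
        one_mul, sub_mul, one_mul, mul_assoc (P.dual p b), Matrix.mul_nonsing_inv _ hu, mul_one,
        sub_mul]
    rw [e, Matrix.trace_sub, Complex.sub_re]
  have hoffs : P.offs x ⬝ᵥ P.coords (blocks h)
      = -∑ k, (P.slackLin x k / P.slack x k ^ 2 + 1 / P.slack x k) * P.slackLin h k := by
    simp [offs, neg_dotProduct, sum_dotProduct, smul_dotProduct, slackLin, sq]
  have hslack : ∀ k, P.slackLin d k = P.slackRow k ⬝ᵥ z - P.slackLin x k := fun k => by
    rw [slackLin, hcd, dotProduct_sub, slackLin]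
  have hobj : P.objForm d h = 2 / G * ∑ g, ∑ t, (P.redRow g t ⬝ᵥ z)
      * (P.redRow g t ⬝ᵥ P.coords (blocks h)) - P.objForm x h := by
    have hres : ∀ g t, P.resid d g t = -(P.redRow g t ⬝ᵥ z) - P.resid x g t := fun g t => by
      have : d.2.2 = P.omegaRow ⬝ᵥ z / P.omegaCoeff - x.2.2 := by rw [hd]; rfl
      rw [resid, resid, hcd, this, redRow, sub_dotProduct, smul_dotProduct, dotProduct_sub,
        smul_eq_mul]
      ring
    -- The residual of `h` splits into a reduced residual and a multiple of the desired pattern; the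
    -- latter drops out by orthogonality.
    have hresh : ∀ g t, P.resid h g t = -(P.redRow g t ⬝ᵥ P.coords (blocks h))
        + P.desired g t * (h.2.2 - P.omegaRow ⬝ᵥ P.coords (blocks h) / P.omegaCoeff) :=
      fun g t => by
      rw [resid, redRow, sub_dotProduct, smul_dotProduct, smul_eq_mul]
      ring
    have e : ∀ g t, P.resid d g t * P.resid h g t
        = (P.redRow g t ⬝ᵥ z) * (P.redRow g t ⬝ᵥ P.coords (blocks h))
          - (h.2.2 - P.omegaRow ⬝ᵥ P.coords (blocks h) / P.omegaCoeff)
            * (P.desired g t * (P.redRow g t ⬝ᵥ z))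
          - P.resid x g t * P.resid h g t := fun g t => by
      rw [hres, sub_mul, hresh g t]
      ring
    simp only [objForm, e, Finset.sum_sub_distrib, ← Finset.mul_sum, sum_desired_mul_redRow]
    ring
  have hquad := P.dotProduct_quad_mulVec τ x (P.coords (blocks h)) z
  rw [barHess, hblock, barGrad, hobj, hp, add_dotProduct, hoffs,
    dotProduct_comm ((P.quad τ x).mulVec z), hquad]
  have e : ∑ k, P.slackLin d k * P.slackLin h k / P.slack x k ^ 2
      = ∑ k, (P.slackRow k ⬝ᵥ z) * (P.slackRow k ⬝ᵥ P.coords (blocks h)) / P.slack x k ^ 2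
        + ∑ k, P.slackLin h k / P.slack x k
        - ∑ k, (P.slackLin x k / P.slack x k ^ 2 + 1 / P.slack x k) * P.slackLin h k := by
    rw [← Finset.sum_add_distrib, ← Finset.sum_sub_distrib]
    refine Finset.sum_congr rfl fun k _ => ?_
    rw [hslack, ← slackLin]
    ring
  rw [e]
  ring

variable {P} in
/-- A formula for the squared Newton decrement that avoids matrix inverses. -/
theorem StrictlyFeasible.newtonForm_eq {τ : ℝ} (hτ : 0 < τ) {x d : Point M U}
    (hx : P.StrictlyFeasible x) (hd : P.IsNewtonDirection τ x d) {p : CoordIdx M U → ℝ}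
    (hdb : ∀ b, blocks d b = blocks x b - P.conjDual x p b) :
    P.newtonForm τ x d d = ∑ k, P.slackLin d k / P.slack x k
      + ∑ b, ((M : ℝ) - (P.dual p b * blocks x b).trace.re) - τ * P.objForm x d := by
  rw [hx.newtonForm_self hτ hd hd.1, barGrad]
  have : ∀ b, ((blocks x b)⁻¹ * blocks d b).trace.re
      = (M : ℝ) - (P.dual p b * blocks x b).trace.re := fun b => by
    have hu := (Matrix.isUnit_iff_isUnit_det _).1 ((P.strictlyFeasible_iff.1 hx).2 b).isUnit
    rw [hdb, conjDual_apply, mul_sub, mul_assoc (blocks x b), ← mul_assoc,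
      Matrix.nonsing_inv_mul _ hu, one_mul, Matrix.trace_sub, Complex.sub_re]
    simp
  simp only [this]
  ring

end ProblemData

/-! ### Computing the Newton step -/

section Matrices

variable {X : Type*} {M : ℕ}

theorem Cost.congr {S : Set (X → ℝ)} {n : ℕ} {f g : X → ℝ} (hf : Cost S n f)
    (h : ∀ x, g x = f x) : Cost S n g := (funext h : g = f) ▸ hf

theorem Comp.forall_of_card_le {ι : Type*} [Fintype ι] {S : Set (X → ℝ)} {n c : ℕ}
    {Q : ι → Set (X → ℝ) → Prop} (hc : Fintype.card ι ≤ c) (hQ : ∀ i, Upward (Q i))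
    (h : ∀ i, Comp S n (Q i)) : Comp S (c * n) (fun T => ∀ i, Q i T) :=
  (Comp.forall_fintype hQ h).le (Nat.mul_le_mul_right _ hc)

theorem Cost.family_of_card_le {ι : Type*} [Fintype ι] {S : Set (X → ℝ)} {n c : ℕ}
    {f : ι → X → ℝ} (hc : Fintype.card ι ≤ c) (h : ∀ i, Cost S n (f i)) :
    Comp S (c * n) (fun T => ∀ i, f i ∈ T) :=
  (Cost.family h).le (Nat.mul_le_mul_right _ hc)

theorem Cost.sum_of_card_le {ι : Type*} [Fintype ι] {S : Set (X → ℝ)} {n c : ℕ} {f : ι → X → ℝ}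
    (hc : Fintype.card ι ≤ c) (h : ∀ i, Cost S n (f i)) :
    Cost S (c * (n + 1) + 1) (fun x => ∑ i, f i x) :=
  (Cost.sum h).le (by gcongr)

theorem Cost.dotProduct {ι : Type*} [Fintype ι] {S : Set (X → ℝ)} {n m c : ℕ}
    {f g : X → ι → ℝ} (hc : Fintype.card ι ≤ c) (hf : ∀ i, Cost S n fun x => f x i)
    (hg : ∀ i, Cost S m fun x => g x i) :
    Cost S (c * (n + m + 2) + 1) (fun x => f x ⬝ᵥ g x) :=
  Cost.sum_of_card_le hc fun i => (hf i).mul (hg i)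

theorem Cost.sum₂ {G K : ℕ} (hK : 0 < K) {S : Set (X → ℝ)} {n : ℕ} {f : Fin G → Fin K → X → ℝ}
    (h : ∀ g t, Cost S n (f g t)) :
    Cost S (G * K * (n + 3) + 1) (fun x => ∑ g, ∑ t, f g t x) := by
  refine (Cost.sum fun g => Cost.sum fun t => h g t).le ?_
  rw [Fintype.card_fin, Fintype.card_fin]
  nlinarith [Nat.zero_le G]

/-- All entries of the matrix-valued function `A` belong to `S`. -/
def MMem (A : X → CMat M) (S : Set (X → ℝ)) : Prop := ∀ m n, CMem (fun x => A x m n) S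

theorem upward_mmem (A : X → CMat M) : Upward (MMem A) :=
  fun _ _ h hA m n => upward_cmem _ h (hA m n)

theorem comp_mmem {A : X → CMat M} {S : Set (X → ℝ)} {c : ℕ}
    (h : ∀ m n, CCost S c fun x => A x m n) : Comp S (M ^ 2 * c) (MMem A) :=
  (Comp.forall_of_card_le (ι := Fin M × Fin M) (by simp [sq])
    (fun p => upward_cmem fun x => A x p.1 p.2) fun p => h p.1 p.2).weaken le_rfl
    fun _ _ h m n => h (m, n)

theorem comp_mul {A B : X → CMat M} {S : Set (X → ℝ)} (hA : MMem A S) (hB : MMem B S) :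
    Comp S (M ^ 2 * (8 * M + 2)) (MMem fun x => A x * B x) :=
  comp_mmem fun m n => by
    simp only [Matrix.mul_apply]
    exact (CCost.sum fun k => (CCost.of_mem (hA m k)).mul (.of_mem (hB k n))).le
      (by rw [Fintype.card_fin]; lia)

theorem cost_trace_mul {A B : X → CMat M} {S : Set (X → ℝ)} (hA : MMem A S) (hB : MMem B S) :
    Cost S (M * (8 * M + 4) + 2) (fun x => (A x * B x).trace.re) := by
  simp only [Matrix.trace, Matrix.diag_apply, Matrix.mul_apply]
  exact (CCost.sum fun m => CCost.sum fun k => (CCost.of_mem (hA m k)).mul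
    (.of_mem (hB k m))).re.le (by simp only [Fintype.card_fin]; lia)

end Matrices

/-! ### Operation counts for the operators and coefficient vectors. -/

section NewtonStep

variable {X : Type*} {G K M U L : ℕ}

/-- The problem data are available. -/
structure DataMem (P : X → ProblemData G K M U L) (S : Set (X → ℝ)) : Prop where
  steer : ∀ g t m, CMem (fun ξ => (P ξ).steer g t m) S
  desired : ∀ g t, (fun ξ => (P ξ).desired g t) ∈ S
  chanS : ∀ i, MMem (fun ξ => (P ξ).chanS i) S
  chanP : ∀ l, MMem (fun ξ => (P ξ).chanP l) S
  noise : ∀ i, (fun ξ => (P ξ).noise i) ∈ S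
  sinr : ∀ i, (fun ξ => (P ξ).sinr i) ∈ S
  power : (fun ξ => (P ξ).power) ∈ S
  thres : (fun ξ => (P ξ).thres) ∈ S

theorem DataMem.mono {P : X → ProblemData G K M U L} {S T : Set (X → ℝ)} (h : DataMem P S)
    (hST : S ⊆ T) : DataMem P T where
  steer g t m := upward_cmem _ hST (h.steer g t m)
  desired g t := hST (h.desired g t)
  chanS i := upward_mmem _ hST (h.chanS i)
  chanP i := upward_mmem _ hST (h.chanP i)
  noise i := hST (h.noise i)
  sinr i := hST (h.sinr i)
  power := hST h.power
  thres := hST h.thres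

/-- The matrix variables are available. -/
abbrev BlocksMem (Z : X → Fin U ⊕ Fin M → CMat M) (S : Set (X → ℝ)) : Prop :=
  ∀ b, MMem (fun ξ => Z ξ b) S

theorem upward_blocksMem (Z : X → Fin U ⊕ Fin M → CMat M) : Upward (BlocksMem Z) :=
  fun _ _ h hZ b => upward_mmem _ h (hZ b)

/-- The entries of a vector-valued function are available. -/
abbrev VecMem {ι : Type*} (z : X → ι → ℝ) (S : Set (X → ℝ)) : Prop := ∀ i, (fun ξ => z ξ i) ∈ S

theorem upward_vecMem {ι : Type*} (z : X → ι → ℝ) : Upward (VecMem z) :=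
  fun _ _ h hz i => h (hz i)

theorem card_coordIdx_le (hM : U + L < M) : Fintype.card (CoordIdx M U) ≤ 3 * M ^ 2 := by
  simp only [Fintype.card_sum, Fintype.card_prod, Fintype.card_fin]
  nlinarith

theorem card_slackIdx_le (hM : U + L < M) : Fintype.card (SlackIdx M U L) ≤ 2 * M := by
  simp only [Fintype.card_sum, Fintype.card_fin]
  lia

theorem card_blockIdx_le (hM : U + L < M) : Fintype.card (Fin U ⊕ Fin M) ≤ 2 * M := by
  simp only [Fintype.card_sum, Fintype.card_fin]
  lia

variable {P : X → ProblemData G K M U L} {S : Set (X → ℝ)}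

theorem comp_coords (hM : U + L < M) (hP : DataMem P S) {Z : X → Fin U ⊕ Fin M → CMat M}
    (hZ : BlocksMem Z S) :
    Comp S (42 * M ^ 4) (VecMem fun ξ => (P ξ).coords (Z ξ)) := by
  have hM1 : 1 ≤ M := by lia
  have hpow : M ≤ M ^ 2 := by nlinarith
  have hc : ∀ i, Cost S (14 * M ^ 2) (fun ξ => (P ξ).coords (Z ξ) i) := by
    rintro (p | p | i)
    · simp only [ProblemData.coords_apply, Sum.elim_inl, Matrix.sum_apply, Complex.re_sum]
      exact (Cost.sum_of_card_le (card_blockIdx_le hM)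
        fun b => Cost.of_mem (hZ b p.1 p.2).1).le (by nlinarith)
    · simp only [ProblemData.coords_apply, Sum.elim_inl, Sum.elim_inr, Matrix.sum_apply,
        Complex.im_sum]
      exact (Cost.sum_of_card_le (card_blockIdx_le hM)
        fun b => Cost.of_mem (hZ b p.1 p.2).2).le (by nlinarith)
    · simp only [ProblemData.coords_apply, Sum.elim_inr]
      exact (cost_trace_mul (hP.chanS i) (hZ (.inl i))).le (by nlinarith)
  exact (Cost.family_of_card_le (card_coordIdx_le hM) hc).le (by nlinarith)

theorem comp_dual (hP : DataMem P S) {p : X → CoordIdx M U → ℝ} (hp : VecMem p S)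
    (b : Fin U ⊕ Fin M) : Comp S (M ^ 2 * 12) (MMem fun ξ => (P ξ).dual (p ξ) b) := by
  refine comp_mmem fun m n => ?_
  have hhalf := Cost.const S (1 / 2)
  rcases b with i | t
  · have hr : Cost S 6 (fun ξ => ((P ξ).dual (p ξ) (.inl i) m n).re) := by
      have := (hhalf.mul ((Cost.of_mem (hp (.inl (m, n)))).add (.of_mem (hp (.inl (n, m)))))).add
        ((Cost.of_mem (hp (.inr (.inr i)))).mul (.of_mem (hP.chanS i m n).1))
      refine Comp.le (n := 5) ?_ (by lia)
      refine Cost.congr this fun ξ => ?_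
      simp [ProblemData.dual_apply, pairMat, mul_add]
    have hi : Cost S 6 (fun ξ => ((P ξ).dual (p ξ) (.inl i) m n).im) := by
      have := (hhalf.mul ((Cost.of_mem (hp (.inr (.inl (m, n))))).sub
        (.of_mem (hp (.inr (.inl (n, m))))))).add
        ((Cost.of_mem (hp (.inr (.inr i)))).mul (.of_mem (hP.chanS i m n).2))
      refine Comp.le (n := 5) ?_ (by lia)
      refine Cost.congr this fun ξ => ?_
      simp [ProblemData.dual_apply, pairMat, sub_eq_add_neg, mul_add]
    exact CCost.of_re_im hr hi
  · have hr : Cost S 6 (fun ξ => ((P ξ).dual (p ξ) (.inr t) m n).re) := by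
      have := hhalf.mul ((Cost.of_mem (hp (.inl (m, n)))).add (.of_mem (hp (.inl (n, m)))))
      refine Comp.le (n := 3) ?_ (by lia)
      refine Cost.congr this fun ξ => ?_
      simp [ProblemData.dual_apply, pairMat, mul_add]
    have hi : Cost S 6 (fun ξ => ((P ξ).dual (p ξ) (.inr t) m n).im) := by
      have := hhalf.mul ((Cost.of_mem (hp (.inr (.inl (m, n))))).sub
        (.of_mem (hp (.inr (.inl (n, m))))))
      refine Comp.le (n := 3) ?_ (by lia)
      refine Cost.congr this fun ξ => ?_
      simp [ProblemData.dual_apply, pairMat, sub_eq_add_neg, mul_add]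
    exact CCost.of_re_im hr hi

/-- The inverse of the log-det Hessian takes two matrix products per block; no block is ever
inverted. -/
theorem comp_conjDual (hM : U + L < M) (hP : DataMem P S) {x : X → Point M U}
    (hx : BlocksMem (fun ξ => blocks (x ξ)) S) {p : X → CoordIdx M U → ℝ} (hp : VecMem p S) :
    Comp S (64 * M ^ 4) (BlocksMem fun ξ => (P ξ).conjDual (x ξ) (p ξ)) := by
  have hM1 : 1 ≤ M := by lia
  have hb : ∀ b, Comp S (32 * M ^ 3) (MMem fun ξ => (P ξ).conjDual (x ξ) (p ξ) b) := fun b => by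
    refine (((comp_dual hP hp b).bind fun T hT h1 => (comp_mul (upward_mmem _ hT (hx b)) h1).bind
      fun T' hT' h2 => comp_mul h2 (upward_mmem _ (hT.trans hT') (hx b)))).le ?_
    have : M ^ 2 ≤ M ^ 3 := Nat.pow_le_pow_right hM1 (by lia)
    nlinarith
  exact (Comp.forall_of_card_le (card_blockIdx_le hM)
    (fun b => upward_mmem fun ξ => (P ξ).conjDual (x ξ) (p ξ) b) hb).le (by nlinarith)

theorem comp_schur (hM : U + L < M) (hP : DataMem P S) {x : X → Point M U}
    (hx : BlocksMem (fun ξ => blocks (x ξ)) S) {p : X → CoordIdx M U → ℝ} (hp : VecMem p S) :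
    Comp S (106 * M ^ 4) (VecMem fun ξ => (P ξ).schur (x ξ) (p ξ)) :=
  ((comp_conjDual hM hP hx hp).bind fun _ hT h => comp_coords hM (hP.mono hT) h).le (by lia)

/-- The coefficient vectors that depend on the problem data only are available. -/
structure RowsMem (P : X → ProblemData G K M U L) (S : Set (X → ℝ)) : Prop where
  beamRow : ∀ g t, VecMem (fun ξ => (P ξ).beamRow g t) S
  omegaCoeff : (fun ξ => (P ξ).omegaCoeff) ∈ S
  omegaRow : VecMem (fun ξ => (P ξ).omegaRow) S
  redRow : ∀ g t, VecMem (fun ξ => (P ξ).redRow g t) S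
  slackRow : ∀ k, VecMem (fun ξ => (P ξ).slackRow k) S

theorem RowsMem.mono {T : Set (X → ℝ)} (h : RowsMem P S) (hST : S ⊆ T) : RowsMem P T where
  beamRow g t := upward_vecMem _ hST (h.beamRow g t)
  omegaCoeff := hST h.omegaCoeff
  omegaRow := upward_vecMem _ hST h.omegaRow
  redRow g t := upward_vecMem _ hST (h.redRow g t)
  slackRow k := upward_vecMem _ hST (h.slackRow k)

theorem cost_matRow {A : X → CMat M} (hA : MMem A S) (i : CoordIdx M U) :
    Cost S 2 (fun ξ => matRow (A ξ) i) := by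
  rcases i with p | p | i
  · exact (Cost.of_mem (hA p.2 p.1).1).le (by lia)
  · exact (Cost.of_mem (hA p.2 p.1).2).neg
  · exact (Cost.const S 0).weaken (by lia) fun T _ h => by simpa [matRow] using h

theorem comp_beamRow (hM : U + L < M) (hP : DataMem P S) :
    Comp S (30 * (G * K * M ^ 2)) (fun T => ∀ g t, VecMem (fun ξ => (P ξ).beamRow g t) T) := by
  have h1 : ∀ (g : Fin G) (t : Fin K) (i : CoordIdx M U),
      Cost S 10 (fun ξ => (P ξ).beamRow g t i) := fun g t i => by
    have hA : ∀ m n, CCost S 8 (fun ξ => (P ξ).steer g t m * star ((P ξ).steer g t n)) :=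
      fun m n => (CCost.of_mem (hP.steer g t m)).mul (CCost.of_mem (hP.steer g t n)).star
    rcases i with p | p | i
    · exact (hA p.2 p.1).re.le (by lia)
    · exact (hA p.2 p.1).im.neg.le (by lia)
    · exact (Cost.const S 0).weaken (by lia) fun T _ h => by
        simpa [ProblemData.beamRow, matRow] using h
  refine ((Cost.family_of_card_le (ι := (Fin G × Fin K) × CoordIdx M U)
    (c := G * K * (3 * M ^ 2)) ?_ fun q => h1 q.1.1 q.1.2 q.2).weaken ?_
    fun T _ h g t i => h ((g, t), i))
  · rw [Fintype.card_prod, Fintype.card_prod, Fintype.card_fin, Fintype.card_fin]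
    exact Nat.mul_le_mul_left _ (card_coordIdx_le hM)
  · exact le_of_eq (by ring)

theorem comp_slackRow (hM : U + L < M) (hP : DataMem P S) :
    Comp S (60 * M ^ 3) (fun T => ∀ k, VecMem (fun ξ => (P ξ).slackRow k) T) := by
  have h1 : ∀ (k : SlackIdx M U L) (i : CoordIdx M U),
      Cost S 10 (fun ξ => (P ξ).slackRow k i) := fun k i => by
    rcases k with j | m | l
    · have hc : Cost S 1 (fun _ : X => (Pi.single (.inr (.inr j)) 1 : CoordIdx M U → ℝ) i) := by
        by_cases h : i = .inr (.inr j)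
        · subst h; simpa using Cost.const S 1
        · simpa [h] using Cost.const S 0
      have h1 : Cost S 1 (fun _ : X => (1 : ℝ)) := by simpa using Cost.const S 1
      have := ((h1.add (h1.div (.of_mem (hP.sinr j)) fun ξ => ((P ξ).sinr_pos j).ne')).mul
        hc).sub (cost_matRow (hP.chanS j) i)
      exact Comp.le this (by lia)
    · refine Comp.le (n := 1) ?_ (by lia)
      by_cases h : i = .inl (m, m)
      · subst h; simpa [ProblemData.slackRow] using Cost.const S (-1)
      · simpa [ProblemData.slackRow, h] using Cost.const S 0
    · exact (cost_matRow (hP.chanP l) i).neg.le (by lia)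
  refine ((Cost.family_of_card_le (ι := SlackIdx M U L × CoordIdx M U)
    (c := 2 * M * (3 * M ^ 2)) ?_ fun q => h1 q.1 q.2).weaken ?_
    fun T _ h k i => h (k, i))
  · rw [Fintype.card_prod]
    exact Nat.mul_le_mul (card_slackIdx_le hM) (card_coordIdx_le hM)
  · exact le_of_eq (by ring)

/-- These vectors do not depend on the iterate and are computed once, before the first Newton step.
-/
theorem comp_rows (hM : U + L < M) (hG : 0 < G) (hK : 0 < K) (hP : DataMem P S) :
    Comp S (200 * (G * K * M ^ 3)) (RowsMem P) := by
  have hM1 : 1 ≤ M := by lia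
  have hGK : 1 ≤ G * K := Nat.mul_pos hG hK
  have hσ : Cost S (G * K * (1 + 3) + 1)
      (fun ξ => ∑ g, ∑ t, (P ξ).desired g t * (P ξ).desired g t) :=
    Cost.sum₂ hK fun g t => (Cost.of_mem (hP.desired g t)).mul (.of_mem (hP.desired g t))
  have h0 : Cost S 1 (fun _ : X => (0 : ℝ)) := by simpa using Cost.const S 0
  have h1 : Cost S 1 (fun _ : X => (1 : ℝ)) := by simpa using Cost.const S 1
  refine ((comp_beamRow hM hP).bind fun T₁ hT₁ hbeam =>
    ((comp_slackRow hM (hP.mono hT₁)).bind fun T₂ hT₂ hslack =>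
    ((Cost.select hσ h0 h1 hσ).mono (upward_mem _) (hT₁.trans hT₂)).bind fun T₃ hT₃ hcoeff =>
    (Cost.family_of_card_le (card_coordIdx_le hM)
      (f := fun i ξ => (P ξ).omegaRow i) (n := G * K * (1 + 3) + 1) fun i => ?_).bind
      fun T₄ hT₄ hrow =>
    (Cost.family_of_card_le (ι := (Fin G × Fin K) × CoordIdx M U) (c := G * K * (3 * M ^ 2))
      (f := fun q ξ => (P ξ).redRow q.1.1 q.1.2 q.2) (n := 3) ?_ fun q => ?_).weaken le_rfl
      fun T₅ hT₅ hred => ⟨?_, ?_, ?_, ?_, ?_⟩)).le ?_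
  · have hT := (hT₁.trans hT₂).trans hT₃
    simp only [ProblemData.omegaRow, Finset.sum_apply, Pi.smul_apply, smul_eq_mul]
    exact Cost.sum₂ hK fun g t => (Cost.of_mem (hT (hP.desired g t))).mul
      (.of_mem (hT₃ (hT₂ (hbeam g t i))))
  · rw [Fintype.card_prod, Fintype.card_prod, Fintype.card_fin, Fintype.card_fin]
    exact Nat.mul_le_mul_left _ (card_coordIdx_le hM)
  · have hT := ((hT₁.trans hT₂).trans hT₃).trans hT₄
    simp only [ProblemData.redRow, Pi.sub_apply, Pi.smul_apply, smul_eq_mul]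
    exact (Cost.of_mem (hT₄ (hT₃ (hT₂ (hbeam _ _ _))))).sub
      (((Cost.of_mem (hT (hP.desired _ _))).div (.of_mem (hT₄ hcoeff))
        fun ξ => (P ξ).omegaCoeff_pos.ne').mul (.of_mem (hrow _)))
  · have e1 : M ^ 2 ≤ M ^ 3 := Nat.pow_le_pow_right hM1 (by lia)
    have e2 : 1 ≤ M ^ 2 := Nat.one_le_pow _ _ hM1
    have e3 : G * K * M ^ 2 ≤ G * K * M ^ 3 := Nat.mul_le_mul_left _ e1
    have e4 : G * K ≤ G * K * M ^ 2 := Nat.le_mul_of_pos_right _ e2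
    have e5 : M ^ 3 ≤ G * K * M ^ 3 := Nat.le_mul_of_pos_left _ hGK
    nlinarith
  · exact fun g t i => hT₅ (hT₄ (hT₃ (hT₂ (hbeam g t i))))
  · exact hT₅ (hT₄ hcoeff)
  · exact fun i => hT₅ (hrow i)
  · exact fun g t i => hred ((g, t), i)
  · exact fun k i => hT₅ (hT₄ (hT₃ (hslack k i)))

end NewtonStep

/-! ### Operation count of a Newton step. -/

section NewtonStep

variable {X : Type*} {G K M U L : ℕ}

/-- The coordinates of a point are available. -/
structure PointMem (x : X → Point M U) (S : Set (X → ℝ)) : Prop where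
  blocks : BlocksMem (fun ξ => blocks (x ξ)) S
  omega : (fun ξ => (x ξ).2.2) ∈ S

theorem PointMem.mono {x : X → Point M U} {S T : Set (X → ℝ)} (h : PointMem x S) (hST : S ⊆ T) :
    PointMem x T :=
  ⟨upward_blocksMem _ hST h.blocks, hST h.omega⟩

/-- The quantities from which the Newton system at `x` is built are available. -/
structure LocalMem (P : X → ProblemData G K M U L) (τ : X → ℝ) (x : X → Point M U)
    (S : Set (X → ℝ)) : Prop where
  data : DataMem P S
  rows : RowsMem P S
  point : PointMem x S
  param : τ ∈ S
  coords : VecMem (fun ξ => (P ξ).coords (blocks (x ξ))) S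
  slack : VecMem (fun ξ => (P ξ).slack (x ξ)) S
  slackLin : VecMem (fun ξ => (P ξ).slackLin (x ξ)) S

variable {P : X → ProblemData G K M U L} {S : Set (X → ℝ)} {τ : X → ℝ} {x : X → Point M U}

theorem LocalMem.mono {T : Set (X → ℝ)} (h : LocalMem P τ x S) (hST : S ⊆ T) :
    LocalMem P τ x T where
  data := h.data.mono hST
  rows := h.rows.mono hST
  point := h.point.mono hST
  param := hST h.param
  coords := upward_vecMem _ hST h.coords
  slack := upward_vecMem _ hST h.slack
  slackLin := upward_vecMem _ hST h.slackLin

theorem pow_le_mul_pow {A M : ℕ} (hA : 1 ≤ A) (hM : 1 ≤ M) {a b : ℕ} (hab : a ≤ b) :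
    M ^ a ≤ A * M ^ b :=
  (Nat.pow_le_pow_right hM hab).trans (Nat.le_mul_of_pos_left _ hA)

theorem mul_pow_le_mul_pow (A : ℕ) {M : ℕ} (hM : 1 ≤ M) {a b : ℕ} (hab : a ≤ b) :
    A * M ^ a ≤ A * M ^ b :=
  Nat.mul_le_mul_left _ (Nat.pow_le_pow_right hM hab)

theorem comp_slackLin (hM : U + L < M) {y : X → Point M U} (hrow : RowsMem P S)
    (hc : VecMem (fun ξ => (P ξ).coords (blocks (y ξ))) S) :
    Comp S (14 * M ^ 3) (VecMem fun ξ => (P ξ).slackLin (y ξ)) := by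
  refine (Cost.family_of_card_le (card_slackIdx_le hM) fun k =>
    Cost.dotProduct (card_coordIdx_le hM) (fun i => .of_mem (hrow.slackRow k i))
      fun i => .of_mem (hc i)).le ?_
  nlinarith [Nat.one_le_pow 2 M (by lia)]

theorem comp_local (hM : U + L < M) (hP : DataMem P S) (hrow : RowsMem P S) (hx : PointMem x S)
    (hτ : τ ∈ S) : Comp S (66 * M ^ 4) (LocalMem P τ x) := by
  have hM1 : 1 ≤ M := by lia
  refine ((comp_coords hM hP hx.blocks).bind fun T₁ hT₁ hc =>
    (comp_slackLin hM (hrow.mono hT₁) hc).bind fun T₂ hT₂ hlin =>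
    (Cost.family_of_card_le (card_slackIdx_le hM) (n := 2 + 0 + 1)
      (f := fun k ξ => (P ξ).slack (x ξ) k) fun k => ?_).weaken le_rfl fun T₃ hT₃ hs => ?_).le ?_
  · refine Cost.add ?_ (.of_mem (hlin k))
    have hP' := (hP.mono hT₁).mono hT₂
    rcases k with i | m | l
    · exact (Cost.of_mem (hP'.noise i)).neg
    · exact (Cost.of_mem hP'.power).div (Cost.natConst _ M) fun _ => by
        exact_mod_cast (show M ≠ 0 by lia)
    · exact (Cost.of_mem hP'.thres).le (by lia)
  · have hST := (hT₁.trans hT₂).trans hT₃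
    exact ⟨hP.mono hST, hrow.mono hST, hx.mono hST, hST hτ,
      fun i => hT₃ (hT₂ (hc i)), hs, fun i => hT₃ (hlin i)⟩
  · have e1 : M ≤ M ^ 4 := Nat.le_self_pow (by lia) M
    have e2 : M ^ 3 ≤ M ^ 4 := Nat.pow_le_pow_right hM1 (by lia)
    lia

/-- Here all `G K` samples meet all pairs of coordinates: at most `9 M ^ 4` entries of `30 G K M`
operations each. -/
theorem comp_quad (hM : U + L < M) (hG : 0 < G) (hK : 0 < K) (h : LocalMem P τ x S)
    (hx : ∀ ξ, (P ξ).StrictlyFeasible (x ξ)) :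
    Comp S (270 * (G * K * M ^ 5))
      (fun T => ∀ i j, (fun ξ => (P ξ).quad (τ ξ) (x ξ) i j) ∈ T) := by
  have hM1 : 1 ≤ M := by lia
  have hGK : 1 ≤ G * K := Nat.mul_pos hG hK
  have h1 : Cost S 1 (fun _ : X => (1 : ℝ)) := by simpa using Cost.natConst S 1
  have h2 : Cost S 1 (fun _ : X => (2 : ℝ)) := by simpa using Cost.natConst S 2
  have hs : ∀ k ξ, (P ξ).slack (x ξ) k ≠ 0 := fun k ξ =>
    (((P ξ).strictlyFeasible_iff.1 (hx ξ)).1 k).ne'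
  have hc : ∀ i j, Cost S (30 * (G * K * M)) (fun ξ => (P ξ).quad (τ ξ) (x ξ) i j) :=
    fun i j => by
    have := (((h2.mul (.of_mem h.param)).div (Cost.natConst S G) fun _ => by
      exact_mod_cast hG.ne').mul (Cost.sum₂ hK fun g t =>
        (Cost.of_mem (h.rows.redRow g t i)).mul (.of_mem (h.rows.redRow g t j)))).add
      (Cost.sum_of_card_le (card_slackIdx_le hM) fun k =>
        (h1.div ((Cost.of_mem (h.slack k)).mul (.of_mem (h.slack k)))
          fun ξ => mul_ne_zero (hs k ξ) (hs k ξ)).mul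
        ((Cost.of_mem (h.rows.slackRow k i)).mul (.of_mem (h.rows.slackRow k j))))
    refine (Cost.congr this fun ξ => ?_).le ?_
    · simp [ProblemData.quad, Matrix.vecMulVec_apply, Matrix.sum_apply, -Fintype.sum_sum_type]
    · have e1 : M ≤ G * K * M := Nat.le_mul_of_pos_left _ hGK
      have e2 : G * K ≤ G * K * M := Nat.le_mul_of_pos_right _ hM1
      lia
  refine (Cost.family_of_card_le (ι := CoordIdx M U × CoordIdx M U)
    (c := 3 * M ^ 2 * (3 * M ^ 2)) ?_ fun q => hc q.1 q.2).weaken (le_of_eq (by ring))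
    fun T _ h i j => h (i, j)
  rw [Fintype.card_prod]
  exact Nat.mul_le_mul (card_coordIdx_le hM) (card_coordIdx_le hM)

theorem comp_offs (hM : U + L < M) (h : LocalMem P τ x S)
    (hx : ∀ ξ, (P ξ).StrictlyFeasible (x ξ)) :
    Comp S (51 * M ^ 3) (VecMem fun ξ => (P ξ).offs (x ξ)) := by
  have h1 : Cost S 1 (fun _ : X => (1 : ℝ)) := by simpa using Cost.natConst S 1
  have hs : ∀ k ξ, (P ξ).slack (x ξ) k ≠ 0 := fun k ξ =>
    (((P ξ).strictlyFeasible_iff.1 (hx ξ)).1 k).ne'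
  have hc : ∀ i, Cost S (17 * M) (fun ξ => (P ξ).offs (x ξ) i) := fun i => by
    have := (Cost.sum_of_card_le (card_slackIdx_le hM) fun k =>
      (((Cost.of_mem (h.slackLin k)).div ((Cost.of_mem (h.slack k)).mul (.of_mem (h.slack k)))
        fun ξ => mul_ne_zero (hs k ξ) (hs k ξ)).add (h1.div (.of_mem (h.slack k)) (hs k))).mul
        (Cost.of_mem (h.rows.slackRow k i))).neg
    refine (Cost.congr this fun ξ => ?_).le (by lia)
    simp only [ProblemData.offs, Pi.neg_apply, Finset.sum_apply, Pi.smul_apply, smul_eq_mul]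
  exact (Cost.family_of_card_le (card_coordIdx_le hM) hc).le (le_of_eq (by ring))

/-- `schur` is applied as an operator to the at most `3 M ^ 2` columns of `quad`, at `106 M ^ 4`
operations each. -/
theorem comp_sysMat (hM : U + L < M) (h : LocalMem P τ x S)
    (hQ : ∀ i j, (fun ξ => (P ξ).quad (τ ξ) (x ξ) i j) ∈ S) :
    Comp S (336 * M ^ 6) (fun T => ∀ i j, (fun ξ => (P ξ).sysMat (τ ξ) (x ξ) i j) ∈ T) := by
  have hM1 : 1 ≤ M := by lia
  refine ((Comp.forall_of_card_le (card_coordIdx_le hM) (fun j => upward_vecMem fun ξ =>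
      (P ξ).schur (x ξ) fun k => (P ξ).quad (τ ξ) (x ξ) k j)
      fun j => comp_schur hM h.data h.point.blocks fun k => hQ k j).bind fun T hT hs =>
    (Cost.family_of_card_le (ι := CoordIdx M U × CoordIdx M U) (c := 3 * M ^ 2 * (3 * M ^ 2))
      (n := 1 + 0 + 1) (f := fun q ξ => (P ξ).sysMat (τ ξ) (x ξ) q.1 q.2) ?_ fun q => ?_).weaken
      le_rfl fun T' _ h i j => h (i, j)).le ?_
  · rw [Fintype.card_prod]
    exact Nat.mul_le_mul (card_coordIdx_le hM) (card_coordIdx_le hM)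
  · have h1 : Cost T 1 (fun _ : X => if q.1 = q.2 then (1 : ℝ) else 0) := by
      split_ifs
      · simpa using Cost.const T 1
      · simpa using Cost.const T 0
    exact h1.add (.of_mem (hs q.2 q.1))
  · have e : M ^ 4 ≤ M ^ 6 := Nat.pow_le_pow_right hM1 (by lia)
    ring_nf
    lia

/-- The reduced Newton system can be set up and solved. -/
theorem comp_system (hM : U + L < M) (hG : 0 < G) (hK : 0 < K) (h : LocalMem P τ x S)
    (hτ : ∀ ξ, 0 < τ ξ) (hx : ∀ ξ, (P ξ).StrictlyFeasible (x ξ)) :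
    Comp S (2000 * (G * K * M ^ 6)) (fun T => ∃ z p : X → CoordIdx M U → ℝ,
      VecMem z T ∧ VecMem p T ∧ ∀ ξ, ((P ξ).sysMat (τ ξ) (x ξ)).mulVec (z ξ)
        = (2 : ℝ) • (P ξ).coords (blocks (x ξ)) - (P ξ).schur (x ξ) ((P ξ).offs (x ξ)) ∧
        p ξ = (P ξ).offs (x ξ) + ((P ξ).quad (τ ξ) (x ξ)).mulVec (z ξ)) := by
  have hM1 : 1 ≤ M := by lia
  have hGK : 1 ≤ G * K := Nat.mul_pos hG hK
  set N := Fintype.card (CoordIdx M U)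
  refine ((comp_quad hM hG hK h hx).bind fun T₁ hT₁ hQ =>
    (comp_offs hM (h.mono hT₁) hx).bind fun T₂ hT₂ hoffs =>
    (comp_sysMat hM ((h.mono hT₁).mono hT₂) fun i j => hT₂ (hQ i j)).bind fun T₃ hT₃ hsys =>
    (comp_schur hM (((h.mono hT₁).mono hT₂).mono hT₃).data
      (((h.mono hT₁).mono hT₂).mono hT₃).point.blocks (upward_vecMem _ hT₃ hoffs)).bind
      fun T₄ hT₄ hschur =>
    (Cost.family_of_card_le (card_coordIdx_le hM) (n := 1 + 0 + 1 + 0 + 1)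
      (f := fun i ξ => ((2 : ℝ) • (P ξ).coords (blocks (x ξ))
        - (P ξ).schur (x ξ) ((P ξ).offs (x ξ))) i) fun i => ?_).bind fun T₅ hT₅ hrhs =>
    (comp_solve T₅ (fun ξ => (P ξ).sysMat (τ ξ) (x ξ)) (fun ξ =>
      (2 : ℝ) • (P ξ).coords (blocks (x ξ)) - (P ξ).schur (x ξ) ((P ξ).offs (x ξ)))
      (fun ξ => (P ξ).sysMat_injective (hτ ξ).le (hx ξ))
      (fun i j => hT₅ (hT₄ (hsys i j))) hrhs).bind fun T₆ hT₆ hz => ?_).le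
      (n := _ + (_ + (_ + (_ + (_ + (_ + 3 * M ^ 2 * (3 * M ^ 2 * 2 + 2))))))) ?_
  · have h2 : Cost T₄ 1 (fun _ : X => (2 : ℝ)) := by simpa using Cost.natConst T₄ 2
    exact (h2.mul (.of_mem (hT₄ (hT₃ (hT₂ (hT₁ (h.coords i))))))).sub (.of_mem (hschur i))
  · obtain ⟨z, hz, hzT⟩ := hz
    have hST := hT₃.trans (hT₄.trans (hT₅.trans hT₆))
    refine (Cost.family_of_card_le (card_coordIdx_le hM)
      (f := fun i ξ => ((P ξ).offs (x ξ) + ((P ξ).quad (τ ξ) (x ξ)).mulVec (z ξ)) i)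
      (n := 3 * M ^ 2 * 2 + 2) fun i => ?_).weaken le_rfl fun T hT hp =>
      ⟨z, _, fun i => hT (hzT i), hp, fun ξ => ⟨hz ξ, rfl⟩⟩
    exact ((Cost.of_mem (hST (hoffs i))).add (Cost.dotProduct (card_coordIdx_le hM)
      (fun j => .of_mem (hST (hT₂ (hQ i j)))) fun j => .of_mem (hzT j))).le (by lia)
  · have hN : N ^ 3 ≤ (3 * M ^ 2) ^ 3 := Nat.pow_le_pow_left (card_coordIdx_le hM) 3
    have hN' : (3 * M ^ 2) ^ 3 = 27 * M ^ 6 := by ring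
    have e1 := mul_pow_le_mul_pow (G * K) hM1 (show 5 ≤ 6 by lia)
    have e2 := pow_le_mul_pow hGK hM1 (show 3 ≤ 6 by lia)
    have e3 := pow_le_mul_pow hGK hM1 (show 6 ≤ 6 by lia)
    have e4 := pow_le_mul_pow hGK hM1 (show 4 ≤ 6 by lia)
    have e5 := pow_le_mul_pow hGK hM1 (show 2 ≤ 6 by lia)
    have e6 : 3 * M ^ 2 * (3 * M ^ 2 * 2 + 2) = 18 * M ^ 4 + 6 * M ^ 2 := by ring
    lia

theorem cost_resid (hM : U + L < M) (hP : DataMem P S) (hrow : RowsMem P S) {y : X → Point M U}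
    (hc : VecMem (fun ξ => (P ξ).coords (blocks (y ξ))) S) (hω : (fun ξ => (y ξ).2.2) ∈ S)
    (g : Fin G) (t : Fin K) : Cost S (9 * M ^ 2) (fun ξ => (P ξ).resid (y ξ) g t) :=
  (((Cost.of_mem (hP.desired g t)).mul (.of_mem hω)).sub (Cost.dotProduct (card_coordIdx_le hM)
    (fun i => .of_mem (hrow.beamRow g t i)) fun i => .of_mem (hc i))).le (by
      have := Nat.one_le_pow 2 M (by lia); lia)

theorem cost_objForm (hM : U + L < M) (hG : 0 < G) (hK : 0 < K) (hP : DataMem P S)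
    (hrow : RowsMem P S) {y y' : X → Point M U}
    (hc : VecMem (fun ξ => (P ξ).coords (blocks (y ξ))) S) (hω : (fun ξ => (y ξ).2.2) ∈ S)
    (hc' : VecMem (fun ξ => (P ξ).coords (blocks (y' ξ))) S) (hω' : (fun ξ => (y' ξ).2.2) ∈ S) :
    Cost S (30 * (G * K * M ^ 2)) (fun ξ => (P ξ).objForm (y ξ) (y' ξ)) := by
  have h2 : Cost S 1 (fun _ : X => (2 : ℝ)) := by simpa using Cost.natConst S 2
  refine ((h2.div (Cost.natConst S G) fun _ => by exact_mod_cast hG.ne').mul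
    (Cost.sum₂ hK fun g t => (cost_resid hM hP hrow hc hω g t).mul
      (cost_resid hM hP hrow hc' hω' g t))).le ?_
  have hGK : 1 ≤ G * K := Nat.mul_pos hG hK
  have e1 : 1 ≤ M ^ 2 := Nat.one_le_pow 2 M (by lia)
  have e2 : G * K ≤ G * K * M ^ 2 := Nat.le_mul_of_pos_right _ e1
  have e3 : G * K * (9 * M ^ 2 + 9 * M ^ 2 + 1 + 3) = 18 * (G * K * M ^ 2) + 4 * (G * K) := by ring
  lia

/-- A damped Newton step can be computed. -/
theorem comp_newtonStep (hM : U + L < M) (hG : 0 < G) (hK : 0 < K) (hP : DataMem P S)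
    (hrow : RowsMem P S) (hxS : PointMem x S) (hτS : τ ∈ S) (hτ : ∀ ξ, 0 < τ ξ)
    (hx : ∀ ξ, (P ξ).StrictlyFeasible (x ξ)) :
    Comp S (3000 * (G * K * M ^ 6)) (fun T => ∃ (d : X → Point M U) (D : X → ℝ),
      (∀ ξ, (P ξ).IsNewtonDirection (τ ξ) (x ξ) (d ξ) ∧
        D ξ = (P ξ).newtonForm (τ ξ) (x ξ) (d ξ) (d ξ)) ∧
      PointMem (fun ξ => x ξ + (1 / (2 * (1 + D ξ))) • d ξ) T) := by
  have hM1 : 1 ≤ M := by lia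
  have hGK : 1 ≤ G * K := Nat.mul_pos hG hK
  refine ((comp_local hM hP hrow hxS hτS).bind fun T₁ hT₁ hloc =>
    (comp_system hM hG hK hloc hτ hx).bind (m := 900 * (G * K * M ^ 6))
      fun T₂ hT₂ hzp => ?_).le ?_
  · obtain ⟨z, p, hz, hp, hsys⟩ := hzp
    have hloc₂ := hloc.mono hT₂
    set d : X → Point M U := fun ξ => ofBlocks
      (fun b => blocks (x ξ) b - (P ξ).conjDual (x ξ) (p ξ) b)
      ((P ξ).omegaRow ⬝ᵥ z ξ / (P ξ).omegaCoeff - (x ξ).2.2) with hd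
    have hdb : ∀ ξ b, blocks (d ξ) b = blocks (x ξ) b - (P ξ).conjDual (x ξ) (p ξ) b :=
      fun ξ b => by rw [hd, blocks_ofBlocks]
    have hnewton : ∀ ξ, (P ξ).IsNewtonDirection (τ ξ) (x ξ) (d ξ) := fun ξ =>
      (hx ξ).isNewtonDirection (hτ ξ) (hsys ξ).1 (hsys ξ).2 rfl
    set D : X → ℝ := fun ξ => (P ξ).newtonForm (τ ξ) (x ξ) (d ξ) (d ξ) with hD
    have hDpos : ∀ ξ, 0 ≤ D ξ := fun ξ =>
      (hx ξ).newtonForm_self_nonneg (hτ ξ).le (hnewton ξ).1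
    have hs : ∀ k ξ, (P ξ).slack (x ξ) k ≠ 0 := fun k ξ =>
      (((P ξ).strictlyFeasible_iff.1 (hx ξ)).1 k).ne'
    have h1 : ∀ S : Set (X → ℝ), Cost S 1 (fun _ : X => (1 : ℝ)) := fun S => by
      simpa using Cost.natConst S 1
    have h2 : ∀ S : Set (X → ℝ), Cost S 1 (fun _ : X => (2 : ℝ)) := fun S => by
      simpa using Cost.natConst S 2
    refine ((comp_conjDual hM hloc₂.data hloc₂.point.blocks hp).bind fun T₃ hT₃ hconj =>
      (Comp.forall_of_card_le (card_blockIdx_le hM)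
        (fun b => upward_mmem fun ξ => blocks (d ξ) b) (n := M ^ 2 * 2) fun b => ?_).bind
        fun T₄ hT₄ hdT =>
      (show Cost T₄ (3 * M ^ 2 * 2 + 3) (fun ξ => (d ξ).2.2) from ?_).bind fun T₅ hT₅ hdω =>
      (comp_coords hM (hloc₂.data.mono (hT₃.trans (hT₄.trans hT₅)))
        (upward_blocksMem _ hT₅ hdT)).bind fun T₆ hT₆ hdc =>
      (comp_slackLin hM (hloc₂.rows.mono (hT₃.trans (hT₄.trans (hT₅.trans hT₆)))) hdc).bind
        fun T₇ hT₇ hdl =>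
      (Comp.forall_of_card_le (card_blockIdx_le hM)
        (fun b => upward_mmem fun ξ => (P ξ).dual (p ξ) b)
        fun b => comp_dual (hloc₂.data.mono (hT₃.trans (hT₄.trans (hT₅.trans (hT₆.trans hT₇)))))
          (upward_vecMem _ (hT₃.trans (hT₄.trans (hT₅.trans (hT₆.trans hT₇)))) hp) b).bind
        fun T₈ hT₈ hdual =>
      (show Cost T₈ (75 * (G * K * M ^ 3)) D from ?_).bind fun T₉ hT₉ hDT =>
      (show Cost T₉ 6 (fun ξ => 1 / (2 * (1 + D ξ))) from
        (h1 _).div ((h2 _).mul ((h1 _).add (.of_mem hDT))) fun ξ => by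
          have := hDpos ξ; positivity).bind fun T₁₀ hT₁₀ hsT =>
      (Comp.forall_of_card_le (card_blockIdx_le hM)
        (fun b => upward_mmem fun ξ => blocks (x ξ + (1 / (2 * (1 + D ξ))) • d ξ) b)
        (n := M ^ 2 * 4) fun b => ?_).bind fun T₁₁ hT₁₁ hnew =>
      (show Cost T₁₁ 2 (fun ξ => (x ξ + (1 / (2 * (1 + D ξ))) • d ξ).2.2) from ?_).weaken le_rfl
        fun T₁₂ hT₁₂ hω => ⟨d, D, fun ξ => ⟨hnewton ξ, rfl⟩,
          ⟨upward_blocksMem _ hT₁₂ hnew, hω⟩⟩).le ?_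
    · refine comp_mmem fun m n => ?_
      simp only [hdb, Matrix.sub_apply]
      exact (CCost.of_mem (upward_cmem _ hT₃ (hloc₂.point.blocks b m n))).sub
        (.of_mem (hconj b m n))
    · have hST := hT₃.trans hT₄
      exact (((Cost.dotProduct (card_coordIdx_le hM)
        (fun i => .of_mem (hST (hloc₂.rows.omegaRow i))) fun i => .of_mem (hST (hz i))).div
        (.of_mem (hST hloc₂.rows.omegaCoeff)) fun ξ => (P ξ).omegaCoeff_pos.ne').sub
        (.of_mem (hST hloc₂.point.omega))).le (by lia)
    · have h3 := hT₇.trans hT₈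
      have h4 := hT₃.trans (hT₄.trans (hT₅.trans (hT₆.trans h3)))
      have hloc₈ := hloc₂.mono h4
      have hform := cost_objForm hM hG hK hloc₈.data hloc₈.rows hloc₈.coords hloc₈.point.omega
        (upward_vecMem _ h3 hdc) (hT₆.trans h3 hdω)
      have := ((Cost.sum_of_card_le (card_slackIdx_le hM) fun k =>
        (Cost.of_mem (hT₈ (hdl k))).div (.of_mem (hloc₈.slack k)) (hs k)).add
        (Cost.sum_of_card_le (card_blockIdx_le hM) fun b =>
          (Cost.natConst T₈ M).sub (cost_trace_mul (hdual b) (hloc₈.point.blocks b)))).sub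
        ((Cost.of_mem hloc₈.param).mul hform)
      refine (Cost.congr this fun ξ => ?_).le ?_
      · exact (hx ξ).newtonForm_eq (hτ ξ) (hnewton ξ) (hdb ξ)
      · have e1 := mul_pow_le_mul_pow (G * K) hM1 (show 2 ≤ 3 by lia)
        have e2 := pow_le_mul_pow hGK hM1 (show 3 ≤ 3 by lia)
        have e3 := pow_le_mul_pow hGK hM1 (show 2 ≤ 3 by lia)
        have e4 := pow_le_mul_pow hGK hM1 (show 1 ≤ 3 by lia)
        have e5 := pow_le_mul_pow hGK hM1 (show 0 ≤ 3 by lia)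
        have e6 : 2 * M * (1 + (M * (8 * M + 4) + 2) + 1 + 1) + 1
          = 16 * M ^ 3 + 8 * M ^ 2 + 10 * M ^ 1 + 1 := by ring
        lia
    · refine comp_mmem fun m n => ?_
      have hxm := upward_cmem _ (hT₃.trans (hT₄.trans (hT₅.trans (hT₆.trans (hT₇.trans
        (hT₈.trans (hT₉.trans hT₁₀))))))) (hloc₂.point.blocks b m n)
      have hdm := upward_cmem _ (hT₅.trans (hT₆.trans (hT₇.trans (hT₈.trans (hT₉.trans hT₁₀)))))
        (hdT b m n)
      simp only [blocks_add_smul, Pi.add_apply, Pi.smul_apply, Matrix.add_apply, Matrix.smul_apply]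
      refine CCost.of_re_im (n := 2) (m := 2) ?_ ?_
      · simp only [Complex.add_re, Complex.smul_re, smul_eq_mul]
        exact (Cost.of_mem hxm.1).add ((Cost.of_mem hsT).mul (.of_mem hdm.1))
      · simp only [Complex.add_im, Complex.smul_im, smul_eq_mul]
        exact (Cost.of_mem hxm.2).add ((Cost.of_mem hsT).mul (.of_mem hdm.2))
    · exact (Cost.of_mem ((hT₃.trans (hT₄.trans (hT₅.trans (hT₆.trans (hT₇.trans
        (hT₈.trans (hT₉.trans (hT₁₀.trans hT₁₁)))))))) hloc₂.point.omega)).add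
        ((Cost.of_mem (hT₁₁ hsT)).mul (.of_mem ((hT₆.trans (hT₇.trans (hT₈.trans
          (hT₉.trans (hT₁₀.trans hT₁₁))))) hdω)))
    · have e1 := mul_pow_le_mul_pow (G * K) hM1 (show 3 ≤ 6 by lia)
      have e2 := pow_le_mul_pow hGK hM1 (show 4 ≤ 6 by lia)
      have e3 := pow_le_mul_pow hGK hM1 (show 3 ≤ 6 by lia)
      have e4 := pow_le_mul_pow hGK hM1 (show 2 ≤ 6 by lia)
      have e5 := pow_le_mul_pow hGK hM1 (show 0 ≤ 6 by lia)
      ring_nf at *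
      lia
  · have e2 := pow_le_mul_pow hGK hM1 (show 4 ≤ 6 by lia)
    lia

end NewtonStep

/-! ### The schedule of the barrier method -/

/-- The factor by which the barrier parameter grows is `1 + 1 / growthDen M`. -/
def growthDen (M : ℕ) : ℕ := 816 * M ^ 2

/-- The number of Newton steps with the initial barrier parameter. -/
def centeringSteps (M b : ℕ) : ℕ := 68 * (1 + 4 * M ^ 2 * (b + 1))

/-- The number of Newton steps with growing barrier parameter. -/
def followingSteps (M b : ℕ) : ℕ := growthDen M * (b + 4 * (M.sqrt + 1) + 4)

/-- The total number of Newton steps. -/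
def totalSteps (M b : ℕ) : ℕ := centeringSteps M b + followingSteps M b

/-- The barrier parameter, in units of the reciprocal tolerance. -/
def paramUnit (M b k : ℕ) : ℚ := (1 + 1 / (growthDen M : ℚ)) ^ (k - centeringSteps M b) / 2 ^ b

theorem paramUnit_pos (M b k : ℕ) : 0 < paramUnit M b k := by
  unfold paramUnit; positivity

theorem paramUnit_mono (M b : ℕ) : Monotone (paramUnit M b) := fun i j hij => by
  unfold paramUnit
  have : (1 : ℚ) ≤ 1 + 1 / (growthDen M : ℚ) := le_add_of_nonneg_right (by positivity)
  gcongr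

/-- Truncated subtraction keeps the parameter constant during the centering phase. -/
theorem paramUnit_of_le {M b k : ℕ} (hk : k ≤ centeringSteps M b) :
    paramUnit M b k = 1 / 2 ^ b := by
  rw [paramUnit, Nat.sub_eq_zero_of_le hk, pow_zero]

theorem paramUnit_succ {M b k : ℕ} (hk : centeringSteps M b ≤ k) :
    paramUnit M b (k + 1) = (1 + 1 / (growthDen M : ℚ)) * paramUnit M b k := by
  rw [paramUnit, paramUnit, Nat.sub_add_comm hk, pow_succ]
  ring

/-- By Bernoulli, `growthDen M` increases at least double the parameter. Of the doublings, `b` undo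
the initial `2⁻ᵇ`, four give `16`, and `4 r` give `M ^ 2` by the crude bound `M ≤ r ^ 2 ≤ 4 ^ r`,
which replaces `log M` by `√M`. -/
theorem le_paramUnit_totalSteps {M : ℕ} (hM : 0 < M) (b : ℕ) :
    16 * (M : ℚ) ^ 2 ≤ paramUnit M b (totalSteps M b) := by
  set r := M.sqrt + 1 with hr
  have hκ : growthDen M ≠ 0 := by unfold growthDen; positivity
  have h1 : (2 : ℚ) ≤ (1 + 1 / (growthDen M : ℚ)) ^ growthDen M := by
    have := one_add_mul_le_pow (a := 1 / (growthDen M : ℚ))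
      (le_trans (by norm_num) (by positivity : (0 : ℚ) ≤ _)) (growthDen M)
    rw [mul_one_div_cancel (by exact_mod_cast hκ)] at this
    linarith
  have h2 : M ^ 2 ≤ 2 ^ (4 * r) := by
    have h3 : M < r * r := Nat.lt_succ_sqrt M
    have h4 : r ≤ 2 ^ r := Nat.lt_two_pow_self.le
    calc M ^ 2 ≤ (2 ^ r * 2 ^ r) ^ 2 := by gcongr; exact h3.le.trans (Nat.mul_le_mul h4 h4)
      _ = 2 ^ (4 * r) := by ring
  have h2' : (M : ℚ) ^ 2 ≤ 2 ^ (4 * r) := by exact_mod_cast h2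
  rw [paramUnit, totalSteps, Nat.add_sub_cancel_left, followingSteps, pow_mul,
    le_div_iff₀ (by positivity)]
  calc 16 * (M : ℚ) ^ 2 * 2 ^ b ≤ 16 * 2 ^ (4 * r) * 2 ^ b := by gcongr
    _ = 2 ^ (b + 4 * r + 4) := by ring
    _ ≤ _ := by gcongr

/-! ### The gap along the schedule. -/

namespace ProblemData

variable {G K M U L : ℕ} {P : ProblemData G K M U L}

/-- If `D ≤ 1/16`, the gap is already at most `1/4` and the step does not raise the merit. Otherwise
the decrease is at least `(1/16) / (4 * 17/16) = 1/68`. -/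
theorem HasGap.newton_step {τ g : ℝ} (hτ : 0 < τ) {x d : Point M U} (h : P.HasGap τ x g)
    (hx : P.StrictlyFeasible x) (hd : P.IsNewtonDirection τ x d) {D : ℝ}
    (hD : D = P.newtonForm τ x d d) :
    P.HasGap τ (x + (1 / (2 * (1 + D))) • d) (max (1 / 4) (g - 1 / 68)) := fun y hy => by
  have h1 := (hx.newton_step hτ hd hD rfl).2
  have hD0 : 0 ≤ D := hD ▸ hx.newtonForm_self_nonneg hτ.le hd.1
  rcases le_or_gt D (1 / 16) with h2 | h2
  · have h3 := hx.merit_le hτ hd (hD ▸ h2) hy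
    have h4 : 0 ≤ D / (4 * (1 + D)) := by positivity
    linarith [le_max_left (1 / 4) (g - 1 / 68)]
  · have h3 : 1 / 68 ≤ D / (4 * (1 + D)) := by
      rw [div_le_div_iff₀ (by norm_num) (by positivity)]; linarith
    linarith [h y hy, le_max_right (1 / 4) (g - 1 / 68)]

/-- The schedule reaches the desired accuracy. -/
theorem objective_le_of_schedule (hM : U + L < M) {b : ℕ} {ε : ℝ} (hε : 0 < ε)
    {x d : ℕ → Point M U} {D : ℕ → ℝ} (hx : ∀ k ≤ totalSteps M b, P.StrictlyFeasible (x k))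
    (hdep : P.HasDepth (x 0) ((2 : ℝ)⁻¹ ^ b)) (hobj : P.objective (x 0) ≤ 2 ^ b * ε)
    (hstep : ∀ k < totalSteps M b, P.IsNewtonDirection (paramUnit M b k / ε) (x k) (d k) ∧
      D k = P.newtonForm (paramUnit M b k / ε) (x k) (d k) (d k) ∧
      x (k + 1) = x k + (1 / (2 * (1 + D k))) • d k)
    {y : Point M U} (hy : P.Feasible y) :
    P.objective (x (totalSteps M b)) ≤ P.objective y + ε := by
  have hM1 : (1 : ℝ) ≤ M := by exact_mod_cast (show 1 ≤ M by lia)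
  have hτ : ∀ k, 0 < (paramUnit M b k : ℝ) / ε := fun k =>
    div_pos (by exact_mod_cast paramUnit_pos M b k) hε
  set g₀ : ℝ := 1 + 4 * M ^ 2 * (b + 1) with hg₀
  have hcenter : ∀ k ≤ centeringSteps M b,
      P.HasGap (paramUnit M b k / ε) (x k) (max (1 / 2) (g₀ - k / 68)) := by
    intro k hk
    induction k with
    | zero =>
      refine ((hx 0 (Nat.zero_le _)).hasGap_of_hasDepth hM hdep (hτ 0).le).mono ?_
      refine le_trans ?_ (le_max_right _ _)
      -- The initial parameter `1 / (2 ^ b ε)` is chosen to make this product at most `1`.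
      have : (paramUnit M b 0 : ℝ) / ε * P.objective (x 0) ≤ 1 := by
        rw [paramUnit_of_le hk]
        push_cast
        rw [div_div, div_mul_eq_mul_div, one_mul, div_le_one (by positivity)]
        exact hobj
      rw [hg₀]
      push_cast
      linarith
    | succ k ih =>
      have hk' : k < totalSteps M b := by unfold totalSteps; lia
      have h1 := (ih (by lia)).newton_step (hτ k) (hx k hk'.le) (hstep k hk').1 (hstep k hk').2.1
      rw [← (hstep k hk').2.2, paramUnit_of_le (by lia)] at h1
      rw [paramUnit_of_le hk]
      refine h1.mono (max_le ?_ ?_)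
      · exact le_trans (by norm_num) (le_max_left _ _)
      · rw [sub_le_iff_le_add]
        refine max_le ?_ ?_
        · linarith [le_max_left (1 / 2) (g₀ - (k + 1 : ℕ) / 68)]
        · have := le_max_right (1 / 2) (g₀ - (k + 1 : ℕ) / 68)
          push_cast at this ⊢
          linarith
  have hfollow : ∀ k, centeringSteps M b ≤ k → k ≤ totalSteps M b →
      P.HasGap (paramUnit M b k / ε) (x k) (1 / 2) := by
    intro k hk
    induction k, hk using Nat.le_induction with
    | base =>
      intro _
      -- `centeringSteps` equals `68 * g₀`, so gains of `1/68` use up the whole initial gap.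
      refine (hcenter _ le_rfl).mono (max_le le_rfl ?_)
      rw [hg₀, centeringSteps]
      push_cast
      linarith
    | succ k hk ih =>
      intro hk'
      have hlt : k < totalSteps M b := by lia
      have h1 := (ih hlt.le).newton_step (hτ k) (hx k hlt.le) (hstep k hlt).1 (hstep k hlt).2.1
      rw [← (hstep k hlt).2.2] at h1
      have hκ : (0 : ℝ) < growthDen M := by
        unfold growthDen; push_cast; positivity
      -- The Newton step leaves a gap of at most `1/2 - 1/68`; the growth of the parameter may then
      -- spend `1/68`.
      have h2 := (h1.mono (g' := 1 / 2 - 1 / 68) (max_le (by norm_num) le_rfl)).increase hM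
        (hτ k).le hκ (hx (k + 1) hk')
      rw [paramUnit_succ hk]
      push_cast
      rw [mul_div_assoc]
      refine h2.mono ?_
      -- The constant is `816 = 12 * 68`, and `2 (4 M² + 1/2 - 1/68) ≤ 12 M²` for `M ≥ 1`.
      have : 2 * (4 * (M : ℝ) ^ 2 + (1 / 2 - 1 / 68)) / growthDen M ≤ 1 / 68 := by
        rw [div_le_div_iff₀ hκ (by norm_num), growthDen]
        push_cast
        nlinarith
      linarith
  have hfin := (hfollow _ (by unfold totalSteps; lia) le_rfl).objective_le hM (hτ _).le
    (hx _ le_rfl) hy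
  have hbig : 16 * (M : ℝ) ^ 2 / ε ≤ paramUnit M b (totalSteps M b) / ε := by
    gcongr
    exact_mod_cast le_paramUnit_totalSteps (show 0 < M by lia) b
  -- A gap of `1/2` limits `τ` times the error to `8 M² + 1`, which is below `16 M²`.
  by_contra! hlt
  have h3 : 16 * (M : ℝ) ^ 2 / ε * ε
      < paramUnit M b (totalSteps M b) / ε
        * (P.objective (x (totalSteps M b)) - P.objective y) :=
    mul_lt_mul' hbig (by linarith) hε.le (hτ _)
  rw [div_mul_cancel₀ _ hε.ne'] at h3
  nlinarith

end ProblemData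

/-! ### The program -/

section Program

variable {X : Type*} {G K M U L : ℕ}

/-- All iterates of the barrier method can be computed. -/
theorem comp_iterates (hM : U + L < M) (hG : 0 < G) (hK : 0 < K) {P : X → ProblemData G K M U L}
    {S : Set (X → ℝ)} (hP : DataMem P S) (hrow : RowsMem P S) {x₀ : X → Point M U}
    (hx₀ : PointMem x₀ S) {ε : X → ℝ} (hεS : ε ∈ S) (hε : ∀ ξ, 0 < ε ξ)
    (hSF : ∀ ξ, (P ξ).StrictlyFeasible (x₀ ξ)) (b N : ℕ) :
    Comp S (N * (3002 * (G * K * M ^ 6))) (fun T => ∃ (x d : ℕ → X → Point M U) (D : ℕ → X → ℝ),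
      x 0 = x₀ ∧ (∀ k ≤ N, PointMem (x k) T) ∧ (∀ k ≤ N, ∀ ξ, (P ξ).StrictlyFeasible (x k ξ)) ∧
      ∀ k < N, ∀ ξ, (P ξ).IsNewtonDirection (paramUnit M b k / ε ξ) (x k ξ) (d k ξ) ∧
        D k ξ = (P ξ).newtonForm (paramUnit M b k / ε ξ) (x k ξ) (d k ξ) (d k ξ) ∧
        x (k + 1) ξ = x k ξ + (1 / (2 * (1 + D k ξ))) • d k ξ) := by
  induction N with
  | zero =>
    refine .pure ⟨fun _ => x₀, fun _ _ => 0, fun _ _ => 0, rfl, fun _ _ => hx₀, fun _ _ => hSF,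
      fun k hk => absurd hk (Nat.not_lt_zero k)⟩
  | succ N ih =>
    have hτ : ∀ ξ, 0 < (paramUnit M b N : ℝ) / ε ξ := fun ξ =>
      div_pos (by exact_mod_cast paramUnit_pos M b N) (hε ξ)
    -- The schedule is rational and independent of the input: one constant and one division by the
    -- tolerance.
    have hτc : Cost S 2 (fun ξ => (paramUnit M b N : ℝ) / ε ξ) :=
      (Cost.const S _).div (.of_mem hεS) fun ξ => (hε ξ).ne'
    refine (ih.bind fun T₁ hT₁ h₁ => (hτc.mono (upward_mem _) hT₁).bind
      (m := 3000 * (G * K * M ^ 6)) fun T₂ hT₂ hτS => ?_).le ?_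
    · obtain ⟨x, d, D, hx0, hxS, hxSF, hstep⟩ := h₁
      have hST := hT₁.trans hT₂
      -- Strict feasibility of the current iterate for every admissible input is what makes the
      -- divisions by the slacks legal.
      refine (comp_newtonStep hM hG hK (hP.mono hST) (hrow.mono hST)
        ((hxS N le_rfl).mono hT₂) hτS hτ (hxSF N le_rfl)).weaken le_rfl fun T₃ hT₃ h₃ => ?_
      obtain ⟨e, E, he, hnew⟩ := h₃
      refine ⟨Function.update x (N + 1) fun ξ => x N ξ + (1 / (2 * (1 + E ξ))) • e ξ,
        Function.update d N e, Function.update D N E, ?_, fun k hk => ?_, fun k hk ξ => ?_,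
        fun k hk ξ => ?_⟩
      · rw [Function.update_of_ne (by lia), hx0]
      · rcases Nat.lt_or_eq_of_le hk with h | rfl
        · rw [Function.update_of_ne h.ne]
          exact (hxS k (by lia)).mono (hT₂.trans hT₃)
        · rw [Function.update_self]
          exact hnew
      · rcases Nat.lt_or_eq_of_le hk with h | rfl
        · rw [Function.update_of_ne h.ne]
          exact hxSF k (by lia) ξ
        · rw [Function.update_self]
          exact ((hxSF N le_rfl ξ).newton_step (hτ ξ) (he ξ).1 (he ξ).2 rfl).1
      · rw [Function.update_of_ne (show k ≠ N + 1 by lia)]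
        rcases Nat.lt_or_eq_of_le (Nat.lt_succ_iff.1 hk) with h | rfl
        · rw [Function.update_of_ne (show k + 1 ≠ N + 1 by lia), Function.update_of_ne h.ne,
            Function.update_of_ne h.ne]
          exact hstep k h ξ
        · rw [Function.update_self, Function.update_self, Function.update_self]
          exact ⟨(he ξ).1, (he ξ).2, rfl⟩
    · have : 1 ≤ G * K * M ^ 6 :=
        Nat.mul_pos (Nat.mul_pos hG hK) (Nat.pow_pos (by lia))
      rw [Nat.succ_mul]
      lia

end Program

theorem totalSteps_le {M : ℕ} (hM : 0 < M) (b : ℕ) :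
    (totalSteps M b : ℝ) ≤ 12000 * (M : ℝ) ^ 2 * √M * (b + 1) := by
  have hs : (M.sqrt : ℝ) ≤ √M := Real.nat_sqrt_le_real_sqrt
  have h1 : 1 ≤ √(M : ℝ) := Real.one_le_sqrt.2 (by exact_mod_cast hM)
  have hM1 : (1 : ℝ) ≤ (M : ℝ) ^ 2 := one_le_pow₀ (by exact_mod_cast hM)
  have hb : (0 : ℝ) ≤ b := Nat.cast_nonneg b
  have h2 : (b : ℝ) + 4 * (M.sqrt + 1) + 4 ≤ 13 * (√M * (b + 1)) := by nlinarith
  have h3 : (1 : ℝ) ≤ √M * (b + 1) := by nlinarith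
  have h4 : (b : ℝ) + 1 ≤ √M * (b + 1) := by nlinarith
  rw [totalSteps, centeringSteps, followingSteps, growthDen]
  push_cast
  set w := √(M : ℝ) * (b + 1)
  have h5 : (M : ℝ) ^ 2 * (b + 4 * (M.sqrt + 1) + 4) ≤ (M : ℝ) ^ 2 * (13 * w) := by gcongr
  have h6 : (M : ℝ) ^ 2 * (b + 1) ≤ (M : ℝ) ^ 2 * w := by gcongr
  have h7 : 1 ≤ (M : ℝ) ^ 2 * w := by nlinarith
  have e : 12000 * (M : ℝ) ^ 2 * √M * (b + 1) = 12000 * ((M : ℝ) ^ 2 * w) := by ring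
  rw [e]
  linarith

end DFRC

end

/-! ### Assembly of the program. -/

theorem lemma1 :
    ∃ C : ℝ, 0 < C ∧ ∀ G K M U L b : ℕ, 0 < G → 0 < K → U + L < M →
      ∃ (p : DFRC.Program (DFRC.InputIdx G K M U L)) (T : ℕ)
        (out : ℕ → DFRC.Coord M U → DFRC.Cell (DFRC.InputIdx G K M U L)),
        (p.cost : ℝ) ≤ C * ((G : ℝ) * (K : ℝ) * (M : ℝ) ^ (8.5 : ℝ)) * ((b : ℝ) + 1) ∧
        ∀ (P : DFRC.ProblemData G K M U L) (x₀ : DFRC.Point M U) (ε : ℝ), 0 < ε →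
          P.StrictlyFeasible x₀ → P.HasDepth x₀ ((2 : ℝ)⁻¹ ^ b) →
          P.objective x₀ ≤ 2 ^ b * ε →
          ∃ x : ℕ → DFRC.Point M U, x 0 = x₀ ∧ P.IsBarrierRun T x ∧
            p.Produces (DFRC.input P x₀ ε) T out x ∧
            ∀ y, P.Feasible y → P.objective (x T) ≤ P.objective y + ε := by
  refine ⟨10 ^ 8, by norm_num, fun G K M U L b hG hK hM => ?_⟩
  -- The contexts are exactly the inputs that satisfy the hypotheses, so legality at every context
  -- is legality under them, while the program depends on the dimensions and `b` only.
  let X := {q : DFRC.ProblemData G K M U L × DFRC.Point M U × ℝ // 0 < q.2.2 ∧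
    q.1.StrictlyFeasible q.2.1 ∧ q.1.HasDepth q.2.1 ((2 : ℝ)⁻¹ ^ b) ∧
    q.1.objective q.2.1 ≤ 2 ^ b * q.2.2}
  let P : X → DFRC.ProblemData G K M U L := fun ξ => ξ.1.1
  let x₀ : X → DFRC.Point M U := fun ξ => ξ.1.2.1
  let ε : X → ℝ := fun ξ => ξ.1.2.2
  let inp : X → DFRC.InputIdx G K M U L → ℝ := fun ξ => DFRC.input (P ξ) (x₀ ξ) (ε ξ)
  let S : Set (X → ℝ) := Set.range fun i ξ => inp ξ i
  have hP : DFRC.DataMem P S :=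
    { steer := fun g t m => ⟨⟨.steerRe g t m, rfl⟩, ⟨.steerIm g t m, rfl⟩⟩
      desired := fun g t => ⟨.desired g t, rfl⟩
      chanS := fun i m n => ⟨⟨.chanSRe i m n, rfl⟩, ⟨.chanSIm i m n, rfl⟩⟩
      chanP := fun l m n => ⟨⟨.chanPRe l m n, rfl⟩, ⟨.chanPIm l m n, rfl⟩⟩
      noise := fun i => ⟨.noise i, rfl⟩
      sinr := fun i => ⟨.sinr i, rfl⟩
      power := ⟨.power, rfl⟩
      thres := ⟨.thres, rfl⟩ }
  have hx₀ : DFRC.PointMem x₀ S := by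
    refine ⟨fun c m n => ?_, ⟨.start .omega, rfl⟩⟩
    rcases c with i | t
    · exact ⟨⟨.start (.fRe i m n), rfl⟩, ⟨.start (.fIm i m n), rfl⟩⟩
    · exact ⟨⟨.start (.vRe t m n), rfl⟩, ⟨.start (.vIm t m n), rfl⟩⟩
  have hε : ε ∈ S := ⟨.tolerance, rfl⟩
  set N := DFRC.totalSteps M b with hN
  obtain ⟨T, n, hn, hExt, x, d, D, hx0, hxT, hxSF, hstep⟩ :=
    (DFRC.comp_rows hM hG hK hP).bind fun T hT hrow =>
      DFRC.comp_iterates hM hG hK (hP.mono hT) hrow (hx₀.mono hT) (hT hε) (fun ξ => ξ.2.1)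
        (fun ξ => ξ.2.2.1) b N
  obtain ⟨p, hp, hlegal, hcell⟩ := DFRC.Ext.exists_program inp hExt
  have hmem : ∀ k ≤ N, ∀ c : DFRC.Coord M U, (fun ξ => c.value (x k ξ)) ∈ T := by
    intro k hk c
    cases c with
    | fRe i m n => exact ((hxT k hk).blocks (.inl i) m n).1
    | fIm i m n => exact ((hxT k hk).blocks (.inl i) m n).2
    | vRe t m n => exact ((hxT k hk).blocks (.inr t) m n).1
    | vIm t m n => exact ((hxT k hk).blocks (.inr t) m n).2
    | omega => exact (hxT k hk).omega
  choose cell hcell' hcellval using hcell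
  -- The cell `.inr 0` for `k > N` is a dummy; only iterates up to `N` are read.
  refine ⟨p, N, fun k c => if hk : k ≤ N then cell _ (hmem k hk c) else .inr 0, ?_,
    fun P' x₀' ε' hε' hSF hdep hobj => ?_⟩
  · have hM0 : 0 < M := by lia
    have hcost : p.cost ≤ 200 * (G * K * M ^ 3) + N * (3002 * (G * K * M ^ 6)) :=
      hp.le.trans hn
    have hcost' : (p.cost : ℝ) ≤ 200 * (G * K * M ^ 3) + N * (3002 * (G * K * M ^ 6)) := by
      exact_mod_cast hcost
    have hpow : (M : ℝ) ^ (8.5 : ℝ) = M ^ 8 * √M := by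
      rw [Real.sqrt_eq_rpow, ← Real.rpow_natCast, ← Real.rpow_add (by exact_mod_cast hM0)]
      norm_num
    have hM1 : (1 : ℝ) ≤ M := by exact_mod_cast hM0
    have h1 : 1 ≤ √(M : ℝ) := Real.one_le_sqrt.2 hM1
    have hb : (1 : ℝ) ≤ b + 1 := by linarith [(Nat.cast_nonneg b : (0 : ℝ) ≤ b)]
    have h2 : (M : ℝ) ^ 3 ≤ M ^ 8 * √M * (b + 1) := by
      calc (M : ℝ) ^ 3 ≤ M ^ 8 := pow_le_pow_right₀ hM1 (by norm_num)
        _ ≤ M ^ 8 * √M := le_mul_of_one_le_right (by positivity) h1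
        _ ≤ _ := le_mul_of_one_le_right (by positivity) hb
    have h3 : (N : ℝ) * M ^ 6 ≤ 12000 * (M ^ 8 * √M * (b + 1)) := by
      calc (N : ℝ) * M ^ 6 ≤ 12000 * (M : ℝ) ^ 2 * √M * (b + 1) * M ^ 6 := by
            gcongr; exact DFRC.totalSteps_le hM0 b
        _ = _ := by ring
    rw [hpow]
    have h4 : (G : ℝ) * K * M ^ 3 ≤ G * K * (M ^ 8 * √M * (b + 1)) := by gcongr
    have h5 : (G : ℝ) * K * (N * M ^ 6) ≤ G * K * (12000 * (M ^ 8 * √M * (b + 1))) := by gcongr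
    have h6 : (0 : ℝ) ≤ G * K * (M ^ 8 * √M * (b + 1)) := by positivity
    linarith
  · let ξ : X := ⟨(P', x₀', ε'), hε', hSF, hdep, hobj⟩
    have hpar : ∀ k, 0 < (DFRC.paramUnit M b k : ℝ) / ε' := fun k =>
      div_pos (by exact_mod_cast DFRC.paramUnit_pos M b k) hε'
    have hx0ξ : x 0 ξ = x₀' := congrFun hx0 ξ
    refine ⟨fun k => x k ξ, hx0ξ, ⟨fun k => DFRC.paramUnit M b k / ε',
      fun k => 1 / (2 * (1 + D k ξ)), fun k => d k ξ, fun i j hij => ?_, hpar,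
      fun k hk => hxSF k hk ξ, fun k hk => ?_⟩, ⟨hlegal ξ, fun k hk c => ?_⟩, fun y hy => ?_⟩
    · have : (DFRC.paramUnit M b i : ℝ) ≤ DFRC.paramUnit M b j := by
        exact_mod_cast DFRC.paramUnit_mono M b hij
      beta_reduce
      gcongr
    · obtain ⟨h1, h2, h3⟩ := hstep k hk ξ
      have hD : 0 ≤ D k ξ := h2 ▸ (hxSF k hk.le ξ).newtonForm_self_nonneg (hpar k).le h1.1
      refine ⟨by positivity, ?_, h1, h3⟩
      rw [div_le_one (by positivity)]
      linarith
    · beta_reduce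
      rw [dif_pos hk]
      exact hcellval _ (hmem k hk c) ξ
    · exact DFRC.ProblemData.objective_le_of_schedule hM hε' (d := fun k => d k ξ)
        (D := fun k => D k ξ) (fun k hk => hxSF k hk ξ) (by rw [hx0ξ]; exact hdep)
        (by rw [hx0ξ]; exact hobj) (fun k hk => hstep k hk ξ) hy
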